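/- Let $d,p\ge 1$ be integers and let $f:\mathbb R^d\to[0,\infty)$ be a measurable probability density. Write $G(t)=\{x\in\mathbb R^d: f(x)\ge t\}$, $B_r(x)$ for the open ball and $\|\cdot\|$ for the Euclidean norm. Let $l\le u<\sup f<\infty$ and assume that $G(t)$ is compact, nonempty and nonconvex for every $t\in[l,u]$. Moreover assume: (A) There are $\zeta>0$ with $G(u+\zeta)$ bounded, a bounded open set $U\supset\overline{G(l-\zeta)}\setminus\operatorname{int}G(u+\zeta)$ and constants $m>0$, $k$ such that $f\in\mathcal C^p(U)$, $\|\nabla f\|\ge m$ on $U$ and $\|\nabla f(x)-\nabla f(y)\|\le k\|x-y\|$ for all $x,y\in U$. (K) $K:\mathbb R^d\to\mathbb R$ is continuous with bounded support, has finite (total) variation on $\mathbb R^d$ and is a kernel of order at least $p$, that is, $\int K=1$ and $\int x^\alpha K(x)\,dx=0$ for all multi-indices with $1\le|\alpha|<p$. The bandwidths $h_n$ are positive for all large $n$ and, up to constant factors from above and below, of order $(\log n/n)^{1/(d+2p)}$. If $K$ takes negative values, assume in addition that $f$ is uniformly continuous on $\mathbb R^d$. Let $X_1,X_2,\dots$ be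 independent random vectors with density $f$, let $\mathcal X_n=\{X_1,\dots,X_n\}$ and $f_n(x)=\frac1{nh_n^d}\sum_{i=1}^nK\big(\frac{x-X_i}{h_n}\big)$. For $M>0$ put $D_n=M(\log n/n)^{p/(d+2p)}$ and $$\mathcal X_n^+(t)=\{X\in\mathcal X_n:f_n(X)\ge t+D_n\},\qquad \mathcal X_n^-(t)=\{X\in\mathcal X_n:f_n(X)<t-D_n\}.$$ For a set $A\subset\mathbb R^d$ and $r>0$ let $C_r(A)=\bigcap_{x:\,B_r(x)\cap A=\emptyset}B_r(x)^c$ be its $r$-convex hull, let $$\hat r_0(t)=\sup\{\gamma>0:\ C_\gamma(\mathcal X_n^+(t))\cap\mathcal X_n^-(t)=\emptyset\},$$ and, for $\nu\in(0,1)$, let $r_n(t)=\nu\,\hat r_0(t)$. Then there is $M_0>0$ such that for every $M\ge M_0$ and every fixed $\nu\in(0,1)$ there is a constant $C$ such that, almost surely, for all sufficiently large $n$, $$\sup_{t\in[l,u]}d_H\big(C_{r_n(t)}(\mathcal X_n^+(t)),G(t)\big)\le C\max\left\{\Big(\frac{\log n}{n}\Big)^{\frac p{d+2p}},\Big(\frac{\log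 n}{n}\Big)^{\frac2{d+1}}\right\}$$ and $$\sup_{t\in[l,u]}\mu\big(C_{r_n(t)}(\mathcal X_n^+(t))\,\triangle\,G(t)\big)\le C\max\left\{\Big(\frac{\log n}{n}\Big)^{\frac p{d+2p}},\Big(\frac{\log n}{n}\Big)^{\frac2{d+1}}\right\},$$ where $d_H$ is the Hausdorff distance and $\mu$ is Lebesgue measure. -/

import Mathlib

open MeasureTheory ProbabilityTheory Filter Asymptotics

noncomputable section

namespace LevelSetEstimation

/-- The Euclidean space of dimension `d`, with the Euclidean norm and Lebesgue measure. -/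
abbrev E (d : ℕ) : Type := EuclideanSpace ℝ (Fin d)

variable {d : ℕ}

/-- The level set `G(t) = {x : f x ≥ t}`. -/
def levelSet (f : E d → ℝ) (t : ℝ) : Set (E d) := {x | t ≤ f x}

/-- The `r`-convex hull: the intersection of the complements of all open balls of radius `r`
that do not meet `A`. -/
def rConvexHull (r : ℝ) (A : Set (E d)) : Set (E d) :=
  ⋂ x ∈ {x : E d | Metric.ball x r ∩ A = ∅}, (Metric.ball x r)ᶜ

/-- Smoothness of the density around the levels in `[l, u]`: `l ≤ u < sup f < ∞`, and, for some
`ζ > 0` such that `G(u + ζ)` is bounded and some bounded open set `U` containing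
`closure G(l - ζ) \ interior G(u + ζ)`, the function `f` is `C^p` on `U`, with a gradient that is
bounded below in norm by some `m > 0` and Lipschitz on `U`. -/
def AssumptionA (p : ℕ) (f : E d → ℝ) (l u : ℝ) : Prop :=
  l ≤ u ∧ BddAbove (Set.range f) ∧ u < ⨆ x, f x ∧
  ∃ (U : Set (E d)) (ζ m k : ℝ),
    0 < ζ ∧ Bornology.IsBounded (levelSet f (u + ζ)) ∧
    IsOpen U ∧ Bornology.IsBounded U ∧
    closure (levelSet f (l - ζ)) \ interior (levelSet f (u + ζ)) ⊆ U ∧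
    ContDiffOn ℝ p f U ∧
    0 < m ∧ (∀ x ∈ U, m ≤ ‖gradient f x‖) ∧
    ∀ x ∈ U, ∀ y ∈ U, ‖gradient f x - gradient f y‖ ≤ k * ‖x - y‖

/-- The divergence of a vector field. -/
def divergence (φ : E d → E d) (x : E d) : ℝ :=
  ∑ i, (fderiv ℝ φ x (EuclideanSpace.single i 1)) i

/-- Finite total variation on the whole space: the integrals of `K` against the divergences of the
compactly supported `C¹` vector fields of norm at most one are bounded. -/
def HasFiniteVariation (K : E d → ℝ) : Prop :=
  ∃ V : ℝ, ∀ φ : E d → E d, ContDiff ℝ 1 φ → HasCompactSupport φ → (∀ x, ‖φ x‖ ≤ 1) →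
    ∫ x, K x * divergence φ x ≤ V

/-- `K` integrates to one and its moments of total degree `1, …, p - 1` vanish. -/
def IsKernelOfOrderAtLeast (p : ℕ) (K : E d → ℝ) : Prop :=
  ∫ x, K x = 1 ∧
  ∀ α : Fin d → ℕ, 0 < ∑ i, α i → ∑ i, α i < p → ∫ x : E d, (∏ i, x i ^ α i) * K x = 0

/-- A continuous kernel of order at least `p`, with bounded support and finite variation, and a
bandwidth sequence `h` that is positive and of exact order `(log n / n)^(1/(d+2p))`. -/
def AssumptionK (p : ℕ) (K : E d → ℝ) (h : ℕ → ℝ) : Prop :=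
  Continuous K ∧ HasCompactSupport K ∧ IsKernelOfOrderAtLeast p K ∧ HasFiniteVariation K ∧
  (∀ᶠ n in atTop, 0 < h n) ∧
  h =Θ[atTop] fun n : ℕ => (Real.log n / n) ^ (1 / ((d : ℝ) + 2 * p))

/-- The kernel density estimator with bandwidth `h` from the first `n` points of `X`. -/
def kde (K : E d → ℝ) (h : ℝ) (n : ℕ) (X : ℕ → E d) (x : E d) : ℝ :=
  1 / (n * h ^ d) * ∑ i ∈ Finset.range n, K (h⁻¹ • (x - X i))

/-- The rate `(log n / n)^(p/(d+2p))`. -/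
def kdeRate (d p n : ℕ) : ℝ := (Real.log n / n) ^ ((p : ℝ) / (d + 2 * p))

/-- The sample points at which the estimator is at least `t + D`. -/
def samplePlus (K : E d → ℝ) (h D : ℝ) (n : ℕ) (X : ℕ → E d) (t : ℝ) : Set (E d) :=
  {x | ∃ i < n, x = X i ∧ t + D ≤ kde K h n X x}

/-- The sample points at which the estimator is less than `t - D`. -/
def sampleMinus (K : E d → ℝ) (h D : ℝ) (n : ℕ) (X : ℕ → E d) (t : ℝ) : Set (E d) :=
  {x | ∃ i < n, x = X i ∧ kde K h n X x < t - D}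

/-- The estimator of the shape parameter: the supremum of all `γ > 0` for which the `γ`-convex
hull of the plus sample contains no point of the minus sample.
If this set of `γ` were empty or unbounded, the value would be `0`; as the `0`-convex hull of any
set is the whole space, a level set estimator built from it would be at infinite Hausdorff
distance from every bounded set (for `d ≥ 1`). -/
def rHat (K : E d → ℝ) (h D : ℝ) (n : ℕ) (X : ℕ → E d) (t : ℝ) : ℝ :=
  sSup {γ : ℝ | 0 < γ ∧
    rConvexHull γ (samplePlus K h D n X t) ∩ sampleMinus K h D n X t = ∅}

/-- The level set estimator: the `ν r̂₀(t)`-convex hull of the plus sample. -/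
def levelSetEstimator (K : E d → ℝ) (h D ν : ℝ) (n : ℕ) (X : ℕ → E d) (t : ℝ) : Set (E d) :=
  rConvexHull (ν * rHat K h D n X t) (samplePlus K h D n X t)

/-- The convergence rate of the level set estimator. -/
def levelSetRate (d p n : ℕ) : ℝ :=
  max (kdeRate d p n) ((Real.log n / n) ^ ((2 : ℝ) / (d + 1)))

/-- `X 0, X 1, …` are independent random vectors, each with density `f` for Lebesgue measure. -/
def IsSampleFrom {Ω : Type*} [MeasurableSpace Ω] (P : Measure Ω) (X : ℕ → Ω → E d)
    (f : E d → ℝ) : Prop :=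
  (∀ i, Measurable (X i)) ∧ iIndepFun X P ∧
  ∀ i, P.map (X i) = volume.withDensity fun x => ENNReal.ofReal (f x)

end LevelSetEstimation

end

/-! Let `s` be of the order of the rate. Consider boxes of thickness `s` in one direction and width
`√s` in the others. Almost surely, for large `n` and all levels `t`, every such box in `G(t + s)`
contains a point of the plus sample, and every such box outside `G(t - s)`, but near enough for `f`
to be bounded below, contains a point of the minus sample. Here `s` has to exceed the uniform error
of the kernel estimator, which is the first term of the rate, and the number `n * s ^ ((d + 1) / 2)`
of points expected in a box has to exceed a multiple of `log n`, which gives the second term.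

The rest is deterministic. A ball of small fixed radius rolls freely along the outside of `G(t)`,
which bounds `r̂₀(t)` below; as `G(t)` is not convex, some segment between interior points leaves
`G(t)`, and the hull of the plus sample at a large radius contains points of the minus sample near
that segment, which bounds `r̂₀(t)` above. A ball that misses the plus sample is almost tangent to
the boundary of `G(t)`, hence enters `G(t)` only up to depth `O(s)`. Conversely, if the hull at
radius `ν * r̂₀(t)` left `G(t)` by more than a multiple of `s`, then the hull at a slightly larger
radius, still below `r̂₀(t)`, would contain a whole box outside `G(t)` and therefore a point of the
minus sample. As the gradient is bounded below, points whose density is within `O(s)` of `t` form a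
strip of width and volume `O(s)`. -/

namespace LevelSetEstimation

open Topology InnerProductSpace

section RConvexHull

variable {d : ℕ} {A B : Set (E d)} {x : E d} {r γ : ℝ}

theorem mem_rConvexHull :
    x ∈ rConvexHull r A ↔ ∀ c, dist x c < r → ∃ z ∈ A, dist z c < r := by
  simp only [rConvexHull, Set.mem_iInter, Set.mem_ofPred_eq, Set.mem_compl_iff, Metric.mem_ball]
  refine forall_congr' fun c => ?_
  rw [imp_not_comm, ← Ne.eq_def, ← Set.nonempty_iff_ne_empty, Set.inter_nonempty]
  simp only [Metric.mem_ball, and_comm]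

theorem rConvexHull_mono_set (h : A ⊆ B) : rConvexHull r A ⊆ rConvexHull r B := fun _ hx =>
  mem_rConvexHull.2 fun c hc =>
    let ⟨z, hz, hzc⟩ := mem_rConvexHull.1 hx c hc
    ⟨z, h hz, hzc⟩

theorem rConvexHull_mono_radius (hr : 0 < r) (h : r ≤ γ) :
    rConvexHull r A ⊆ rConvexHull γ A := fun x hx => mem_rConvexHull.2 fun c hc => by
  have hγ : 0 < γ := hr.trans_le h
  have hle : r / γ ≤ 1 := (div_le_one hγ).2 h
  obtain ⟨z, hz, hzc⟩ := mem_rConvexHull.1 hx (AffineMap.lineMap x c (r / γ)) (by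
    rw [dist_left_lineMap, Real.norm_of_nonneg (by positivity)]
    calc r / γ * dist x c < r / γ * γ := by gcongr
      _ = r := div_mul_cancel₀ r hγ.ne')
  refine ⟨z, hz, Metric.ball_subset_ball' ?_ hzc⟩
  rw [dist_lineMap_right, Real.norm_of_nonneg (sub_nonneg.2 hle)]
  calc r + (1 - r / γ) * dist x c ≤ r + (1 - r / γ) * γ := by
        gcongr
    _ = γ := by field_simp; ring

end RConvexHull

section Geometry

variable {V : Type*} [NormedAddCommGroup V] [InnerProductSpace ℝ V]

/-- The plate of thickness of order `s` and width of order `√s` with centre `x` and normal `η`: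
the part of a `√s`-neighbourhood that fits between a smooth surface with normal `η` at `x` and its
translates by multiples of `s`. -/
def box (x η : V) (s : ℝ) : Set V := {z | |⟪z - x, η⟫_ℝ| ≤ s ∧ ‖z - x‖ ≤ √s}

theorem box_mono (x η : V) {s s' : ℝ} (h : s ≤ s') : box x η s ⊆ box x η s' := fun _ hz =>
  ⟨hz.1.trans h, hz.2.trans (Real.sqrt_le_sqrt h)⟩

/-- `A` is dense in `S` at the resolution `s`: it meets every box of thickness `s` that is
contained in `S`. -/
def IsBoxDense (A S : Set V) (s : ℝ) : Prop :=
  ∀ x η, ‖η‖ = 1 → box x η s ⊆ S → (A ∩ box x η s).Nonempty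

theorem IsBoxDense.mono {A S : Set V} {s s' : ℝ} (hA : IsBoxDense A S s) (h : s ≤ s') :
    IsBoxDense A S s' := fun x η hη hsub =>
  (hA x η hη ((box_mono x η h).trans hsub)).mono
    (Set.inter_subset_inter_right A (box_mono x η h))

theorem exists_unit_smul [Nontrivial V] (w : V) : ∃ e : V, ‖e‖ = 1 ∧ w = ‖w‖ • e := by
  obtain ⟨η, hη⟩ := exists_norm_eq V (zero_le_one (α := ℝ))
  rcases eq_or_ne w 0 with rfl | hw
  · exact ⟨η, hη, by simp⟩
  · exact ⟨‖w‖⁻¹ • w, norm_smul_inv_norm hw, (smul_inv_smul₀ (norm_ne_zero_iff.2 hw) w).symm⟩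

theorem norm_add_smul_add_smul_le {w η τ : V} {a b : ℝ} (hη : ‖η‖ = 1) (hτ : ‖τ‖ ≤ 1) :
    ‖a • η + b • τ + w‖ ≤ |a| + |b| + ‖w‖ := by
  refine norm_add₃_le.trans ?_
  rw [norm_smul, norm_smul, hη, mul_one, Real.norm_eq_abs, Real.norm_eq_abs]
  gcongr
  exact mul_le_of_le_one_right (abs_nonneg b) hτ

/-- The tangential vector is scaled such that no unit tangent vector is needed when `e = ±η`, as is
the case in dimension one. -/
theorem exists_orthogonal_decomposition {e η : V} (he : ‖e‖ = 1) (hη : ‖η‖ = 1) :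
    ∃ (τ : V) (β : ℝ), 0 ≤ β ∧ ⟪e, η⟫_ℝ ^ 2 + β ^ 2 = 1 ∧ e = ⟪e, η⟫_ℝ • η + β • τ ∧
      ⟪τ, η⟫_ℝ = 0 ∧ ‖τ‖ ≤ 1 ∧ ⟪τ, e⟫_ℝ = β := by
  set w := e - ⟪e, η⟫_ℝ • η with hw
  have hwη : ⟪w, η⟫_ℝ = 0 := by
    rw [hw, inner_sub_left, real_inner_smul_left, real_inner_self_eq_norm_sq, hη]; ring
  have he' : e = ⟪e, η⟫_ℝ • η + w := by rw [hw]; abel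
  have hwe : ⟪w, e⟫_ℝ = ‖w‖ ^ 2 := by
    conv_lhs => rw [he', inner_add_right, real_inner_smul_right, hwη, real_inner_self_eq_norm_sq]
    ring
  have hsq : ⟪e, η⟫_ℝ ^ 2 + ‖w‖ ^ 2 = 1 := by
    rw [← hwe, hw, inner_sub_left, real_inner_smul_left, real_inner_self_eq_norm_sq, he,
      real_inner_comm e η]; ring
  rcases eq_or_ne w 0 with h0 | h0
  · exact ⟨0, 0, le_rfl, by simpa [h0] using hsq, by simpa [h0] using he', by simp⟩
  · have hn : ‖w‖ ≠ 0 := norm_ne_zero_iff.2 h0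
    refine ⟨‖w‖⁻¹ • w, ‖w‖, norm_nonneg _, hsq, ?_, ?_, (norm_smul_inv_norm h0).le, ?_⟩
    · rwa [smul_inv_smul₀ hn]
    · rw [real_inner_smul_left, hwη, mul_zero]
    · rw [real_inner_smul_left, hwe]; field_simp

/-- A box with normal `η` can be moved by `a` along `η` and by `b` orthogonally to `η`, in the
direction in which the inner product with `e` increases. -/
theorem exists_shifted_box {e η : V} (he : ‖e‖ = 1) (hη : ‖η‖ = 1) :
    ∃ β, 0 ≤ β ∧ ⟪e, η⟫_ℝ ^ 2 + β ^ 2 = 1 ∧ ∀ (y : V) (a b s : ℝ), 0 ≤ b → ∃ x, ∀ z ∈ box x η s,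
      |⟪z - y, η⟫_ℝ - a| ≤ s ∧ ‖z - y‖ ≤ |a| + b + √s ∧
      a * ⟪e, η⟫_ℝ + b * β - s * |⟪e, η⟫_ℝ| - √s * β ≤ ⟪z - y, e⟫_ℝ := by
  obtain ⟨τ, β, hβ, hsq, hdec, hτη, hτ, hτe⟩ := exists_orthogonal_decomposition he hη
  refine ⟨β, hβ, hsq, fun y a b s hb => ⟨y + a • η + b • τ, fun z ⟨hzη, hzs⟩ => ?_⟩⟩
  set w := z - (y + a • η + b • τ) with hw
  have hz : z - y = a • η + b • τ + w := by rw [hw]; abel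
  have hη' : ⟪η, η⟫_ℝ = 1 := by rw [real_inner_self_eq_norm_sq, hη, one_pow]
  refine ⟨?_, ?_, ?_⟩
  · rwa [hz, inner_add_left, inner_add_left, real_inner_smul_left, real_inner_smul_left, hτη, hη',
      mul_one, mul_zero, add_zero, add_sub_cancel_left]
  · rw [hz]
    refine (norm_add_smul_add_smul_le hη hτ).trans ?_
    rw [abs_of_nonneg hb]
    gcongr
  · have hwe : ⟪w, e⟫_ℝ = ⟪w, η⟫_ℝ * ⟪e, η⟫_ℝ + β * ⟪w, τ⟫_ℝ := by
      conv_lhs => rw [hdec, inner_add_right, real_inner_smul_right, real_inner_smul_right]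
      rw [mul_comm ⟪e, η⟫_ℝ]
    have hnormal : -(s * |⟪e, η⟫_ℝ|) ≤ ⟪w, η⟫_ℝ * ⟪e, η⟫_ℝ := by
      refine neg_le_of_abs_le ?_
      rw [abs_mul]
      gcongr
    have htangent : -√s ≤ ⟪w, τ⟫_ℝ := by
      refine neg_le_of_abs_le ((abs_real_inner_le_norm w τ).trans ?_)
      exact (mul_le_of_le_one_right (norm_nonneg w) hτ).trans hzs
    have := mul_le_mul_of_nonneg_left htangent hβ
    rw [hz, inner_add_left, inner_add_left, real_inner_smul_left, real_inner_smul_left, hτe,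
      real_inner_comm e η, hwe]
    linarith

theorem dist_add_smul_lt_iff {y z e : V} {ρ : ℝ} (he : ‖e‖ = 1) (hρ : 0 < ρ) :
    dist z (y + ρ • e) < ρ ↔ ‖z - y‖ ^ 2 < 2 * ρ * ⟪z - y, e⟫_ℝ := by
  rw [dist_eq_norm, ← sq_lt_sq₀ (norm_nonneg _) hρ.le, ← sub_sub, norm_sub_sq_real, norm_smul, he,
    real_inner_smul_right, Real.norm_of_nonneg hρ.le]
  constructor <;> intro h <;> linarith

end Geometry

/-- Every ball of radius `r ≥ 2 * ρ` that contains `y` contains a ball of radius `ρ` with `y` on its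
boundary. -/
theorem mem_rConvexHull_of_forall_tangent_ball {d : ℕ} [Nontrivial (E d)] {A : Set (E d)} {y : E d}
    {ρ r : ℝ} (hr : 2 * ρ ≤ r)
    (h : ∀ e, ‖e‖ = 1 → ∃ z ∈ A, dist z (y + ρ • e) < ρ) : y ∈ rConvexHull r A := by
  refine mem_rConvexHull.2 fun c hc => ?_
  obtain ⟨e, he, hce⟩ := exists_unit_smul (c - y)
  obtain ⟨z, hzA, hz⟩ := h e he
  refine ⟨z, hzA, Metric.ball_subset_ball' ?_ hz⟩
  have hyc : dist (y + ρ • e) c = |ρ - ‖c - y‖| := by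
    rw [dist_eq_norm, ← Real.norm_eq_abs, ← mul_one ‖ρ - ‖c - y‖‖, ← he, ← norm_smul, sub_smul,
      ← hce]
    congr 1
    abel
  rw [dist_comm, dist_eq_norm] at hc
  rw [hyc]
  rcases abs_cases (ρ - ‖c - y‖) with h | h <;> linarith [norm_nonneg (c - y)]

section SmallParameter

theorem eventually_const_mul_lt (c : ℝ) {ε : ℝ} (hε : 0 < ε) : ∀ᶠ s in 𝓝[>] (0 : ℝ), c * s < ε := by
  have h : Tendsto (fun s : ℝ => c * s) (𝓝[>] 0) (𝓝 (c * 0)) :=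
    ((continuous_const.mul continuous_id).tendsto 0).mono_left nhdsWithin_le_nhds
  rw [mul_zero] at h
  exact h.eventually_lt_const hε

theorem tendsto_sqrt_nhdsGT_zero : Tendsto Real.sqrt (𝓝[>] 0) (𝓝[>] 0) := by
  refine tendsto_nhdsWithin_iff.2 ⟨?_, ?_⟩
  · have := (Real.continuous_sqrt.tendsto 0).mono_left (nhdsWithin_le_nhds (s := Set.Ioi 0))
    rwa [Real.sqrt_zero] at this
  · filter_upwards [self_mem_nhdsWithin] with s hs using Real.sqrt_pos.2 hs

theorem eventually_const_mul_sqrt_lt (c : ℝ) {ε : ℝ} (hε : 0 < ε) :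
    ∀ᶠ s in 𝓝[>] (0 : ℝ), c * √s < ε :=
  tendsto_sqrt_nhdsGT_zero.eventually (eventually_const_mul_lt c hε)

theorem tendsto_const_mul_nhdsGT_zero {c : ℝ} (hc : 0 < c) :
    Tendsto (fun s : ℝ => c * s) (𝓝[>] 0) (𝓝[>] 0) := by
  refine tendsto_nhdsWithin_iff.2 ⟨?_, ?_⟩
  · have := ((continuous_const_mul c).tendsto 0).mono_left (nhdsWithin_le_nhds (s := Set.Ioi 0))
    rwa [mul_zero] at this
  · filter_upwards [self_mem_nhdsWithin] with s hs using mul_pos hc hs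

end SmallParameter

section InnerHull

variable {d : ℕ}

/-- A compact neighbourhood `carrier` of the boundaries of the level sets with levels in `[l, u]`,
together with constants that quantify the smoothness of `f` near it: the gradient is bounded below
by `m`, bounded above by `L` and `k`-Lipschitz, and Taylor's inequality of second order holds up to
distance `δ`. The levels `l - ζ` and `u + ζ / 2` bound the range of `f` on points that are known to
belong to the neighbourhood. -/
structure SmoothZone (f : E d → ℝ) (l u : ℝ) where
  carrier : Set (E d)
  ζ : ℝ
  m : ℝ
  k : ℝ
  L : ℝ
  δ : ℝ
  le : l ≤ u
  ζ_pos : 0 < ζ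
  m_pos : 0 < m
  k_pos : 0 < k
  L_nonneg : 0 ≤ L
  δ_pos : 0 < δ
  low_pos : 0 < l - ζ
  isCompact : IsCompact carrier
  isBounded : Bornology.IsBounded (levelSet f (l - ζ))
  high_of_notMem : ∀ x ∈ closure (levelSet f (l - ζ)), x ∉ carrier →
    ∀ y, ‖y - x‖ ≤ δ → u + ζ / 2 ≤ f y
  m_le : ∀ a ∈ carrier, m ≤ ‖gradient f a‖
  le_L : ∀ a ∈ carrier, ‖gradient f a‖ ≤ L
  gradient_lipschitz : ∀ a ∈ carrier, ∀ z ∈ carrier,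
    ‖gradient f z - gradient f a‖ ≤ k * ‖z - a‖
  taylor : ∀ a ∈ carrier, ∀ z, ‖z - a‖ ≤ δ →
    |f z - f a - ⟪gradient f a, z - a⟫_ℝ| ≤ k * ‖z - a‖ ^ 2

/-- The unit normal at `a` that points out of the level set of `f` through `a`. If the gradient
vanishes at `a`, the value is `0`. -/
noncomputable def outerNormal (f : E d → ℝ) (a : E d) : E d := -(‖gradient f a‖⁻¹ • gradient f a)

theorem gradient_eq_neg_smul_outerNormal (f : E d → ℝ) (a : E d) :
    gradient f a = -(‖gradient f a‖ • outerNormal f a) := by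
  rcases eq_or_ne (gradient f a) 0 with h | h
  · simp [h]
  · rw [outerNormal, smul_neg, neg_neg, smul_inv_smul₀ (norm_ne_zero_iff.2 h)]

variable {f : E d → ℝ} {l u : ℝ}

namespace SmoothZone

variable (Z : SmoothZone f l u) {a z : E d}

theorem norm_outerNormal (ha : a ∈ Z.carrier) : ‖outerNormal f a‖ = 1 := by
  rw [outerNormal, norm_neg]
  exact norm_smul_inv_norm (norm_pos_iff.1 (Z.m_pos.trans_le (Z.m_le a ha)))

theorem taylor_outerNormal (ha : a ∈ Z.carrier) (hz : ‖z - a‖ ≤ Z.δ) :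
    |f z - f a + ‖gradient f a‖ * ⟪z - a, outerNormal f a⟫_ℝ| ≤ Z.k * ‖z - a‖ ^ 2 := by
  have h := Z.taylor a ha z hz
  rwa [gradient_eq_neg_smul_outerNormal, inner_neg_left, real_inner_smul_left, real_inner_comm,
    sub_neg_eq_add] at h

theorem mem_carrier {x : E d} (h1 : l - Z.ζ ≤ f x) (h2 : f x < u + Z.ζ / 2) : x ∈ Z.carrier := by
  by_contra hx
  have := Z.high_of_notMem x (subset_closure h1) hx x (by simpa using Z.δ_pos.le)
  linarith

/-- Move the box by `± D * s` along the gradient and by `2 * √s` orthogonally to it, towards the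
centre of the ball: this costs only a multiple of `s` in terms of the density, but gains enough
depth inside the ball. -/
theorem exists_mem_tangent_ball_of_mem_carrier {y e : E d} (hy : y ∈ Z.carrier) (he : ‖e‖ = 1)
    {D ρ s t : ℝ} {A : Set (E d)} (hs : 0 < s) (hD : 1 ≤ D) (hDρ : 8 < (D - 1) * ρ)
    (hsD : D * √s ≤ 1) (hsδ : 4 * √s ≤ Z.δ) (hA : IsBoxDense A (levelSet f (t + s)) s)
    (hfy : t + (1 + Z.L * (D + 1) + 16 * Z.k) * s ≤ f y) :
    ∃ z ∈ A, dist z (y + ρ • e) < ρ := by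
  have hρ : 0 < ρ := by by_contra! h; nlinarith
  have hsq : √s ^ 2 = s := Real.sq_sqrt hs.le
  have hσ := Real.sqrt_pos.2 hs
  have hDs : D * s ≤ √s := by nlinarith
  obtain ⟨β, hβ, hαβ, hbox⟩ := exists_shifted_box he (Z.norm_outerNormal hy)
  set η := outerNormal f y
  set α := ⟪e, η⟫_ℝ
  have hαβ1 : 1 ≤ |α| + β := by nlinarith [sq_abs α, abs_nonneg α]
  obtain ⟨a, ha, haα⟩ : ∃ a, |a| = D * s ∧ a * α = D * s * |α| := by
    rcases abs_choice α with h | h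
    · exact ⟨D * s, abs_of_nonneg (by positivity), by rw [h]⟩
    · exact ⟨-(D * s), by rw [abs_neg, abs_of_nonneg (by positivity)], by rw [h]; ring⟩
  obtain ⟨x, hx⟩ := hbox y a (2 * √s) s (by positivity)
  have hnear : ∀ z ∈ box x η s, ‖z - y‖ ≤ 4 * √s := fun z hz => by linarith [(hx z hz).2.1]
  have hsub : box x η s ⊆ levelSet f (t + s) := fun z hz => by
    have hnormal : |⟪z - y, η⟫_ℝ| ≤ (D + 1) * s := by
      have := abs_add_le (⟪z - y, η⟫_ℝ - a) a
      rw [sub_add_cancel, ha] at this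
      linarith [(hx z hz).1]
    have hgrad : |‖gradient f y‖ * ⟪z - y, η⟫_ℝ| ≤ Z.L * ((D + 1) * s) := by
      rw [abs_mul, abs_norm]
      exact mul_le_mul (Z.le_L y hy) hnormal (abs_nonneg _) Z.L_nonneg
    have hquad : Z.k * ‖z - y‖ ^ 2 ≤ Z.k * (16 * s) := by
      have := pow_le_pow_left₀ (norm_nonneg _) (hnear z hz) 2
      rw [mul_pow, hsq] at this
      exact mul_le_mul_of_nonneg_left (by linarith) Z.k_pos.le
    have htaylor := Z.taylor_outerNormal hy ((hnear z hz).trans hsδ)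
    change t + s ≤ f z
    linarith [neg_le_of_abs_le htaylor, le_of_abs_le hgrad]
  obtain ⟨z, hzA, hz⟩ := hA x η (Z.norm_outerNormal hy) hsub
  refine ⟨z, hzA, (dist_add_smul_lt_iff he hρ).2 ?_⟩
  have hdepth : (D - 1) * s ≤ ⟪z - y, e⟫_ℝ := by
    have h1 : (D - 1) * s * 1 ≤ (D - 1) * s * (|α| + β) := by gcongr
    have h2 : (D - 1) * s * β ≤ √s * β := by gcongr; linarith
    linarith [(hx z hz).2.2]
  have := pow_le_pow_left₀ (norm_nonneg _) (hnear z hz) 2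
  calc ‖z - y‖ ^ 2 ≤ 2 * 8 * s := by rw [mul_pow, hsq] at this; linarith
    _ < 2 * ((D - 1) * ρ) * s := by gcongr
    _ ≤ 2 * ρ * ⟪z - y, e⟫_ℝ := by
      rw [mul_assoc 2 ρ, mul_assoc 2]
      gcongr 2 * ?_
      nlinarith

theorem exists_mem_tangent_ball_of_notMem_carrier {y e : E d} (hy : y ∉ Z.carrier)
    (hfy : l - Z.ζ ≤ f y) (he : ‖e‖ = 1) {ρ s t : ℝ} {A : Set (E d)} (hs : 0 < s)
    (hsρ : 9 * √s < ρ) (hsδ : 3 * √s ≤ Z.δ) (hts : t + s ≤ u + Z.ζ / 2)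
    (hA : IsBoxDense A (levelSet f (t + s)) s) : ∃ z ∈ A, dist z (y + ρ • e) < ρ := by
  have hσ := Real.sqrt_pos.2 hs
  have hnear : ∀ z ∈ box (y + (2 * √s) • e) e s,
      ‖z - y‖ ≤ 3 * √s ∧ √s ≤ ⟪z - y, e⟫_ℝ := by
    rintro z ⟨-, hz⟩
    have hzy : z - y = (2 * √s) • e + (z - (y + (2 * √s) • e)) := by abel
    have hw := abs_le.1 ((abs_real_inner_le_norm (z - (y + (2 * √s) • e)) e).trans_eq
      (by rw [he, mul_one]))
    rw [hzy]
    constructor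
    · refine (norm_add_le _ _).trans ?_
      rw [norm_smul, he, Real.norm_of_nonneg (by positivity)]
      linarith
    · rw [inner_add_left, real_inner_smul_left, real_inner_self_eq_norm_sq, he]
      linarith [hw.1]
  obtain ⟨z, hzA, hz⟩ := hA _ e he fun z hz => hts.trans <|
    Z.high_of_notMem y (subset_closure hfy) hy z ((hnear z hz).1.trans hsδ)
  obtain ⟨h1, h2⟩ := hnear z hz
  refine ⟨z, hzA, (dist_add_smul_lt_iff he (by linarith)).2 ?_⟩
  nlinarith [norm_nonneg (z - y)]

theorem exists_levelSet_subset_rConvexHull (Z : SmoothZone f l u) [Nontrivial (E d)] {r₁ : ℝ}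
    (hr₁ : 0 < r₁) :
    ∃ C > 0, ∀ᶠ s in 𝓝[>] 0, ∀ t ∈ Set.Icc l u, ∀ A : Set (E d),
      IsBoxDense A (levelSet f (t + s)) s → ∀ r, r₁ ≤ r →
      levelSet f (t + C * s) ⊆ rConvexHull r A := by
  have := Z.L_nonneg
  have := Z.k_pos
  set ρ := r₁ / 2 with hρ
  set D := 1 + 9 / ρ with hD
  have hρ0 : 0 < ρ := by positivity
  have hD1 : 1 ≤ D := by rw [hD]; linarith [show 0 < 9 / ρ by positivity]
  have hDρ : 8 < (D - 1) * ρ := by rw [hD, add_sub_cancel_left, div_mul_cancel₀ _ hρ0.ne']; norm_num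
  refine ⟨1 + Z.L * (D + 1) + 16 * Z.k, by positivity, ?_⟩
  filter_upwards [self_mem_nhdsWithin, eventually_const_mul_sqrt_lt D one_pos,
    eventually_const_mul_sqrt_lt 4 Z.δ_pos, eventually_const_mul_sqrt_lt 9 hρ0,
    eventually_const_mul_lt 1 (half_pos Z.ζ_pos)]
    with s (hs : 0 < s) hsD hsδ hsρ hsζ t ht A hA r hr y (hy : _ ≤ f y)
  refine mem_rConvexHull_of_forall_tangent_ball (ρ := ρ) (by linarith) fun e he => ?_
  by_cases hyZ : y ∈ Z.carrier
  · exact Z.exists_mem_tangent_ball_of_mem_carrier hyZ he hs hD1 hDρ hsD.le hsδ.le hA hy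
  · have hlow : l - Z.ζ ≤ f y := by
      have : 0 ≤ (1 + Z.L * (D + 1) + 16 * Z.k) * s := by positivity
      linarith [ht.1, Z.ζ_pos]
    exact Z.exists_mem_tangent_ball_of_notMem_carrier hyZ hlow he hs hsρ
      (by linarith [Real.sqrt_nonneg s]) (by linarith [ht.2]) hA

end SmoothZone

end InnerHull

section Tilt

variable {r₁ γ ρ α β σ D M : ℝ}

theorem three_quarters_mul_le_of_sq_sub_sq_le (hr₁ : 0 < r₁) (hγ : r₁ ≤ γ) (hρ : 0 ≤ ρ)
    (h : γ ^ 2 - ρ ^ 2 ≤ γ * (M * σ ^ 2)) (hM : M * σ ^ 2 ≤ r₁ / 4) : 3 / 4 * γ ≤ ρ := by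
  have hγ0 : 0 < γ := hr₁.trans_le hγ
  have : γ * (M * σ ^ 2) ≤ γ * (γ / 4) := by gcongr; linarith
  refine le_of_sq_le_sq ?_ hρ
  nlinarith

/-- If `α < 0`, the left-hand sides would force `|α|` and `β` to be small at the same time. -/
theorem cos_pos_of_sq_sub_sq_le (hγ : r₁ ≤ γ) (hργ : ρ < γ)
    (hρ : 3 / 4 * γ ≤ ρ) (hσ : 0 < σ) (hβ : 0 ≤ β) (hβ' : β ≤ 1 / 2) (hαβ : α ^ 2 + β ^ 2 = 1)
    (hD : 50 ≤ r₁ * (D - 1)) (hD' : 0 ≤ D - 1)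
    (h : γ ^ 2 - ρ ^ 2 + 2 * ρ * (σ * β) ≤ 16 * σ ^ 2 + 2 * ρ * ((D * α + |α|) * σ ^ 2)) :
    0 < α := by
  by_contra! hα
  have hρ0 : 0 ≤ ρ := by linarith
  have h1 : σ ^ 2 * (2 * ρ * ((D - 1) * -α)) ≤ σ ^ 2 * 16 := by
    rw [abs_of_nonpos hα] at h
    have : 0 ≤ ρ * (σ * β) := by positivity
    nlinarith
  have h2 : 2 * ρ * ((D - 1) * -α) ≤ 16 := le_of_mul_le_mul_left h1 (by positivity)
  have h3 : 3 / 4 * 50 ≤ ρ * (D - 1) := by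
    have : 3 / 4 * r₁ * (D - 1) ≤ ρ * (D - 1) := by gcongr; linarith
    linarith
  have h4 : 75 * -α ≤ 16 := by nlinarith
  nlinarith

/-- With `α` and `β` the cosine and the sine of the angle between a direction and the outer normal:
the angle is at most of order `σ`. -/
theorem tilt_of_sq_sub_sq_le (hr₁ : 0 < r₁) (hγ : r₁ ≤ γ) (hρ : 0 ≤ ρ) (hργ : ρ < γ) (hσ : 0 < σ)
    (hβ : 0 ≤ β) (hαβ : α ^ 2 + β ^ 2 = 1) (hD : 50 ≤ r₁ * (D - 1)) (hD' : 0 ≤ D - 1)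
    (hM : M = 16 / r₁ + 2 * (D + 1)) (hMr : M * σ ^ 2 ≤ r₁ / 4) (hMσ : M * σ ≤ 1 / 2)
    (h : γ ^ 2 - ρ ^ 2 + 2 * ρ * (σ * β) ≤ 16 * σ ^ 2 + 2 * ρ * ((D * α + |α|) * σ ^ 2)) :
    3 / 4 * γ ≤ ρ ∧ 0 < α ∧ β ≤ M * σ := by
  have hα : |α| ≤ 1 := by
    rw [abs_le_one_iff_mul_self_le_one]; nlinarith
  have hαD : D * α + |α| ≤ D + 1 := by nlinarith [le_of_abs_le hα]
  have h16 : 16 ≤ γ * (16 / r₁) := by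
    rw [mul_div_assoc', le_div_iff₀ hr₁]; linarith
  have h' : γ ^ 2 - ρ ^ 2 + 2 * ρ * (σ * β) ≤ γ * (M * σ ^ 2) := by
    calc _ ≤ 16 * σ ^ 2 + 2 * ρ * ((D * α + |α|) * σ ^ 2) := h
      _ ≤ γ * (16 / r₁) * σ ^ 2 + 2 * ρ * ((D + 1) * σ ^ 2) := by gcongr
      _ ≤ γ * (16 / r₁) * σ ^ 2 + 2 * γ * ((D + 1) * σ ^ 2) := by
        have : 0 ≤ D + 1 := by linarith
        gcongr
      _ = γ * (M * σ ^ 2) := by rw [hM]; ring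
  have hβσ : 0 ≤ 2 * ρ * (σ * β) := by positivity
  have hργ' := three_quarters_mul_le_of_sq_sub_sq_le hr₁ hγ hρ (by linarith) hMr
  have hβM : β ≤ M * σ := by
    have h1 : γ * (σ * β) ≤ 2 * ρ * (σ * β) := by gcongr; linarith
    have h2 : γ * σ * β ≤ γ * σ * (M * σ) := by
      have : ρ ^ 2 ≤ γ ^ 2 := by gcongr
      linarith
    exact le_of_mul_le_mul_left h2 (mul_pos (hr₁.trans_le hγ) hσ)
  exact ⟨hργ', cos_pos_of_sq_sub_sq_le hγ hργ hργ' hσ hβ (hβM.trans hMσ) hαβ hD hD' h, hβM⟩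

end Tilt

theorem norm_sub_le_two_mul_of_inner {V : Type*} [NormedAddCommGroup V] [InnerProductSpace ℝ V]
    {e η : V} (he : ‖e‖ = 1) (hη : ‖η‖ = 1) {β : ℝ} (hβ : 0 ≤ β) (h0 : 0 ≤ ⟪e, η⟫_ℝ)
    (hsq : ⟪e, η⟫_ℝ ^ 2 + β ^ 2 = 1) : ‖e - η‖ ≤ 2 * β := by
  have h1 : ⟪e, η⟫_ℝ ≤ 1 := by nlinarith
  refine le_of_sq_le_sq ?_ (by positivity)
  rw [norm_sub_sq_real, he, hη]
  nlinarith

namespace SmoothZone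

variable {d : ℕ} {f : E d → ℝ} {l u : ℝ} (Z : SmoothZone f l u) {a : E d}

theorem box_subset_levelSet (ha : a ∈ Z.carrier) {w x : E d} {σ s D : ℝ} (hσ : 0 < σ)
    (hsσ : s ≤ σ ^ 2) (hσ1 : σ ≤ 1) (hσδ : 6 * σ ≤ Z.δ)
    (hD : 36 * Z.k + 1 ≤ Z.m * (D - 3)) (hD3 : 3 ≤ D) (hw : w ∈ box 0 (outerNormal f a) s)
    (hx : ∀ z ∈ box x (outerNormal f a) s,
      |⟪z - (a + σ ^ 2 • outerNormal f a + w), outerNormal f a⟫_ℝ - -(D * σ ^ 2)| ≤ s ∧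
        ‖z - (a + σ ^ 2 • outerNormal f a + w)‖ ≤ 4 * σ) :
    box x (outerNormal f a) s ⊆ levelSet f (f a + s) := fun z hz => by
  obtain ⟨h1, h2⟩ := hx z hz
  have hη := Z.norm_outerNormal ha
  set η := outerNormal f a
  set v := z - (a + σ ^ 2 • η + w) with hv
  have hza : z - a = v + σ ^ 2 • η + w := by rw [hv]; abel
  obtain ⟨hwη, hws⟩ := hw
  rw [sub_zero] at hwη hws
  have hsσ' : √s ≤ σ := Real.sqrt_le_iff.2 ⟨hσ.le, hsσ⟩
  have hσσ : ‖σ ^ 2 • η‖ ≤ σ := by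
    rw [norm_smul, hη, Real.norm_of_nonneg (by positivity)]; nlinarith
  have hnorm : ‖z - a‖ ≤ 6 * σ := by
    rw [hza]
    linarith [norm_add₃_le (a := v) (b := σ ^ 2 • η) (c := w)]
  have hnormal : ⟪z - a, η⟫_ℝ ≤ (3 - D) * σ ^ 2 := by
    rw [hza, inner_add_left, inner_add_left, real_inner_smul_left, real_inner_self_eq_norm_sq, hη]
    linarith [le_of_abs_le h1, le_of_abs_le hwη]
  have hgrad : Z.m * ((D - 3) * σ ^ 2) ≤ ‖gradient f a‖ * -⟪z - a, η⟫_ℝ :=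
    mul_le_mul (Z.m_le a ha) (by linarith) (mul_nonneg (by linarith) (by positivity))
      (norm_nonneg _)
  have hquad : Z.k * ‖z - a‖ ^ 2 ≤ Z.k * (6 * σ) ^ 2 := by
    have := Z.k_pos
    gcongr
  have htaylor := neg_le_of_abs_le (Z.taylor_outerNormal ha (hnorm.trans hσδ))
  have := mul_le_mul_of_nonneg_right hD (sq_nonneg σ)
  change f a + s ≤ f z
  linarith

/-- Push the box from the surface `{f = f a}` by `D * σ ^ 2` into the level set and by `2 * σ`
towards the centre of the ball: the sample point it contains must avoid the ball. -/
theorem exists_sine_of_ball_disjoint (ha : a ∈ Z.carrier) {w e : E d} {γ ρ σ s D : ℝ}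
    {A : Set (E d)} (hσ : 0 < σ) (hsσ : s ≤ σ ^ 2) (hσ1 : σ ≤ 1) (hDσ : D * σ ≤ 1)
    (hσδ : 6 * σ ≤ Z.δ) (hD : 36 * Z.k + 1 ≤ Z.m * (D - 3)) (hD3 : 3 ≤ D)
    (hA : IsBoxDense A (levelSet f (f a + s)) s) (hw : w ∈ box 0 (outerNormal f a) s) (hγ : 0 ≤ γ)
    (hρ : 0 ≤ ρ) (he : ‖e‖ = 1)
    (hmiss : ∀ z ∈ A, γ ≤ dist z (a + σ ^ 2 • outerNormal f a + w + ρ • e)) :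
    ∃ β, 0 ≤ β ∧ ⟪e, outerNormal f a⟫_ℝ ^ 2 + β ^ 2 = 1 ∧ γ ^ 2 - ρ ^ 2 + 2 * ρ * (σ * β) ≤
      16 * σ ^ 2 + 2 * ρ * ((D * ⟪e, outerNormal f a⟫_ℝ + |⟪e, outerNormal f a⟫_ℝ|) * σ ^ 2) := by
  have hη := Z.norm_outerNormal ha
  obtain ⟨β, hβ, hαβ, hbox⟩ := exists_shifted_box he hη
  refine ⟨β, hβ, hαβ, ?_⟩
  have hsσ' : √s ≤ σ := Real.sqrt_le_iff.2 ⟨hσ.le, hsσ⟩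
  obtain ⟨x, hx⟩ := hbox (a + σ ^ 2 • outerNormal f a + w) (-(D * σ ^ 2)) (2 * σ) s (by positivity)
  have hnear : ∀ z ∈ box x (outerNormal f a) s,
      ‖z - (a + σ ^ 2 • outerNormal f a + w)‖ ≤ 4 * σ := fun z hz => by
    have := (hx z hz).2.1
    rw [abs_neg, abs_of_nonneg (mul_nonneg (by linarith) (sq_nonneg _))] at this
    nlinarith
  obtain ⟨z, hzA, hz⟩ := hA x _ hη <| Z.box_subset_levelSet ha hσ hsσ hσ1 hσδ hD hD3 hw
    fun z hz => ⟨(hx z hz).1, hnear z hz⟩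
  have hdepth := (hx z hz).2.2
  have hnorm := pow_le_pow_left₀ (norm_nonneg _) (hnear z hz) 2
  have hdist := pow_le_pow_left₀ hγ (hmiss z hzA) 2
  rw [dist_eq_norm, ← sub_sub, norm_sub_sq_real, norm_smul, he, Real.norm_of_nonneg hρ,
    real_inner_smul_right] at hdist
  have h1 : √s * β ≤ σ * β := by gcongr
  have h2 : s * |⟪e, outerNormal f a⟫_ℝ| ≤ σ ^ 2 * |⟪e, outerNormal f a⟫_ℝ| := by gcongr
  have h3 := mul_le_mul_of_nonneg_left (hdepth.trans' <| sub_le_sub (sub_le_sub_left h2 _) h1)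
    (by positivity : 0 ≤ 2 * ρ)
  linarith

/-- A ball that misses the sample and almost reaches the surface `{f = f a}` is almost tangent to
it. -/
theorem exists_tilt_bound (Z : SmoothZone f l u) {r₁ : ℝ} (hr₁ : 0 < r₁) :
    ∃ K > 0, ∀ᶠ σ in 𝓝[>] 0, ∀ s ≤ σ ^ 2, ∀ a ∈ Z.carrier, ∀ A : Set (E d),
      IsBoxDense A (levelSet f (f a + s)) s → ∀ w ∈ box 0 (outerNormal f a) s,
      ∀ γ, r₁ ≤ γ → ∀ ρ, 0 ≤ ρ → ρ < γ → ∀ e : E d, ‖e‖ = 1 →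
      (∀ z ∈ A, γ ≤ dist z (a + σ ^ 2 • outerNormal f a + w + ρ • e)) →
      3 / 4 * γ ≤ ρ ∧ 3 / 4 ≤ ⟪e, outerNormal f a⟫_ℝ ∧ ‖e - outerNormal f a‖ ≤ K * σ := by
  have hk := Z.k_pos
  have hm := Z.m_pos
  have hD1 : 0 < (36 * Z.k + 1) / Z.m := by positivity
  have hD2 : 0 < 50 / r₁ := by positivity
  set D := 4 + (36 * Z.k + 1) / Z.m + 50 / r₁ with hD
  have hDm : 36 * Z.k + 1 ≤ Z.m * (D - 3) := by
    rw [← div_le_iff₀' hm]; linarith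
  have hDr : 50 ≤ r₁ * (D - 1) := by
    rw [← div_le_iff₀' hr₁]; linarith
  have hD4 : 4 < D := by linarith
  clear_value D
  set M := 16 / r₁ + 2 * (D + 1) with hM
  have hM0 : 0 < M := by positivity
  refine ⟨2 * M, by positivity, ?_⟩
  filter_upwards [self_mem_nhdsWithin, eventually_const_mul_lt D one_pos,
    eventually_const_mul_lt 1 one_pos, eventually_const_mul_lt 6 Z.δ_pos,
    eventually_const_mul_lt M (by norm_num : (0 : ℝ) < 1 / 8),
    eventually_const_mul_lt M (by positivity : 0 < r₁ / 4)]
    with σ (hσ : 0 < σ) hDσ hσ1 hσδ hMσ hMr s hsσ a ha A hA w hw γ hγ ρ hρ hργ e he hmiss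
  have hMr' : M * σ ^ 2 ≤ r₁ / 4 := by nlinarith
  obtain ⟨β, hβ, hαβ, h⟩ := Z.exists_sine_of_ball_disjoint ha hσ hsσ (by linarith) hDσ.le hσδ.le hDm
    (by linarith) hA hw (hr₁.le.trans hγ) hρ he hmiss
  obtain ⟨hργ', hα, hβM⟩ := tilt_of_sq_sub_sq_le hr₁ hγ hρ hργ hσ hβ hαβ hDr (by linarith) hM hMr'
    (by linarith) h
  refine ⟨hργ', by nlinarith, ?_⟩
  linarith [norm_sub_le_two_mul_of_inner he (Z.norm_outerNormal ha) hβ hα.le hαβ]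

end SmoothZone

theorem eq_neg_of_forall_inner_nonpos {V : Type*} [NormedAddCommGroup V] [InnerProductSpace ℝ V]
    {e g : V} (he : ‖e‖ = 1) (hg : ‖g‖ = 1) (h : ∀ v, 0 < ⟪g, v⟫_ℝ → ⟪e, v⟫_ℝ ≤ 0) : e = -g := by
  have hle : -1 ≤ ⟪e, g⟫_ℝ := neg_le_of_abs_le ((abs_real_inner_le_norm e g).trans_eq (by simp [*]))
  rcases hle.eq_or_lt with heq | hlt
  · exact eq_neg_of_add_eq_zero_left <| norm_eq_zero.1 <| sq_eq_zero_iff.1 <| by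
      rw [norm_add_sq_real, he, hg, ← heq]; norm_num
  · have h1 : 0 < ⟪g, e + g⟫_ℝ := by
      rw [inner_add_right, real_inner_self_eq_norm_sq, hg, real_inner_comm]; linarith
    have h2 := h _ h1
    rw [inner_add_right, real_inner_self_eq_norm_sq, he] at h2
    linarith

namespace SmoothZone

variable {d : ℕ} {f : E d → ℝ} {l u : ℝ} (Z : SmoothZone f l u) {a x z : E d} {t : ℝ}

theorem hasGradientAt (ha : a ∈ Z.carrier) : HasGradientAt f (gradient f a) a := by
  rw [hasGradientAt_iff_isLittleO]
  have hO : (fun z => f z - f a - ⟪gradient f a, z - a⟫_ℝ) =O[𝓝 a] fun z => ‖z - a‖ ^ 2 := by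
    refine .of_bound Z.k ?_
    filter_upwards [Metric.closedBall_mem_nhds a Z.δ_pos] with z hz
    simpa using Z.taylor a ha z (by rwa [← dist_eq_norm])
  exact hO.trans_isLittleO (isLittleO_pow_sub_sub a one_lt_two)

theorem continuousAt (ha : a ∈ Z.carrier) : ContinuousAt f a :=
  (Z.hasGradientAt ha).continuousAt

theorem abs_sub_le (ha : a ∈ Z.carrier) (hz : ‖z - a‖ ≤ Z.δ) :
    |f z - f a| ≤ (Z.L + Z.k * Z.δ) * ‖z - a‖ := by
  have hgrad : |⟪gradient f a, z - a⟫_ℝ| ≤ Z.L * ‖z - a‖ :=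
    (abs_real_inner_le_norm _ _).trans (by gcongr; exact Z.le_L a ha)
  have hquad : Z.k * ‖z - a‖ ^ 2 ≤ Z.k * Z.δ * ‖z - a‖ := by
    have := Z.k_pos
    rw [sq, mul_assoc]
    gcongr
  calc |f z - f a| = |f z - f a - ⟪gradient f a, z - a⟫_ℝ + ⟪gradient f a, z - a⟫_ℝ| := by ring_nf
    _ ≤ _ := abs_add_le _ _
    _ ≤ _ := by linarith [Z.taylor a ha z hz]

theorem le_sub_of_inner_nonneg (ha : a ∈ Z.carrier) (hz : ‖z - a‖ ≤ Z.δ)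
    (h : 0 ≤ ⟪z - a, outerNormal f a⟫_ℝ) :
    f z ≤ f a - Z.m * ⟪z - a, outerNormal f a⟫_ℝ + Z.k * ‖z - a‖ ^ 2 := by
  have := mul_le_mul_of_nonneg_right (Z.m_le a ha) h
  linarith [le_of_abs_le (Z.taylor_outerNormal ha hz)]

include Z in
theorem isClosed_levelSet (ht : t ∈ Set.Icc l u) : IsClosed (levelSet f t) := by
  refine isClosed_of_closure_subset fun x hx => ?_
  have hsub : levelSet f t ⊆ levelSet f (l - Z.ζ) := fun y (hy : t ≤ f y) => by
    change l - Z.ζ ≤ f y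
    linarith [ht.1, Z.ζ_pos]
  by_cases hxZ : x ∈ Z.carrier
  · exact continuousWithinAt_const.closure_le hx (Z.continuousAt hxZ).continuousWithinAt
      fun y hy => hy
  · have := Z.high_of_notMem x (closure_mono hsub hx) hxZ x (by simpa using Z.δ_pos.le)
    change t ≤ f x
    linarith [ht.2, Z.ζ_pos]

theorem mem_carrier_and_eq_of_mem_closure_compl (ht : t ∈ Set.Icc l u) (ha : a ∈ levelSet f t)
    (ha' : a ∈ closure (levelSet f t)ᶜ) : a ∈ Z.carrier ∧ f a = t := by
  have haZ : a ∈ Z.carrier := by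
    by_contra hcon
    rw [closure_compl] at ha'
    refine ha' (mem_interior_iff_mem_nhds.2 ?_)
    filter_upwards [Metric.closedBall_mem_nhds a Z.δ_pos] with z hz
    have hlow : l - Z.ζ ≤ f a := by
      have : t ≤ f a := ha
      linarith [ht.1, Z.ζ_pos]
    have := Z.high_of_notMem a (subset_closure hlow) hcon z (by rwa [← dist_eq_norm])
    change t ≤ f z
    linarith [ht.2, Z.ζ_pos]
  refine ⟨haZ, le_antisymm ?_ ha⟩
  exact (Z.continuousAt haZ).continuousWithinAt.closure_le ha' continuousWithinAt_const
    fun z (hz : ¬ t ≤ f z) => (not_le.1 hz).le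

theorem inner_sub_nonpos_of_forall_dist_le (ha : a ∈ Z.carrier)
    (hmin : ∀ z ∈ levelSet f (f a), dist x a ≤ dist x z) {v : E d}
    (hv : 0 < ⟪gradient f a, v⟫_ℝ) : ⟪x - a, v⟫_ℝ ≤ 0 := by
  by_contra! hxv
  obtain ⟨ε, hε, hεδ, hεk, hεx⟩ := (eventually_mem_nhdsWithin.and <| (eventually_const_mul_lt ‖v‖
    Z.δ_pos).and <| (eventually_const_mul_lt (Z.k * ‖v‖ ^ 2) hv).and <|
    eventually_const_mul_lt (‖v‖ ^ 2) (mul_pos two_pos hxv)).exists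
  rw [Set.mem_Ioi] at hε
  have hnorm : ‖a + ε • v - a‖ = ε * ‖v‖ := by
    rw [add_sub_cancel_left, norm_smul, Real.norm_of_nonneg hε.le]
  have hmem : a + ε • v ∈ levelSet f (f a) := by
    have h := neg_le_of_abs_le (Z.taylor a ha (a + ε • v) (by linarith))
    rw [hnorm, add_sub_cancel_left, real_inner_smul_right] at h
    change f a ≤ _
    nlinarith
  have h := pow_le_pow_left₀ dist_nonneg (hmin _ hmem) 2
  rw [dist_eq_norm, dist_eq_norm, ← sub_sub, norm_sub_sq_real (x - a), norm_smul,
    real_inner_smul_right, Real.norm_of_nonneg hε.le] at h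
  nlinarith

theorem eq_add_smul_outerNormal_of_forall_dist_le (ht : t ∈ Set.Icc l u) (hx : x ∉ levelSet f t)
    (ha : a ∈ levelSet f t) (hmin : ∀ z ∈ levelSet f t, dist x a ≤ dist x z) :
    a ∈ Z.carrier ∧ f a = t ∧ x = a + dist x a • outerNormal f a := by
  have hxa : 0 < dist x a := dist_pos.2 fun h => hx (h ▸ ha)
  have ha' : a ∈ closure (levelSet f t)ᶜ := by
    have hlim : Tendsto (AffineMap.lineMap a x) (𝓝[>] (0 : ℝ)) (𝓝 a) := by
      simpa using ((AffineMap.lineMap_continuous (R := ℝ) (p := a) (q := x)).tendsto 0).mono_left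
        nhdsWithin_le_nhds
    refine mem_closure_of_frequently_of_tendsto (Eventually.frequently ?_) hlim
    filter_upwards [Ioo_mem_nhdsGT one_pos] with ε ⟨hε0, hε1⟩ hmem
    have h := hmin _ hmem
    rw [dist_right_lineMap, Real.norm_of_nonneg (by linarith), dist_comm] at h
    nlinarith [dist_comm x a]
  obtain ⟨haZ, rfl⟩ := Z.mem_carrier_and_eq_of_mem_closure_compl ht ha ha'
  refine ⟨haZ, rfl, ?_⟩
  have hpos := Z.m_pos.trans_le (Z.m_le a haZ)
  rw [dist_eq_norm] at hxa ⊢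
  have : ‖x - a‖⁻¹ • (x - a) = -(‖gradient f a‖⁻¹ • gradient f a) := by
    refine eq_neg_of_forall_inner_nonpos (norm_smul_inv_norm (norm_pos_iff.1 hxa))
      (norm_smul_inv_norm (norm_pos_iff.1 hpos)) fun v hv => ?_
    rw [real_inner_smul_left] at hv ⊢
    exact mul_nonpos_of_nonneg_of_nonpos (by positivity) <|
      Z.inner_sub_nonpos_of_forall_dist_le haZ hmin ((pos_iff_pos_of_mul_pos hv).1 (by positivity))
  rw [outerNormal, ← this, smul_inv_smul₀ hxa.ne', add_sub_cancel]

include Z in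
theorem isCompact_levelSet (ht : t ∈ Set.Icc l u) : IsCompact (levelSet f t) :=
  Metric.isCompact_of_isClosed_isBounded (Z.isClosed_levelSet ht) <| Z.isBounded.subset
    fun x (hx : t ≤ f x) => show l - Z.ζ ≤ f x by linarith [ht.1, Z.ζ_pos]

theorem exists_foot (ht : t ∈ Set.Icc l u) (hne : (levelSet f t).Nonempty) (hx : x ∉ levelSet f t) :
    ∃ a ∈ Z.carrier, f a = t ∧ ∃ p > 0, x = a + p • outerNormal f a ∧
      ∀ z ∈ levelSet f t, p ≤ dist x z := by
  obtain ⟨a, ha, hmin⟩ := (Z.isCompact_levelSet ht).exists_infDist_eq_dist hne x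
  have hle : ∀ z ∈ levelSet f t, dist x a ≤ dist x z := fun z hz =>
    hmin.symm.trans_le (Metric.infDist_le_dist_of_mem hz)
  obtain ⟨haZ, hfa, hxa⟩ := Z.eq_add_smul_outerNormal_of_forall_dist_le ht hx ha hle
  exact ⟨a, haZ, hfa, dist x a, dist_pos.2 fun h => hx (h ▸ ha), hxa, hle⟩

theorem disjoint_levelSet_ball_add_smul_outerNormal (ha : a ∈ Z.carrier) {γ : ℝ} (hγ : 0 < γ)
    (hγδ : 2 * γ ≤ Z.δ) (hγm : 2 * Z.k * γ ≤ Z.m) :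
    Disjoint (levelSet f (f a)) (Metric.ball (a + γ • outerNormal f a) γ) := by
  refine Set.disjoint_left.2 fun z (hz : f a ≤ f z) hzb => ?_
  rw [Metric.mem_ball, dist_add_smul_lt_iff (Z.norm_outerNormal ha) hγ] at hzb
  set q := ⟪z - a, outerNormal f a⟫_ℝ
  have hq : 0 < q := pos_of_mul_pos_right ((sq_nonneg _).trans_lt hzb) (by positivity)
  have hqz : q ≤ ‖z - a‖ :=
    (real_inner_le_norm _ _).trans_eq (by rw [Z.norm_outerNormal ha, mul_one])
  have hzδ : ‖z - a‖ ≤ Z.δ := by nlinarith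
  have h1 := Z.le_sub_of_inner_nonneg ha hzδ hq.le
  have h2 := mul_lt_mul_of_pos_left hzb Z.k_pos
  have h3 := mul_le_mul_of_nonneg_right hγm hq.le
  linarith

theorem rConvexHull_levelSet_subset (ht : t ∈ Set.Icc l u) (hne : (levelSet f t).Nonempty) {γ : ℝ}
    (hγ : 0 < γ) (hγδ : 2 * γ ≤ Z.δ) (hγm : 2 * Z.k * γ ≤ Z.m) :
    rConvexHull γ (levelSet f t) ⊆ levelSet f t := by
  intro x hx
  by_contra hxG
  obtain ⟨a, haZ, rfl, p, hp, rfl, hnear⟩ := Z.exists_foot ht hne hxG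
  have hη := Z.norm_outerNormal haZ
  rw [mem_rConvexHull] at hx
  rcases le_or_gt γ p with h | h
  · obtain ⟨z, hzG, hz⟩ := hx (a + p • outerNormal f a) (by simpa using hγ)
    linarith [hnear z hzG, dist_comm z (a + p • outerNormal f a)]
  · obtain ⟨z, hzG, hz⟩ := hx (a + γ • outerNormal f a) (by
      rw [dist_add_left, dist_eq_norm, ← sub_smul, norm_smul, hη, mul_one, Real.norm_eq_abs,
        abs_lt]
      constructor <;> linarith)
    exact Set.disjoint_left.1 (Z.disjoint_levelSet_ball_add_smul_outerNormal haZ hγ hγδ hγm) hzG hz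

end SmoothZone

section Lens

variable {V : Type*} [NormedAddCommGroup V] [InnerProductSpace ℝ V]

theorem norm_smul_sub_add_smul_sq_le {e η w : V} {p κ : ℝ} (he : ‖e‖ = 1) (hη : ‖η‖ = 1)
    (hp : 0 ≤ p) (hpκ : p ≤ 2 * (⟪w, η⟫_ℝ + κ * ⟪e, η⟫_ℝ)) :
    ‖p • η - (w + κ • e)‖ ^ 2 ≤ κ ^ 2 + ‖w‖ ^ 2 + 2 * κ * ⟪w, e⟫_ℝ := by
  have := mul_nonneg hp (sub_nonneg.2 hpκ)
  rw [norm_sub_sq_real, norm_add_sq_real, norm_smul, norm_smul, hη, he, mul_one, mul_one,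
    Real.norm_eq_abs, Real.norm_eq_abs, sq_abs, sq_abs, inner_add_right, real_inner_smul_left,
    real_inner_smul_left, real_inner_smul_right, real_inner_smul_right, real_inner_comm w η,
    real_inner_comm e η]
  linarith

/-- The larger ball touches the hyperplane orthogonal to `e` at the origin, and the smaller one
crosses it only slightly, so that their difference is a thin lens at the origin. -/
theorem norm_sq_le_and_le_inner_of_mem_lens {y e : V} {r γ ν c R : ℝ} (he : ‖e‖ = 1) (hγ : 0 < γ)
    (hν0 : 0 < ν) (hν1 : ν < 1) (hr : r = ν * γ) (hrR : r ≤ R) (hc : 0 < c) (hcr : c ≤ r / 2)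
    (hmiss : γ ≤ ‖y - γ • e‖) (hmem : ‖y - (r - c) • e‖ < r) :
    ‖y‖ ^ 2 ≤ 2 * R / (1 - ν) * c ∧ -(2 * c) ≤ ⟪y, e⟫_ℝ := by
  have h1ν : 0 < 1 - ν := by linarith
  have h1 := pow_le_pow_left₀ hγ.le hmiss 2
  have h2 := pow_lt_pow_left₀ hmem (norm_nonneg _) two_ne_zero
  rw [norm_sub_sq_real, norm_smul, he, mul_one, Real.norm_eq_abs, sq_abs,
    real_inner_smul_right] at h1 h2
  set q := ⟪y, e⟫_ℝ
  constructor
  · suffices ‖y‖ ^ 2 ≤ 2 * r / (1 - ν) * c by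
      refine this.trans ?_
      gcongr
    rw [div_mul_eq_mul_div, le_div_iff₀ h1ν]
    rcases le_total 0 q with hq | hq
    · have h3 : γ * (1 - ν) * q ≤ r * c := by rw [hr] at h2 ⊢; nlinarith [mul_nonneg hc.le hq]
      have h4 := mul_le_mul_of_nonneg_left h3 hν0.le
      have h5 : (1 - ν) * ‖y‖ ^ 2 ≤ (1 - ν) * (2 * r * q + 2 * r * c) :=
        mul_le_mul_of_nonneg_left (by nlinarith [mul_nonneg hc.le hq]) h1ν.le
      have h6 : r * (1 - ν) * q = ν * (γ * (1 - ν) * q) := by rw [hr]; ring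
      linarith
    · have : (r - c) * q ≤ 0 := mul_nonpos_of_nonneg_of_nonpos (by linarith) hq
      nlinarith [mul_nonneg hν0.le (sq_nonneg ‖y‖)]
  · by_contra! hq
    have h3 : (r - c) * q ≤ (r - c) * -(2 * c) := mul_le_mul_of_nonneg_left hq.le (by linarith)
    nlinarith [sq_nonneg ‖y‖]

theorem dist_add_smul_sq_le_of_mem_box {a η e w : V} {K ε σ p r r₁ g κ : ℝ} (hη : ‖η‖ = 1)
    (he : ‖e‖ = 1) (hε0 : 0 < ε) (hε : ε < 1 / 4) (hσ : 0 < σ) (hw : w ∈ box 0 η (ε ^ 2 * σ ^ 2))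
    (hK : 0 < K) (heη : ‖e - η‖ ≤ K * σ) (hα : 3 / 4 ≤ ⟪e, η⟫_ℝ) (hr₁ : 0 < r₁) (hr : r₁ ≤ r)
    (hp : p ∈ Set.Ioo (σ ^ 2) r) (hrg : r ≤ g) (hrκ : 3 / 4 * r ≤ κ) (hκg : κ ≤ g) :
    dist (a + p • η) (a + σ ^ 2 • η + w + κ • e) ^ 2 ≤
      κ ^ 2 + g * ((1 / r₁ + 2 + 2 * K) * ε * σ ^ 2) := by
  obtain ⟨hwη, hwn⟩ := hw
  rw [sub_zero] at hwη hwn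
  rw [← mul_pow, Real.sqrt_sq (by positivity)] at hwn
  have hε2 : ε ^ 2 * σ ^ 2 ≤ ε * σ ^ 2 := by gcongr; nlinarith
  have hwe : ⟪w, e⟫_ℝ ≤ (1 + K) * (ε * σ ^ 2) := by
    have h1 : ⟪w, e - η⟫_ℝ ≤ (ε * σ) * (K * σ) := (real_inner_le_norm _ _).trans (by gcongr)
    rw [inner_sub_right] at h1
    linarith [le_of_abs_le hwη]
  have hw2 : ‖w‖ ^ 2 ≤ g * (1 / r₁ * (ε * σ ^ 2)) := by
    have h1 : 1 ≤ g * (1 / r₁) := by rw [mul_one_div, le_div_iff₀ hr₁]; linarith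
    calc ‖w‖ ^ 2 ≤ (ε * σ) ^ 2 := by gcongr
      _ ≤ 1 * (ε * σ ^ 2) := by rw [mul_pow, one_mul]; exact hε2
      _ ≤ g * (1 / r₁) * (ε * σ ^ 2) := by gcongr
      _ = _ := by ring
  have hκe : κ * ⟪w, e⟫_ℝ ≤ g * ((1 + K) * (ε * σ ^ 2)) :=
    (mul_le_mul_of_nonneg_left hwe (by linarith)).trans (by gcongr)
  have hκα : 3 / 4 * r * (3 / 4) ≤ κ * ⟪e, η⟫_ℝ := by gcongr; linarith
  have haxis := norm_smul_sub_add_smul_sq_le (w := w) (κ := κ) he hη (sub_nonneg.2 hp.1.le) (by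
    nlinarith [neg_le_of_abs_le hwη, hp.2, sq_nonneg σ])
  calc dist (a + p • η) (a + σ ^ 2 • η + w + κ • e) ^ 2
      = ‖(p - σ ^ 2) • η - (w + κ • e)‖ ^ 2 := by
        rw [dist_eq_norm, sub_smul]; congr 2; abel
    _ ≤ _ := by linarith

theorem half_le_inner_and_norm_le_of_mem_lens {η e w Y : V} {K ε σ ω c q θ : ℝ} (hη : ‖η‖ = 1)
    (he : ‖e‖ = 1) (hε0 : 0 < ε) (hε : ε < 1 / 4) (hεω : ε < ω / 4) (hσ : 0 < σ) (hσω : σ < ω / 4)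
    (hw : w ∈ box 0 η (ε ^ 2 * σ ^ 2)) (heη : ‖e - η‖ ≤ K * σ) (hqω : q < ω / 4)
    (hKq : K * q < 1 / 8) (hc : 16 * c < 1) (hθ0 : 0 ≤ θ) (hθ : θ ≤ c * σ ^ 2) (hY : ‖Y‖ ≤ q * σ)
    (hYe : -(2 * (c * σ ^ 2)) ≤ ⟪Y, e⟫_ℝ) :
    σ ^ 2 / 2 ≤ ⟪σ ^ 2 • η + w - θ • e + Y, η⟫_ℝ ∧ ‖σ ^ 2 • η + w - θ • e + Y‖ ≤ ω * σ := by
  obtain ⟨hwη, hwn⟩ := hw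
  rw [sub_zero] at hwη hwn
  rw [← mul_pow, Real.sqrt_sq (by positivity)] at hwn
  have hσ2 : 0 < σ ^ 2 := by positivity
  constructor
  · have h1 : ⟪Y, e - η⟫_ℝ ≤ (q * σ) * (K * σ) :=
      (real_inner_le_norm _ _).trans (mul_le_mul hY heη (norm_nonneg _) ((norm_nonneg _).trans hY))
    have h2 : θ * ⟪e, η⟫_ℝ ≤ θ * 1 := by
      gcongr
      simpa [he, hη] using real_inner_le_norm e η
    have h3 : ε ^ 2 * σ ^ 2 ≤ 1 / 16 * σ ^ 2 := by gcongr; nlinarith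
    rw [inner_sub_right] at h1
    rw [inner_add_left, inner_sub_left, inner_add_left, real_inner_smul_left,
      real_inner_smul_left, real_inner_self_eq_norm_sq, hη]
    nlinarith [neg_le_of_abs_le hwη]
  · have h1 : ‖σ ^ 2 • η + w - θ • e + Y‖ ≤ σ ^ 2 + ‖w‖ + θ + ‖Y‖ :=
      calc _ ≤ ‖σ ^ 2 • η‖ + ‖w‖ + ‖θ • e‖ + ‖Y‖ := (norm_add_le _ _).trans <| by
            gcongr; exact (norm_sub_le _ _).trans (by gcongr; exact norm_add_le _ _)
        _ = _ := by simp [norm_smul, hη, he, abs_of_nonneg hθ0]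
    nlinarith

end Lens

theorem exists_lens_constants (K Λ M k : ℝ) {m : ℝ} (hm : 0 < m) :
    ∃ ω > 0, ω < 1 ∧ ω < m ∧ k * ω < m / 4 ∧ ∃ q > 0, ∃ c > 0, ∃ ε > 0, q < ω / 4 ∧ K * q < 1 / 8 ∧
      16 * c < 1 ∧ Λ * c < q ^ 2 ∧ ε < ω / 4 ∧ M * ε < c := by
  obtain ⟨ω, hω, hω1, hωm, hωk⟩ := (eventually_mem_nhdsWithin.and <| (eventually_const_mul_lt 1
    one_pos).and <| (eventually_const_mul_lt 1 hm).and <|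
    eventually_const_mul_lt k (by positivity : 0 < m / 4)).exists
  rw [Set.mem_Ioi] at hω
  obtain ⟨q, hq, hqω, hqK⟩ := (eventually_mem_nhdsWithin.and <| (eventually_const_mul_lt 1
    (by positivity : 0 < ω / 4)).and <|
    eventually_const_mul_lt K (by norm_num : (0 : ℝ) < 1 / 8)).exists
  rw [Set.mem_Ioi] at hq
  obtain ⟨c, hc, hc1, hcq⟩ := (eventually_mem_nhdsWithin.and <| (eventually_const_mul_lt 16
    one_pos).and <| eventually_const_mul_lt Λ (pow_pos hq 2)).exists
  obtain ⟨ε, hε, hεω, hεc⟩ := (eventually_mem_nhdsWithin.and <| (eventually_const_mul_lt 1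
    (by positivity : 0 < ω / 4)).and <| eventually_const_mul_lt M hc).exists
  exact ⟨ω, hω, by linarith, by linarith, hωk, q, hq, c, hc, ε, hε, by linarith, hqK, hc1, hcq,
    by linarith, hεc⟩

section OuterHull

variable {d : ℕ}

/-- A ball of radius `γ` that misses `A` and has `x` at depth `γ - ρ` inside it, together with a
point `b` of the hull at the smaller radius `r`, leaves only a thin lens around `x` for the points
of `A`, and this lens is not empty. -/
theorem exists_mem_lens {A : Set (E d)} {b x e : E d} {r γ ν ρ τ s R : ℝ} (he : ‖e‖ = 1)
    (hb : b ∈ rConvexHull r A) (hγ : 0 < γ) (hν0 : 0 < ν) (hν1 : ν < 1) (hr : r = ν * γ)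
    (hrR : r ≤ R) (hτ : 0 ≤ τ) (hτs : τ < s) (hsr : 8 * s ≤ r) (hργ : ρ < γ) (hρ : 3 / 4 * γ ≤ ρ)
    (hmiss : ∀ z ∈ A, γ ≤ dist z (x + ρ • e))
    (haxis : ∀ g κ, r ≤ g → 3 / 4 * r ≤ κ → κ ≤ g → dist b (x + κ • e) ^ 2 ≤ κ ^ 2 + g * τ) :
    γ - ρ ≤ τ ∧ ∃ z ∈ A, ‖z - (x - (γ - ρ) • e)‖ ^ 2 ≤ 2 * R / (1 - ν) * s ∧
      -(2 * s) ≤ ⟪z - (x - (γ - ρ) • e), e⟫_ℝ := by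
  have hr0 : 0 < r := by rw [hr]; positivity
  have hrγ : r ≤ γ := by rw [hr]; nlinarith
  have hθ : γ - ρ ≤ τ := by
    by_contra! hcon
    have hbγ : dist b (x + ρ • e) < γ := by
      refine lt_of_pow_lt_pow_left₀ 2 hγ.le ?_
      nlinarith [haxis γ ρ hrγ (by linarith) hργ.le]
    obtain ⟨z, hzA, hz⟩ := mem_rConvexHull.1 (rConvexHull_mono_radius hr0 hrγ hb) _ hbγ
    linarith [hmiss z hzA]
  refine ⟨hθ, ?_⟩
  set κ := r - s - (γ - ρ) with hκ
  have hbr : dist b (x + κ • e) < r := by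
    refine lt_of_pow_lt_pow_left₀ 2 hr0.le ?_
    nlinarith [haxis r κ le_rfl (by linarith) (by linarith)]
  obtain ⟨z, hzA, hzr⟩ := mem_rConvexHull.1 hb _ hbr
  have hzγ := hmiss z hzA
  refine ⟨z, hzA, norm_sq_le_and_le_inner_of_mem_lens he hγ hν0 hν1 hr hrR (by linarith)
    (by linarith) ?_ ?_⟩
  · convert hzγ using 1
    rw [dist_eq_norm, sub_smul]
    congr 1
    abel
  · convert hzr using 1
    rw [dist_eq_norm, hκ, sub_smul (r - s)]
    congr 1
    abel

namespace SmoothZone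

variable {f : E d → ℝ} {l u : ℝ} (Z : SmoothZone f l u)

theorem lt_of_sq_div_two_le_inner {a z : E d} {ω σ : ℝ} (ha : a ∈ Z.carrier) (hσ : 0 < σ)
    (hωδ : ω * σ ≤ Z.δ) (hω0 : 0 < ω) (hω1 : ω < 1) (hωk : Z.k * ω < Z.m / 4)
    (hinner : σ ^ 2 / 2 ≤ ⟪z - a, outerNormal f a⟫_ℝ) (hnorm : ‖z - a‖ ≤ ω * σ) : f z < f a := by
  have := Z.k_pos
  have := Z.m_pos
  have h1 := Z.le_sub_of_inner_nonneg ha (hnorm.trans hωδ)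
    ((by positivity : 0 ≤ σ ^ 2 / 2).trans hinner)
  have h2 : Z.k * ‖z - a‖ ^ 2 ≤ Z.m / 4 * σ ^ 2 :=
    calc Z.k * ‖z - a‖ ^ 2 ≤ Z.k * (ω * σ) ^ 2 := by gcongr
      _ = Z.k * ω * ω * σ ^ 2 := by ring
      _ ≤ Z.m / 4 * 1 * σ ^ 2 := by gcongr
      _ = _ := by ring
  have h3 : Z.m * (σ ^ 2 / 2) ≤ Z.m * ⟪z - a, outerNormal f a⟫_ℝ := by gcongr
  have : 0 < Z.m * σ ^ 2 := by positivity
  linarith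

/-- If the hull at the smaller radius `r` reaches a point of the normal line further out than
`σ ^ 2`, then a ball of radius `r / ν` that contains a point of the box and misses `A` leaves a lens
with a point of `A` at a level below `f a`. -/
theorem exists_box_subset_rConvexHull {r₁ R ν : ℝ} (hr₁ : 0 < r₁) (hν0 : 0 < ν) (hν1 : ν < 1) :
    ∃ ε > 0, ε < 1 / 4 ∧ ε < Z.m / 4 ∧ Z.k * ε < Z.m / 4 ∧ ∀ᶠ σ in 𝓝[>] 0, ∀ a ∈ Z.carrier,
      ∀ A ⊆ levelSet f (f a), IsBoxDense A (levelSet f (f a + ε ^ 2 * σ ^ 2)) (ε ^ 2 * σ ^ 2) →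
      ∀ r ∈ Set.Icc r₁ R, ∀ p ∈ Set.Ioo (σ ^ 2) r, a + p • outerNormal f a ∈ rConvexHull r A →
      box (a + σ ^ 2 • outerNormal f a) (outerNormal f a) (ε ^ 2 * σ ^ 2) ⊆
        rConvexHull (r / ν) A := by
  have hk := Z.k_pos
  obtain ⟨K, hK, htilt⟩ := Z.exists_tilt_bound hr₁
  obtain ⟨ω, hω, hω1, hωm, hωk, q, hq, c, hc, ε, hε, hqω, hKq, hc1, hcq, hεω, hεc⟩ :=
    exists_lens_constants K (2 * R / (1 - ν)) (1 / r₁ + 2 + 2 * K) Z.k Z.m_pos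
  refine ⟨ε, hε, by linarith, by linarith, by nlinarith, ?_⟩
  filter_upwards [self_mem_nhdsWithin, htilt,
    eventually_const_mul_lt 1 (by positivity : 0 < ω / 4), eventually_const_mul_lt ω Z.δ_pos,
    eventually_const_mul_lt 1 (by positivity : 0 < r₁ / 4)]
    with σ (hσ : 0 < σ) htilt hσω hσδ hσr a ha A hAG hA r hr p hp hmem x hx
  rw [one_mul] at hσω hσr
  set η := outerNormal f a
  have hη : ‖η‖ = 1 := Z.norm_outerNormal ha
  obtain ⟨w, rfl⟩ : ∃ w, x = a + σ ^ 2 • η + w := ⟨x - (a + σ ^ 2 • η), by abel⟩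
  have hw : w ∈ box 0 η (ε ^ 2 * σ ^ 2) := by simpa [box] using hx
  have hr0 : 0 < r := hr₁.trans_le hr.1
  have hrν : r = ν * (r / ν) := by field_simp
  have hrγ : r ≤ r / ν := le_div_self hr0.le hν0 hν1.le
  have : Nontrivial (E d) := nontrivial_of_ne η 0 (norm_pos_iff.1 (by rw [hη]; exact one_pos))
  refine mem_rConvexHull.2 fun y hy => ?_
  by_contra! hmiss
  obtain ⟨e, he, hye⟩ := exists_unit_smul (y - (a + σ ^ 2 • η + w))
  rw [sub_eq_iff_eq_add'] at hye
  rw [dist_comm, dist_eq_norm] at hy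
  set ρ := ‖y - (a + σ ^ 2 • η + w)‖
  have hmiss' : ∀ z ∈ A, r / ν ≤ dist z (a + σ ^ 2 • η + w + ρ • e) := by rwa [← hye]
  obtain ⟨hρ, hα, heη⟩ := htilt _ (mul_le_of_le_one_left (sq_nonneg σ) (by nlinarith)) a ha A hA w
    hw _ (hr.1.trans hrγ) ρ (norm_nonneg _) hy e he hmiss'
  obtain ⟨hθ, z, hzA, hY, hYe⟩ := exists_mem_lens (s := c * σ ^ 2) he hmem (by positivity) hν0 hν1
    hrν hr.2 (by positivity) (by gcongr) (by nlinarith [hr.1]) hy hρ hmiss' fun g κ h1 h2 h3 =>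
      dist_add_smul_sq_le_of_mem_box hη he hε (by linarith) hσ hw hK heη hα hr₁ hr.1 hp h1 h2 h3
  obtain ⟨h1, h2⟩ := half_le_inner_and_norm_le_of_mem_lens hη he hε (by linarith) hεω hσ hσω hw heη
    hqω hKq hc1 (sub_nonneg.2 hy.le) (hθ.trans (by gcongr))
    (le_of_sq_le_sq (hY.trans (by rw [← mul_assoc, mul_pow]; gcongr)) (by positivity)) hYe
  have hza : σ ^ 2 • η + w - (r / ν - ρ) • e + (z - (a + σ ^ 2 • η + w - (r / ν - ρ) • e)) =
    z - a := by abel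
  rw [hza] at h1 h2
  exact (Z.lt_of_sq_div_two_le_inner ha hσ hσδ.le hω hω1 hωk h1 h2).not_ge (hAG hzA)

theorem box_add_smul_outerNormal_subset {a : E d} {ε σ : ℝ} (ha : a ∈ Z.carrier) (hl : l ≤ f a)
    (hε0 : 0 < ε) (hε : ε < 1 / 4) (hεm : ε < Z.m / 4) (hkε : Z.k * ε < Z.m / 4) (hσ0 : 0 < σ)
    (hσ : σ < 1 / 4) (hkσ : Z.k * σ < Z.m / 4) (hσδ : σ < Z.δ)
    (hσζ : (Z.L + Z.k * Z.δ) * σ < Z.ζ) :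
    box (a + σ ^ 2 • outerNormal f a) (outerNormal f a) (ε ^ 2 * σ ^ 2) ⊆
      {z | l - Z.ζ ≤ f z ∧ f z ≤ f a - ε ^ 2 * σ ^ 2} := by
  rintro z ⟨h1, h2⟩
  have := Z.k_pos
  have := Z.m_pos
  have := Z.L_nonneg
  have := Z.δ_pos
  have hη := Z.norm_outerNormal ha
  set η := outerNormal f a
  obtain ⟨w, rfl⟩ : ∃ w, z = a + σ ^ 2 • η + w := ⟨z - (a + σ ^ 2 • η), by abel⟩
  rw [add_sub_cancel_left] at h1 h2
  rw [← mul_pow, Real.sqrt_sq (by positivity)] at h2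
  have hzw : a + σ ^ 2 • η + w - a = σ ^ 2 • η + w := by abel
  have hσ2 : 0 < σ ^ 2 := by positivity
  have hε2 : ε ^ 2 * σ ^ 2 ≤ ε / 4 * σ ^ 2 := by gcongr; nlinarith
  have hinner : σ ^ 2 / 2 ≤ ⟪a + σ ^ 2 • η + w - a, η⟫_ℝ := by
    rw [hzw, inner_add_left, real_inner_smul_left, real_inner_self_eq_norm_sq, hη]
    nlinarith [neg_le_of_abs_le h1]
  have hnorm : ‖a + σ ^ 2 • η + w - a‖ ≤ σ * (σ + ε) := by
    rw [hzw]
    refine (norm_add_le _ _).trans ?_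
    rw [norm_smul, hη, Real.norm_of_nonneg hσ2.le]
    linarith
  have hnorm' : ‖a + σ ^ 2 • η + w - a‖ ≤ σ := hnorm.trans (by nlinarith)
  constructor
  · have hM : (Z.L + Z.k * Z.δ) * ‖a + σ ^ 2 • η + w - a‖ ≤ (Z.L + Z.k * Z.δ) * σ := by gcongr
    linarith [neg_le_of_abs_le (Z.abs_sub_le ha (hnorm'.trans hσδ.le))]
  · have hup := Z.le_sub_of_inner_nonneg ha (hnorm'.trans hσδ.le)
      ((by positivity : 0 ≤ σ ^ 2 / 2).trans hinner)
    have hlin : Z.m * (σ ^ 2 / 2) ≤ Z.m * ⟪a + σ ^ 2 • η + w - a, η⟫_ℝ := by gcongr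
    have hquad : Z.k * ‖a + σ ^ 2 • η + w - a‖ ^ 2 ≤ Z.m / 4 * σ ^ 2 :=
      calc Z.k * ‖a + σ ^ 2 • η + w - a‖ ^ 2 ≤ Z.k * (σ * (σ + ε)) ^ 2 := by gcongr
        _ = (Z.k * σ + Z.k * ε) * (σ + ε) * σ ^ 2 := by ring
        _ ≤ (Z.m / 4 + Z.m / 4) * (1 / 2) * σ ^ 2 := by gcongr; linarith
        _ = _ := by ring
    nlinarith

/-- A point of the hull lies within `σ ^ 2`, `σ = √s / ε`, of the level set: otherwise the hull at
the larger radius `r / ν` contains a whole box outside the level set, and hence a point of `B`. -/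
theorem exists_near_levelSet_of_mem_rConvexHull {r₁ R ν : ℝ} (hr₁ : 0 < r₁) (hν0 : 0 < ν)
    (hν1 : ν < 1) :
    ∃ C > 0, ∀ᶠ s in 𝓝[>] 0, ∀ t ∈ Set.Icc l u, (levelSet f t).Nonempty → ∀ A ⊆ levelSet f t,
      ∀ B, IsBoxDense A (levelSet f (t + s)) s →
      IsBoxDense B {z | l - Z.ζ ≤ f z ∧ f z ≤ t - s} s →
      ∀ r ∈ Set.Icc r₁ R, Disjoint (rConvexHull (r / ν) A) B → ∀ x ∈ rConvexHull r A,
      t - C * s ≤ f x ∧ ∃ y ∈ levelSet f t, dist x y ≤ C * s := by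
  obtain ⟨ε, hε, hε4, hεm, hkε, hbox⟩ := Z.exists_box_subset_rConvexHull (R := R) hr₁ hν0 hν1
  set M := Z.L + Z.k * Z.δ
  have hM : 0 ≤ M := add_nonneg Z.L_nonneg (mul_nonneg Z.k_pos.le Z.δ_pos.le)
  refine ⟨(M + 1) * (ε⁻¹) ^ 2, by positivity, ?_⟩
  filter_upwards [self_mem_nhdsWithin,
    ((tendsto_const_mul_nhdsGT_zero (inv_pos.2 hε)).comp tendsto_sqrt_nhdsGT_zero).eventually
      (hbox.and <| (eventually_const_mul_lt 1 (by norm_num : (0 : ℝ) < 1 / 4)).and <|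
        (eventually_const_mul_lt Z.k (div_pos Z.m_pos four_pos)).and <|
        (eventually_const_mul_lt 1 Z.δ_pos).and (eventually_const_mul_lt M Z.ζ_pos))]
    with s (hs : 0 < s) ⟨hbox, hσ4, hkσ, hσδ, hσζ⟩ t ht hne A hAG B hA hB r hr hAB x hx
  rw [Function.comp_apply] at hbox hσ4 hkσ hσδ hσζ
  rw [one_mul] at hσ4 hσδ
  set σ := ε⁻¹ * √s with hσ
  have hσ0 : 0 < σ := by positivity
  have hσs : ε ^ 2 * σ ^ 2 = s := by
    rw [hσ, mul_pow, Real.sq_sqrt hs.le, inv_pow, mul_inv_cancel_left₀ (by positivity)]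
  have hCs : (M + 1) * ε⁻¹ ^ 2 * s = (M + 1) * σ ^ 2 := by
    rw [hσ, mul_pow, Real.sq_sqrt hs.le, mul_assoc]
  rw [hCs]
  by_cases hxG : x ∈ levelSet f t
  · refine ⟨le_trans ?_ hxG, x, hxG, by rw [dist_self]; positivity⟩
    linarith [show 0 ≤ (M + 1) * σ ^ 2 by positivity]
  obtain ⟨a, ha, rfl, p, hp, rfl, hnear⟩ := Z.exists_foot ht hne hxG
  have hpa : ‖a + p • outerNormal f a - a‖ = p := by
    rw [add_sub_cancel_left, norm_smul, Z.norm_outerNormal ha, Real.norm_of_nonneg hp.le, mul_one]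
  rcases le_or_gt p (σ ^ 2) with hpσ | hpσ
  · have hMp : M * p ≤ M * σ ^ 2 := by gcongr
    refine ⟨?_, a, le_refl (f a), by rw [dist_eq_norm, hpa]; nlinarith⟩
    have := neg_le_of_abs_le (Z.abs_sub_le ha (z := a + p • outerNormal f a) (by nlinarith))
    rw [hpa] at this
    nlinarith
  · have hpr : p < r := by
      by_contra! hcon
      obtain ⟨z, hzA, hz⟩ := mem_rConvexHull.1 hx (a + p • outerNormal f a) (by
        rw [dist_self]; exact hr₁.trans_le hr.1)
      linarith [hnear z (hAG hzA), dist_comm z (a + p • outerNormal f a)]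
    rw [← hσs] at hA hB
    obtain ⟨z, hzB, hz⟩ := hB _ _ (Z.norm_outerNormal ha) <|
      Z.box_add_smul_outerNormal_subset ha ht.1 hε hε4 hεm hkε hσ0 hσ4 hkσ hσδ hσζ
    exact (Set.disjoint_left.1 hAB (hbox a ha A hAG hA r hr p ⟨hpσ, hpr⟩ hx hz) hzB).elim

end SmoothZone

end OuterHull

section Gradient

variable {V : Type*} [NormedAddCommGroup V] [InnerProductSpace ℝ V] [CompleteSpace V]

theorem norm_gradient_sub_gradient (f : V → ℝ) (a z : V) :
    ‖gradient f z - gradient f a‖ = ‖fderiv ℝ f z - fderiv ℝ f a‖ := by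
  rw [gradient, gradient, ← map_sub, LinearIsometryEquiv.norm_map]

theorem abs_sub_sub_inner_gradient_le {f : V → ℝ} {a z : V} {k : ℝ} (hk : 0 ≤ k)
    (hf : ∀ x ∈ Metric.closedBall a ‖z - a‖, DifferentiableAt ℝ f x)
    (hlip : ∀ x ∈ Metric.closedBall a ‖z - a‖, ‖gradient f x - gradient f a‖ ≤ k * ‖x - a‖) :
    |f z - f a - ⟪gradient f a, z - a⟫_ℝ| ≤ k * ‖z - a‖ ^ 2 := by
  have h := (convex_closedBall a ‖z - a‖).norm_image_sub_le_of_norm_fderiv_le'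
    (f := f) (φ := fderiv ℝ f a) (C := k * ‖z - a‖) (x := a) (y := z) hf
    (fun x hx => by
      rw [← norm_gradient_sub_gradient]
      exact (hlip x hx).trans (by gcongr; rwa [← dist_eq_norm]))
    (Metric.mem_closedBall_self (norm_nonneg _)) (by rw [Metric.mem_closedBall, dist_eq_norm])
  rwa [gradient, InnerProductSpace.toDual_symm_apply, ← Real.norm_eq_abs, sq, ← mul_assoc]

end Gradient

theorem exists_mem_closure_diff_interior_dist_le {V : Type*} [NormedAddCommGroup V]
    [NormedSpace ℝ V] [FiniteDimensional ℝ V] {S : Set V} {x y : V} (hx : x ∈ interior S)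
    (hy : y ∉ interior S) : ∃ w ∈ closure S \ interior S, dist x w ≤ dist x y := by
  obtain ⟨w, hw, hxw⟩ := exists_mem_frontier_infDist_compl_eq_dist hx
    (fun h => hy (h ▸ Set.mem_univ y))
  rw [frontier, isOpen_interior.interior_eq] at hw
  exact ⟨w, ⟨closure_mono interior_subset hw.1, hw.2⟩, hxw ▸ Metric.infDist_le_dist_of_mem hy⟩

section Construction

variable {d p : ℕ} {f : E d → ℝ} {l u ζ L k δ : ℝ}

theorem le_of_notMem_closure_diff_interior (hlu : l ≤ u) (hζ : 0 < ζ) (hk : 0 ≤ k) (hδ : 2 * δ ≤ 1)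
    (hδζ : 2 * (L + k) * δ ≤ ζ / 2)
    (hcont : ∀ w ∈ closure (levelSet f (l - ζ)) \ interior (levelSet f (u + ζ)), ContinuousAt f w)
    (hL : ∀ w ∈ closure (levelSet f (l - ζ)) \ interior (levelSet f (u + ζ)), ‖gradient f w‖ ≤ L)
    (htaylor : ∀ w ∈ closure (levelSet f (l - ζ)) \ interior (levelSet f (u + ζ)), ∀ z,
      ‖z - w‖ ≤ 2 * δ → |f z - f w - ⟪gradient f w, z - w⟫_ℝ| ≤ k * ‖z - w‖ ^ 2) {x : E d}
    (hx : x ∈ closure (levelSet f (l - ζ)))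
    (hx' : x ∉ closure (levelSet f (l - ζ)) \ interior (levelSet f (u + ζ))) {y : E d}
    (hyx : ‖y - x‖ ≤ δ) : u + ζ / 2 ≤ f y := by
  have hxO : x ∈ interior (levelSet f (u + ζ)) := by
    by_contra h
    exact hx' ⟨hx, h⟩
  by_cases hyO : y ∈ interior (levelSet f (u + ζ))
  · have hy : y ∈ levelSet f (u + ζ) := interior_subset hyO
    change u + ζ ≤ f y at hy
    linarith
  obtain ⟨w, ⟨hwcl, hwO⟩, hxw⟩ := exists_mem_closure_diff_interior_dist_le hxO hyO
  have hwZ : w ∈ closure (levelSet f (l - ζ)) \ interior (levelSet f (u + ζ)) :=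
    ⟨closure_mono (fun v (hv : u + ζ ≤ f v) => show l - ζ ≤ f v by linarith) hwcl, hwO⟩
  have hfw : u + ζ ≤ f w := continuousWithinAt_const.closure_le hwcl
    (hcont w hwZ).continuousWithinAt fun v hv => hv
  have hyw : ‖y - w‖ ≤ 2 * δ := by
    rw [← dist_eq_norm] at hyx ⊢
    linarith [dist_triangle y x w, dist_comm x y]
  have hlin : |⟪gradient f w, y - w⟫_ℝ| ≤ L * (2 * δ) :=
    (abs_real_inner_le_norm _ _).trans <|
      mul_le_mul (hL w hwZ) hyw (norm_nonneg _) ((norm_nonneg _).trans (hL w hwZ))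
  have hquad : k * ‖y - w‖ ^ 2 ≤ k * (2 * δ) := by
    gcongr
    nlinarith [norm_nonneg (y - w)]
  linarith [neg_le_of_abs_le (htaylor w hwZ y hyw), neg_le_of_abs_le hlin]

theorem isBounded_of_isBounded_diff {V : Type*} [PseudoMetricSpace V] {A B : Set V}
    (hB : Bornology.IsBounded B) (h : Bornology.IsBounded (closure A \ interior B)) :
    Bornology.IsBounded A := by
  refine (h.union hB).subset fun x hx => ?_
  by_cases hxB : x ∈ interior B
  · exact Or.inr (interior_subset hxB)
  · exact Or.inl ⟨subset_closure hx, hxB⟩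

theorem AssumptionA.exists_smoothZone [Nontrivial (E d)] (hp : p ≠ 0) (hf : ∀ x, 0 ≤ f x)
    (hA : AssumptionA p f l u) :
    ∃ (Z : SmoothZone f l u) (U : Set (E d)), IsOpen U ∧ Z.carrier ⊆ U ∧ ContDiffOn ℝ p f U := by
  obtain ⟨hlu, -, -, U, ζ, m, k₀, hζ, hbdd, hUo, hUb, hsub, hsm, hm, hgm, hgk⟩ := hA
  set S := closure (levelSet f (l - ζ)) \ interior (levelSet f (u + ζ))
  have hS : IsCompact S := Metric.isCompact_of_isClosed_isBounded
    (isClosed_closure.sdiff isOpen_interior) (hUb.subset hsub)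
  have hbounded : Bornology.IsBounded (levelSet f (l - ζ)) :=
    isBounded_of_isBounded_diff hbdd (hUb.subset hsub)
  have hlow : 0 < l - ζ := by
    by_contra! hcon
    exact NormedSpace.unbounded_univ ℝ (E d) (hbounded.subset fun x _ => hcon.trans (hf x))
  obtain ⟨k, hk0, hk⟩ : ∃ k > 0, ∀ x ∈ U, ∀ y ∈ U, ‖gradient f x - gradient f y‖ ≤ k * ‖x - y‖ :=
    ⟨max k₀ 1, by positivity, fun x hx y hy =>
      (hgk x hx y hy).trans (by gcongr; exact le_max_left _ _)⟩
  obtain ⟨L, hL0, hL⟩ : ∃ L ≥ 0, ∀ a ∈ S, ‖gradient f a‖ ≤ L := by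
    have hlip : LipschitzOnWith k.toNNReal (gradient f) U :=
      .of_dist_le_mul fun x hx y hy => by
        rw [dist_eq_norm, dist_eq_norm, Real.coe_toNNReal _ hk0.le]
        exact hk x hx y hy
    obtain ⟨L, hL⟩ := hS.exists_bound_of_continuousOn (hlip.continuousOn.mono hsub)
    exact ⟨max L 0, le_max_right _ _, fun a ha => (hL a ha).trans (le_max_left _ _)⟩
  obtain ⟨δ₀, hδ₀, hδ₀U⟩ := hS.exists_cthickening_subset_open hUo hsub
  have hdiff : ∀ x ∈ U, DifferentiableAt ℝ f x := fun x hx =>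
    (hsm.contDiffAt (hUo.mem_nhds hx)).differentiableAt (by exact_mod_cast hp)
  have htaylor : ∀ a ∈ S, ∀ z, ‖z - a‖ ≤ δ₀ →
      |f z - f a - ⟪gradient f a, z - a⟫_ℝ| ≤ k * ‖z - a‖ ^ 2 := fun a ha z hza => by
    have hball : Metric.closedBall a ‖z - a‖ ⊆ U := (Metric.closedBall_subset_closedBall hza).trans
      ((Metric.closedBall_subset_cthickening ha δ₀).trans hδ₀U)
    exact abs_sub_sub_inner_gradient_le hk0.le (fun x hx => hdiff x (hball hx))
      fun x hx => hk x (hball hx) a (hsub ha)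
  obtain ⟨δ, hδ, hδ1, hδδ₀, hδζ⟩ := (eventually_mem_nhdsWithin.and <| (eventually_const_mul_lt 2
    one_pos).and <| (eventually_const_mul_lt 2 hδ₀).and <|
    eventually_const_mul_lt (2 * (L + k)) (half_pos hζ)).exists
  rw [Set.mem_Ioi] at hδ
  exact ⟨⟨S, ζ, m, k, L, δ, hlu, hζ, hm, hk0, hL0, hδ, hlow, hS, hbounded,
    fun x hx hx' y hyx => le_of_notMem_closure_diff_interior hlu hζ hk0.le hδ1.le hδζ.le
      (fun w hw => (hdiff w (hsub hw)).continuousAt) hL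
      (fun w hw z hz => htaylor w hw z (hz.trans hδδ₀.le)) hx hx' hyx,
    fun a ha => hgm a (hsub ha), hL, fun a ha z hz => hk z (hsub hz) a (hsub ha),
    fun a ha z hz => htaylor a ha z (by linarith)⟩, U, hUo, hsub, hsm⟩

end Construction

section Volume

theorem measure_le_of_thin {V : Type*} [NormedAddCommGroup V] [NormedSpace ℝ V] [MeasurableSpace V]
    [BorelSpace V] {μ : Measure V} [μ.IsAddRightInvariant] {S : Set V} (hS : MeasurableSet S)
    {a e : V} {κ ρ : ℝ} (hSρ : S ⊆ Metric.ball a ρ) (he : ‖e‖ = 1) (hκ : 0 < κ) (hκρ : κ ≤ ρ)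
    (hthin : ∀ z ∈ S, ∀ τ, κ ≤ τ → z + τ • e ∉ S) :
    μ S ≤ ENNReal.ofReal (2 * κ / ρ) * μ (Metric.ball a (2 * ρ)) := by
  have hρ : 0 < ρ := hκ.trans_le hκρ
  set N := ⌊ρ / κ⌋₊
  set T : ℕ → Set V := fun j => (fun x => x + (-(j * κ)) • e) ⁻¹' S
  have hNle : N * κ ≤ ρ := (le_div_iff₀ hκ).1 (Nat.floor_le (by positivity))
  have hNge : ρ / (2 * κ) ≤ N := by
    have h1 := Nat.lt_floor_add_one (ρ / κ)
    have h2 : (1 : ℝ) ≤ N := by exact_mod_cast Nat.le_floor (by simpa using (one_le_div hκ).2 hκρ)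
    rw [mul_comm, ← div_div]
    linarith
  have hdisj : Pairwise (Function.onFun Disjoint T) := by
    refine (pairwise_disjoint_on T).2 fun i j hij => Set.disjoint_left.2 fun x hi hj => ?_
    have hij' : (i : ℝ) + 1 ≤ j := by exact_mod_cast hij
    have hshift : x + (-(j * κ)) • e + ((j - i) * κ) • e = x + (-(i * κ)) • e := by module
    exact hthin _ hj ((j - i) * κ) (le_mul_of_one_le_left hκ.le (by linarith)) (hshift ▸ hi)
  have hsub : ⋃ j ∈ Finset.range N, T j ⊆ Metric.ball a (2 * ρ) :=
    Set.iUnion₂_subset fun j hj x hx => by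
      have hjN : (j : ℝ) ≤ N := by exact_mod_cast (Finset.mem_range.1 hj).le
      have hdist : dist x (x + (-(j * κ)) • e) ≤ ρ := by
        rw [dist_self_add_right, norm_smul, he, mul_one, norm_neg,
          Real.norm_of_nonneg (by positivity)]
        exact (by gcongr : j * κ ≤ N * κ).trans hNle
      have := Metric.mem_ball.1 (hSρ hx)
      rw [Metric.mem_ball]
      linarith [dist_triangle x (x + (-(j * κ)) • e) a]
  have hvol : N * μ S ≤ μ (Metric.ball a (2 * ρ)) := by
    refine le_trans (le_of_eq ?_) (measure_mono hsub)
    rw [measure_biUnion_finset (hdisj.set_pairwise _) fun j _ => (measurable_add_const _) hS]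
    simp [T, measure_preimage_add_right]
  calc μ S = ENNReal.ofReal (2 * κ / ρ) * (ENNReal.ofReal (ρ / (2 * κ)) * μ S) := by
        rw [← mul_assoc, ← ENNReal.ofReal_mul (by positivity), div_mul_div_cancel₀ hρ.ne',
          div_self (by positivity), ENNReal.ofReal_one, one_mul]
    _ ≤ ENNReal.ofReal (2 * κ / ρ) * (N * μ S) := by
        gcongr
        rw [← ENNReal.ofReal_natCast]
        exact ENNReal.ofReal_le_ofReal hNge
    _ ≤ _ := by gcongr

namespace SmoothZone

variable {d : ℕ} {f : E d → ℝ} {l u : ℝ} (Z : SmoothZone f l u)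

theorem lt_of_add_smul_outerNormal_mem_ball {a z : E d} {ρ τ : ℝ} (ha : a ∈ Z.carrier)
    (hz : z ∈ Z.carrier) (hρδ : 2 * ρ < Z.δ) (hρk : 6 * Z.k * ρ < Z.m) (hza : z ∈ Metric.ball a ρ)
    (hτ : 0 < τ) (hτa : z + τ • outerNormal f a ∈ Metric.ball a ρ) :
    f (z + τ • outerNormal f a) < f z - Z.m / 3 * τ := by
  have hk := Z.k_pos
  have hη := Z.norm_outerNormal ha
  set η := outerNormal f a with hηdef
  have hnorm : ‖z + τ • η - z‖ = τ := by
    rw [add_sub_cancel_left, norm_smul, hη, Real.norm_of_nonneg hτ.le, mul_one]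
  have hτρ : τ < 2 * ρ := by
    rw [← hnorm, ← dist_eq_norm]
    linarith [dist_triangle_right (z + τ • η) z a, Metric.mem_ball.1 hza, Metric.mem_ball.1 hτa]
  have htaylor := le_of_abs_le (Z.taylor z hz (z + τ • η) (by rw [hnorm]; linarith))
  rw [hnorm, add_sub_cancel_left, real_inner_smul_right] at htaylor
  have hslope : ⟪gradient f z, η⟫_ℝ ≤ Z.k * ρ - Z.m := by
    have h1 : ⟪gradient f a, η⟫_ℝ = -‖gradient f a‖ := by
      rw [gradient_eq_neg_smul_outerNormal, inner_neg_left, real_inner_smul_left, ← hηdef,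
        real_inner_self_eq_norm_sq, norm_neg, norm_smul, hη]
      simp
    have h2 : ⟪gradient f z - gradient f a, η⟫_ℝ ≤ Z.k * ρ := by
      refine (real_inner_le_norm _ _).trans ?_
      rw [hη, mul_one]
      refine (Z.gradient_lipschitz a ha z hz).trans ?_
      gcongr
      rw [← dist_eq_norm]
      exact hza.le
    rw [inner_sub_left, h1] at h2
    linarith [Z.m_le a ha]
  have h1 : τ * ⟪gradient f z, η⟫_ℝ ≤ τ * (Z.k * ρ - Z.m) := by gcongr
  have h2 : Z.k * τ ^ 2 ≤ Z.k * (2 * ρ * τ) := by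
    rw [sq]
    gcongr
  have h3 : τ * (6 * Z.k * ρ) < τ * Z.m := by gcongr
  have h4 : 0 < τ * Z.m := mul_pos hτ Z.m_pos
  linarith

theorem volume_strip_inter_ball_le (hf : Measurable f) {ρ : ℝ} (hρδ : 2 * ρ < Z.δ)
    (hρk : 6 * Z.k * ρ < Z.m) {a : E d} (ha : a ∈ Z.carrier) {ε : ℝ} (hε : 0 < ε)
    (hερ : 3 / Z.m * ε ≤ ρ) (s : ℝ) :
    volume (Z.carrier ∩ {x | s ≤ f x ∧ f x ≤ s + ε} ∩ Metric.ball a ρ) ≤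
      ENNReal.ofReal (2 * (3 / Z.m * ε) / ρ) * volume (Metric.ball a (2 * ρ)) := by
  have hm := Z.m_pos
  have hmeas : MeasurableSet (Z.carrier ∩ {x | s ≤ f x ∧ f x ≤ s + ε} ∩ Metric.ball a ρ) :=
    (Z.isCompact.isClosed.measurableSet.inter <| (measurableSet_le measurable_const hf).inter
      (measurableSet_le hf measurable_const)).inter measurableSet_ball
  refine measure_le_of_thin hmeas Set.inter_subset_right (Z.norm_outerNormal ha) (by positivity) hερ
    fun z ⟨⟨hzZ, _, hz⟩, hza⟩ τ hτ ⟨⟨_, hτs, _⟩, hτa⟩ => ?_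
  have h := Z.lt_of_add_smul_outerNormal_mem_ball ha hzZ hρδ hρk hza
    ((by positivity : 0 < 3 / Z.m * ε).trans_le hτ) hτa
  have : ε ≤ Z.m / 3 * τ :=
    calc ε = Z.m / 3 * (3 / Z.m * ε) := by field_simp
      _ ≤ _ := by gcongr
  linarith

theorem volume_strip_le (hf : Measurable f) :
    ∃ C > 0, ∀ᶠ ε in 𝓝[>] 0, ∀ s, l - Z.ζ ≤ s → s + ε < u + Z.ζ / 2 →
      volume {x | s ≤ f x ∧ f x ≤ s + ε} ≤ ENNReal.ofReal (C * ε) := by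
  have hm := Z.m_pos
  obtain ⟨ρ, hρ, hρδ, hρk⟩ := (eventually_mem_nhdsWithin.and <| (eventually_const_mul_lt 2
    Z.δ_pos).and <| eventually_const_mul_lt (6 * Z.k) hm).exists
  rw [Set.mem_Ioi] at hρ
  obtain ⟨T, hTZ, hT⟩ := Z.isCompact.elim_nhds_subcover (fun a => Metric.ball a ρ)
    (fun a _ => Metric.ball_mem_nhds a hρ)
  set v := ∑ a ∈ T, volume (Metric.ball a (2 * ρ))
  have hv : v ≠ ⊤ := ENNReal.sum_ne_top.2 fun a _ => measure_ball_lt_top.ne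
  refine ⟨6 / (Z.m * ρ) * v.toReal + 1, by positivity, ?_⟩
  filter_upwards [self_mem_nhdsWithin, eventually_const_mul_lt (3 / Z.m) hρ]
    with ε (hε : 0 < ε) hερ s hs hsu
  have hcover : {x | s ≤ f x ∧ f x ≤ s + ε} ⊆
      ⋃ a ∈ T, (Z.carrier ∩ {x | s ≤ f x ∧ f x ≤ s + ε} ∩ Metric.ball a ρ) := fun x hx => by
    have hxZ : x ∈ Z.carrier := Z.mem_carrier (hs.trans hx.1) (hx.2.trans_lt hsu)
    obtain ⟨a, haT, hxa⟩ := Set.mem_iUnion₂.1 (hT hxZ)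
    exact Set.mem_iUnion₂.2 ⟨a, haT, ⟨hxZ, hx⟩, hxa⟩
  calc volume {x | s ≤ f x ∧ f x ≤ s + ε}
      ≤ ∑ a ∈ T, volume (Z.carrier ∩ {x | s ≤ f x ∧ f x ≤ s + ε} ∩ Metric.ball a ρ) :=
        (measure_mono hcover).trans (measure_biUnion_finset_le T _)
    _ ≤ ∑ a ∈ T, ENNReal.ofReal (2 * (3 / Z.m * ε) / ρ) * volume (Metric.ball a (2 * ρ)) :=
        Finset.sum_le_sum fun a ha =>
          Z.volume_strip_inter_ball_le hf hρδ hρk (hTZ a ha) hε hερ.le s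
    _ = ENNReal.ofReal (6 / (Z.m * ρ) * v.toReal * ε) := by
        rw [← Finset.mul_sum]
        change _ * v = _
        conv_lhs => rw [← ENNReal.ofReal_toReal hv]
        rw [← ENNReal.ofReal_mul (by positivity)]
        congr 1
        field_simp
        ring
    _ ≤ _ := ENNReal.ofReal_le_ofReal (by linarith)

end SmoothZone

end Volume

section BoxVolume

variable {V : Type*} [NormedAddCommGroup V] [InnerProductSpace ℝ V]

theorem isClosed_box (x η : V) (s : ℝ) : IsClosed (box x η s) :=
  have h1 : Continuous fun z => |⟪z - x, η⟫_ℝ| := by fun_prop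
  have h2 : Continuous fun z => ‖z - x‖ := by fun_prop
  (isClosed_le h1 continuous_const).inter (isClosed_le h2 continuous_const)

theorem mem_box_self (x η : V) {s : ℝ} (hs : 0 ≤ s) : x ∈ box x η s := by
  simpa [box] using hs

theorem box_subset_box {x x' η η' : V} {s : ℝ} (hs : 0 ≤ s) (hs1 : s ≤ 1) (hη : ‖η‖ = 1)
    (hx : ‖x - x'‖ ≤ s / 4) (hη' : ‖η - η'‖ ≤ s / 4) : box x' η' (s / 4) ⊆ box x η s := by
  rintro z ⟨h1, h2⟩
  have hsqrt : √(s / 4) = √s / 2 := by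
    rw [Real.sqrt_div hs, show (4 : ℝ) = 2 ^ 2 by norm_num, Real.sqrt_sq two_pos.le]
  have hsqs : s ≤ √s := Real.le_sqrt_of_sq_le (by nlinarith)
  rw [hsqrt] at h2
  constructor
  · have hsplit : ⟪z - x, η⟫_ℝ = ⟪z - x', η'⟫_ℝ + ⟪z - x', η - η'⟫_ℝ - ⟪x - x', η⟫_ℝ := by
      rw [← inner_add_right, add_sub_cancel, ← inner_sub_left, sub_sub_sub_cancel_right]
    have htilt : |⟪z - x', η - η'⟫_ℝ| ≤ 1 * (s / 4) :=
      (abs_real_inner_le_norm _ _).trans <|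
        mul_le_mul (by linarith [Real.sqrt_le_one.2 hs1]) hη' (norm_nonneg _) zero_le_one
    have hshift : |⟪x - x', η⟫_ℝ| ≤ s / 4 :=
      (abs_real_inner_le_norm _ _).trans (by rwa [hη, mul_one])
    rw [hsplit]
    linarith [abs_sub (⟪z - x', η'⟫_ℝ + ⟪z - x', η - η'⟫_ℝ) ⟪x - x', η⟫_ℝ,
      abs_add_le ⟪z - x', η'⟫_ℝ ⟪z - x', η - η'⟫_ℝ]
  · rw [← sub_sub_sub_cancel_right z x x']
    linarith [norm_sub_le (z - x') (x - x')]

theorem norm_le_sum_abs_repr {ι : Type*} [Fintype ι] (b : OrthonormalBasis ι ℝ V) (v : V) :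
    ‖v‖ ≤ ∑ i, |b.repr v i| := by
  conv_lhs => rw [← b.sum_repr v]
  exact norm_sum_le_of_le _ fun i _ => by rw [norm_smul, b.norm_eq_one, mul_one, Real.norm_eq_abs]

theorem exists_orthonormalBasis_apply_eq {ι : Type*} [Fintype ι] [FiniteDimensional ℝ V]
    (hι : Module.finrank ℝ V = Fintype.card ι) (i₀ : ι) {e : V} (he : ‖e‖ = 1) :
    ∃ b : OrthonormalBasis ι ℝ V, b i₀ = e := by
  obtain ⟨b, hb⟩ := Orthonormal.exists_orthonormalBasis_extension_of_card_eq (𝕜 := ℝ) hι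
    (v := fun _ => e) (s := {i₀})
    ⟨fun _ => he, fun i j hij => (hij (Subsingleton.elim i j)).elim⟩
  exact ⟨b, hb i₀ rfl⟩

theorem volume_forall_abs_repr_sub_le [FiniteDimensional ℝ V] [MeasurableSpace V] [BorelSpace V]
    {ι : Type*} [Fintype ι] (b : OrthonormalBasis ι ℝ V) (x : V) (w : ι → ℝ) :
    volume {z | ∀ i, |b.repr (z - x) i| ≤ w i} = ∏ i, ENNReal.ofReal (2 * w i) := by
  have hmp : MeasurePreserving (fun z : V => (WithLp.ofLp (b.repr z) : ι → ℝ)) volume volume :=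
    (EuclideanSpace.volume_preserving_symm_measurableEquiv_toLp ι).comp b.measurePreserving_repr
  set c : ι → ℝ := fun i => b.repr x i
  have hpre : {z | ∀ i, |b.repr (z - x) i| ≤ w i} =
      (fun z : V => (WithLp.ofLp (b.repr z) : ι → ℝ)) ⁻¹' Set.Icc (c - w) (c + w) := by
    ext z
    simp only [Set.mem_ofPred_eq, Set.mem_preimage, Set.mem_Icc, Pi.le_def, ← forall_and,
      Pi.sub_apply, Pi.add_apply, map_sub, PiLp.sub_apply, abs_le, c]
    exact forall_congr' fun i => by constructor <;> rintro ⟨h1, h2⟩ <;> constructor <;> linarith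
  rw [hpre, hmp.measure_preimage measurableSet_Icc.nullMeasurableSet, Real.volume_Icc_pi]
  congr 1 with i
  congr 1
  simp only [Pi.add_apply, Pi.sub_apply]
  ring

theorem pos_of_nontrivial (d : ℕ) [Nontrivial (E d)] : 0 < d := by
  simpa using Module.finrank_pos (R := ℝ) (M := E d)

/-- The box contains a cuboid with one side of order `s` along `η` and `d - 1` sides of order `√s`;
this is where the exponent `(d + 1) / 2` comes from. -/
theorem exists_le_volume_box (d : ℕ) [Nontrivial (E d)] :
    ∃ c > 0, ∀ x η : E d, ‖η‖ ≤ 2 → ∀ s, 0 ≤ s → s ≤ 1 →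
      ENNReal.ofReal (c * √s ^ (d + 1)) ≤ volume (box x η s) := by
  have hd : (1 : ℝ) ≤ d := by exact_mod_cast pos_of_nontrivial d
  set i₀ : Fin d := ⟨0, pos_of_nontrivial d⟩
  refine ⟨(1 / (d : ℝ)) ^ d, by positivity, fun x η hη s hs hs1 => ?_⟩
  obtain ⟨e, he, hηe⟩ := exists_unit_smul η
  obtain ⟨b, hb⟩ := exists_orthonormalBasis_apply_eq (ι := Fin d) (by simp) i₀ he
  have hsq : √s * √s = s := Real.mul_self_sqrt hs
  set w : Fin d → ℝ := fun i => √s / (2 * d) * (if i = i₀ then √s else 1) with hw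
  have hvol : volume {z | ∀ i, |b.repr (z - x) i| ≤ w i} =
      ENNReal.ofReal ((1 / (d : ℝ)) ^ d * √s ^ (d + 1)) := by
    have hside (i : Fin d) : 2 * w i = √s / d * (if i = i₀ then √s else 1) := by
      simp only [hw]
      field_simp
    rw [volume_forall_abs_repr_sub_le, ← ENNReal.ofReal_prod_of_nonneg fun i _ => by
      simp only [hw]; split_ifs <;> positivity]
    simp only [hside, Finset.prod_mul_distrib, Finset.prod_const, Finset.prod_ite_eq',
      Finset.card_univ, Fintype.card_fin, Finset.mem_univ, if_true]
    congr 1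
    rw [div_pow, div_pow, one_pow, pow_succ]
    ring
  rw [← hvol]
  refine measure_mono fun z hz => ⟨?_, ?_⟩
  · have hinner : ⟪z - x, η⟫_ℝ = ‖η‖ * b.repr (z - x) i₀ := by
      conv_lhs => rw [hηe]
      rw [real_inner_smul_right, b.repr_apply_apply, hb, real_inner_comm]
    have hw₀ : w i₀ = s / (2 * d) := by
      simp only [hw, if_true]
      rw [div_mul_eq_mul_div, hsq]
    rw [hinner, abs_mul, abs_norm]
    calc ‖η‖ * |b.repr (z - x) i₀| ≤ 2 * (s / (2 * d)) :=
          mul_le_mul hη (hw₀ ▸ hz i₀) (abs_nonneg _) two_pos.le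
      _ = s / d := by field_simp
      _ ≤ s := div_le_self hs hd
  · calc ‖z - x‖ ≤ ∑ i, |b.repr (z - x) i| := norm_le_sum_abs_repr b _
      _ ≤ ∑ _ : Fin d, √s / (2 * d) := Finset.sum_le_sum fun i _ => (hz i).trans <|
          mul_le_of_le_one_right (by positivity) <| by
            split_ifs
            exacts [Real.sqrt_le_one.2 hs1, le_rfl]
      _ = √s / 2 := by
          rw [Finset.sum_const, Finset.card_univ, Fintype.card_fin, nsmul_eq_mul]
          field_simp
      _ ≤ √s := half_le_self (Real.sqrt_nonneg s)

end BoxVolume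

section Grid

variable {d : ℕ}

/-- The points of `(1 / n) ℤ ^ d` in the cube `[-N, N] ^ d`. -/
noncomputable def grid (d N n : ℕ) : Finset (E d) :=
  (Fintype.piFinset fun _ : Fin d => Finset.Icc (-(N * n : ℤ)) (N * n)).image
    fun i => WithLp.toLp 2 fun j => (i j : ℝ) / n

theorem card_grid_le (d N : ℕ) {n : ℕ} (hn : 1 ≤ n) :
    ((grid d N n).card : ℝ) ≤ ((2 * N + 1) * n) ^ d := by
  have hside : ((N * n : ℤ) + 1 - -(N * n : ℤ)).toNat ≤ (2 * N + 1) * n := by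
    rw [Int.toNat_le]
    push_cast
    nlinarith
  have hcard : (grid d N n).card ≤ ((2 * N + 1) * n) ^ d := by
    refine Finset.card_image_le.trans ?_
    rw [Fintype.card_piFinset, Finset.prod_const, Finset.card_univ, Fintype.card_fin, Int.card_Icc]
    gcongr
  exact_mod_cast hcard

theorem exists_mem_grid {N n : ℕ} (hn : 1 ≤ n) {x : E d} (hx : ‖x‖ ≤ N) :
    ∃ x' ∈ grid d N n, ‖x - x'‖ ≤ d / n := by
  have hn0 : (0 : ℝ) < n := by exact_mod_cast hn
  set x' : E d := WithLp.toLp 2 fun j => (⌊x j * n⌋ : ℝ) / n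
  refine ⟨x', Finset.mem_image.2 ⟨fun j => ⌊x j * n⌋, ?_, rfl⟩, ?_⟩
  · refine Fintype.mem_piFinset.2 fun j => Finset.mem_Icc.2 ?_
    obtain ⟨h1, h2⟩ := abs_le.1 ((PiLp.norm_apply_le x j).trans hx)
    constructor
    · rw [Int.le_floor]
      push_cast
      nlinarith
    · rw [← Int.cast_le (R := ℝ)]
      push_cast
      exact (Int.floor_le _).trans (by gcongr)
  · have hcoord (j : Fin d) : |x j - x' j| ≤ 1 / n := by
      have : x j - x' j = Int.fract (x j * n) / n := by
        rw [← Int.self_sub_floor]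
        simp only [x']
        field_simp
      rw [this, abs_of_nonneg (div_nonneg (Int.fract_nonneg _) hn0.le)]
      gcongr
      exact (Int.fract_lt_one _).le
    calc ‖x - x'‖ ≤ ∑ j, |x j - x' j| :=
          norm_le_sum_abs_repr (EuclideanSpace.basisFun (Fin d) ℝ) _
      _ ≤ ∑ _ : Fin d, 1 / (n : ℝ) := Finset.sum_le_sum fun j _ => hcoord j
      _ = d / n := by
          rw [Finset.sum_const, Finset.card_univ, Fintype.card_fin, nsmul_eq_mul, mul_one_div]

end Grid

section Rates

theorem log_div_pos {n : ℕ} (hn : 2 ≤ n) : 0 < Real.log n / n :=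
  div_pos (Real.log_pos (by exact_mod_cast hn)) (by positivity)

theorem tendsto_log_div : Tendsto (fun n : ℕ => Real.log n / n) atTop (𝓝[>] 0) :=
  tendsto_nhdsWithin_iff.2 ⟨Real.isLittleO_log_id_atTop.tendsto_div_nhds_zero.comp
    tendsto_natCast_atTop_atTop, (eventually_ge_atTop 2).mono fun _ => log_div_pos⟩

theorem tendsto_log_natCast : Tendsto (fun n : ℕ => Real.log n) atTop atTop :=
  Real.tendsto_log_atTop.comp tendsto_natCast_atTop_atTop

theorem tendsto_rpow_nhdsGT_zero {a : ℝ} (ha : 0 < a) :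
    Tendsto (fun x : ℝ => x ^ a) (𝓝[>] 0) (𝓝[>] 0) := by
  refine tendsto_nhdsWithin_iff.2 ⟨?_, ?_⟩
  · have := (Real.continuousAt_rpow_const 0 a (Or.inr ha.le)).tendsto
    rw [Real.zero_rpow ha.ne'] at this
    exact this.mono_left nhdsWithin_le_nhds
  · filter_upwards [self_mem_nhdsWithin] with x hx using Real.rpow_pos_of_pos hx a

theorem div_natCast_le_rpow {c D a : ℝ} {n : ℕ} (hn : 2 ≤ n) (hc : c / D ≤ Real.log n) (hD : 0 < D)
    (hDn : D * (Real.log n / n) ≤ 1) (ha : a ≤ 1) : c / n ≤ (D * (Real.log n / n)) ^ a :=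
  calc c / n ≤ D * Real.log n / n := by
        rw [div_le_iff₀' hD] at hc
        gcongr
    _ = (D * (Real.log n / n)) ^ (1 : ℝ) := by rw [Real.rpow_one, mul_div_assoc]
    _ ≤ _ := Real.rpow_le_rpow_of_exponent_ge (mul_pos hD (log_div_pos hn)) hDn ha

theorem sqrt_rpow_two_div_pow (d : ℕ) {r : ℝ} (hr : 0 ≤ r) :
    √(r ^ ((2 : ℝ) / (d + 1))) ^ (d + 1) = r := by
  rw [Real.sqrt_eq_rpow, ← Real.rpow_natCast, ← Real.rpow_mul hr, ← Real.rpow_mul hr]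
  have : (2 : ℝ) / (d + 1) * (1 / 2) * ((d + 1 : ℕ) : ℝ) = 1 := by
    push_cast
    field_simp
  rw [this, Real.rpow_one]

end Rates

section Sample

variable {d : ℕ} {Ω : Type*} [MeasurableSpace Ω] {P : Measure Ω} {X : ℕ → Ω → E d} {f : E d → ℝ}

theorem ae_eventually_of_measure_le {p : ℕ → Ω → Prop} {a : ℕ → ℝ} (ha : Summable a)
    (h : ∀ᶠ n in atTop, P {ω | ¬ p n ω} ≤ ENNReal.ofReal (a n)) :
    ∀ᵐ ω ∂P, ∀ᶠ n in atTop, p n ω := by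
  obtain ⟨N, hN⟩ := eventually_atTop.1 h
  have hsum : ∑' n, P {ω | N ≤ n ∧ ¬ p n ω} ≠ ⊤ := by
    refine ne_top_of_le_ne_top ha.tsum_ofReal_ne_top (ENNReal.tsum_le_tsum fun n => ?_)
    by_cases hn : N ≤ n
    · exact (measure_mono fun ω hω => hω.2).trans (hN n hn)
    · simp [hn]
  filter_upwards [ae_eventually_notMem hsum] with ω hω
  filter_upwards [hω, eventually_ge_atTop N] with n hn hnN
  by_contra hcon
  exact hn ⟨hnN, hcon⟩

theorem IsSampleFrom.measure_notMem_le [IsProbabilityMeasure P] (hX : IsSampleFrom P X f)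
    {B : Set (E d)} (hB : MeasurableSet B) {lam v : ℝ} (hlam : 0 ≤ lam) (hBf : B ⊆ levelSet f lam)
    (hv : ENNReal.ofReal v ≤ volume B) (i : ℕ) :
    P (X i ⁻¹' Bᶜ) ≤ ENNReal.ofReal (Real.exp (-(lam * v))) := by
  obtain ⟨hmeas, -, hlaw⟩ := hX
  have hmass : ENNReal.ofReal (lam * v) ≤ P (X i ⁻¹' B) := by
    rw [← Measure.map_apply (hmeas i) hB, hlaw i, withDensity_apply _ hB, ENNReal.ofReal_mul hlam]
    calc ENNReal.ofReal lam * ENNReal.ofReal v ≤ ENNReal.ofReal lam * volume B := by gcongr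
      _ = ∫⁻ _ in B, ENNReal.ofReal lam := by rw [setLIntegral_const]
      _ ≤ _ := setLIntegral_mono' hB fun z hz => ENNReal.ofReal_le_ofReal (hBf hz)
  rw [Set.preimage_compl, prob_compl_eq_one_sub (hmeas i hB)]
  calc 1 - P (X i ⁻¹' B) ≤ 1 - ENNReal.ofReal (lam * v) := tsub_le_tsub_left hmass 1
    _ ≤ ENNReal.ofReal (1 - lam * v) := by
        rw [← ENNReal.ofReal_one, tsub_le_iff_right]
        simpa using ENNReal.ofReal_add_le (p := 1 - lam * v) (q := lam * v)
    _ ≤ _ := ENNReal.ofReal_le_ofReal (Real.one_sub_le_exp_neg _)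

theorem IsSampleFrom.measure_forall_notMem_le [IsProbabilityMeasure P] (hX : IsSampleFrom P X f)
    {B : Set (E d)} (hB : MeasurableSet B) {lam v : ℝ} (hlam : 0 ≤ lam) (hBf : B ⊆ levelSet f lam)
    (hv : ENNReal.ofReal v ≤ volume B) (n : ℕ) :
    P {ω | ∀ i < n, X i ω ∉ B} ≤ ENNReal.ofReal (Real.exp (-(n * (lam * v)))) := by
  have hset : {ω | ∀ i < n, X i ω ∉ B} = ⋂ i ∈ Finset.range n, X i ⁻¹' Bᶜ := by
    ext ω
    simp
  rw [hset, hX.2.1.measure_inter_preimage_eq_mul (Finset.range n) (sets := fun _ => Bᶜ)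
    (fun _ _ => hB.compl)]
  refine (Finset.prod_le_prod' fun i _ => hX.measure_notMem_le hB hlam hBf hv i).trans_eq ?_
  rw [Finset.prod_const, Finset.card_range, ← ENNReal.ofReal_pow (Real.exp_pos _).le,
    ← Real.exp_nat_mul, mul_neg]

/-- A union bound over the smaller boxes whose centers and axes lie on a grid. -/
theorem IsSampleFrom.measure_not_isBoxDense_le [IsProbabilityMeasure P] (hX : IsSampleFrom P X f)
    {lam : ℝ} (hlam : 0 ≤ lam) {N : ℕ} (hN1 : 1 ≤ N) (hN : ∀ x, lam ≤ f x → ‖x‖ ≤ N) {s v : ℝ}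
    (hs : 0 ≤ s) (hs1 : s ≤ 1)
    (hv : ∀ x η : E d, ‖η‖ ≤ 2 → ENNReal.ofReal v ≤ volume (box x η (s / 4)))
    {n : ℕ} (hn : 1 ≤ n) (hdn : d / n ≤ s / 4) :
    P {ω | ¬ IsBoxDense ((X · ω) '' Set.Iio n) (levelSet f lam) s} ≤
      ENNReal.ofReal (((2 * N + 1) * n) ^ (2 * d) * Real.exp (-(n * (lam * v)))) := by
  classical
  set G := ((grid d N n) ×ˢ (grid d N n)).filter fun q =>
    ‖q.2‖ ≤ 2 ∧ box q.1 q.2 (s / 4) ⊆ levelSet f lam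
  have hsub : {ω | ¬ IsBoxDense ((X · ω) '' Set.Iio n) (levelSet f lam) s} ⊆
      ⋃ q ∈ G, {ω | ∀ i < n, X i ω ∉ box q.1 q.2 (s / 4)} := fun ω hω => by
    simp only [IsBoxDense, not_forall, Set.mem_ofPred_eq] at hω
    obtain ⟨x, η, hη, hbox, hempty⟩ := hω
    obtain ⟨x', hx', hxx'⟩ := exists_mem_grid hn (hN x (hbox (mem_box_self x η hs)))
    obtain ⟨η', hη', hηη'⟩ := exists_mem_grid (N := N) hn (x := η) (by
      rw [hη]
      exact_mod_cast hN1)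
    have hss := box_subset_box hs hs1 hη (hxx'.trans hdn) (hηη'.trans hdn)
    have hη'2 : ‖η'‖ ≤ 2 := by linarith [norm_le_norm_add_norm_sub η η']
    exact Set.mem_iUnion₂.2 ⟨(x', η'), Finset.mem_filter.2
      ⟨Finset.mem_product.2 ⟨hx', hη'⟩, hη'2, hss.trans hbox⟩,
      fun i hi h => hempty ⟨X i ω, ⟨i, hi, rfl⟩, hss h⟩⟩
  have hone : ∀ q ∈ G, P {ω | ∀ i < n, X i ω ∉ box q.1 q.2 (s / 4)} ≤
      ENNReal.ofReal (Real.exp (-(n * (lam * v)))) := fun q hq =>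
    have ⟨_, hq2, hqf⟩ := Finset.mem_filter.1 hq
    hX.measure_forall_notMem_le (isClosed_box _ _ _).measurableSet hlam hqf (hv _ _ hq2) n
  have hcard : (G.card : ℝ) ≤ ((2 * N + 1) * n) ^ (2 * d) :=
    calc (G.card : ℝ) ≤ (grid d N n).card * (grid d N n).card := by
          exact_mod_cast (Finset.card_filter_le _ _).trans (Finset.card_product _ _).le
      _ ≤ ((2 * N + 1) * n) ^ d * ((2 * N + 1) * n) ^ d := by gcongr <;> exact card_grid_le d N hn
      _ = _ := by rw [two_mul d, pow_add]
  refine (measure_mono hsub).trans <| (measure_biUnion_finset_le G _).trans <|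
    (Finset.sum_le_sum hone).trans ?_
  rw [Finset.sum_const, nsmul_eq_mul, ENNReal.ofReal_mul (by positivity),
    ← ENNReal.ofReal_natCast]
  gcongr

theorem IsSampleFrom.exists_eventually_isBoxDense [IsProbabilityMeasure P] [Nontrivial (E d)]
    (hX : IsSampleFrom P X f) {lam : ℝ} (hlam : 0 < lam)
    (hb : Bornology.IsBounded (levelSet f lam)) :
    ∃ C > 0, ∀ᵐ ω ∂P, ∀ᶠ n : ℕ in atTop, IsBoxDense ((X · ω) '' Set.Iio n) (levelSet f lam)
      (C * (Real.log n / n) ^ ((2 : ℝ) / (d + 1))) := by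
  obtain ⟨c, hc, hvol⟩ := exists_le_volume_box d
  obtain ⟨R, hR⟩ := hb.exists_norm_le
  obtain ⟨N, hN⟩ := exists_nat_ge (max R 1)
  have hN1 : 1 ≤ N := by exact_mod_cast (le_max_right R 1).trans hN
  have hNf : ∀ x, lam ≤ f x → ‖x‖ ≤ N := fun x hx =>
    (hR x hx).trans ((le_max_left R 1).trans hN)
  set D : ℝ := 2 ^ (d + 1) * (2 * d + 2) / (lam * c) with hD
  set a : ℝ := 2 / (d + 1) with ha
  have hD0 : 0 < D := by positivity
  have ha0 : 0 < a := by positivity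
  have ha1 : a ≤ 1 := by
    have : (1 : ℝ) ≤ d := by exact_mod_cast pos_of_nontrivial d
    rw [ha, div_le_one (by positivity)]
    linarith
  refine ⟨D ^ a, by positivity, ae_eventually_of_measure_le
    ((Real.summable_one_div_nat_pow.2 one_lt_two).mul_left ((2 * N + 1 : ℝ) ^ (2 * d))) ?_⟩
  filter_upwards [tendsto_log_div.eventually (eventually_const_mul_lt D one_pos),
    eventually_ge_atTop 2, tendsto_log_natCast.eventually_ge_atTop (4 * d / D)] with n hn1 hn2 hn3
  have hr0 : 0 < D * (Real.log n / n) := mul_pos hD0 (log_div_pos hn2)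
  rw [← Real.mul_rpow hD0.le (log_div_pos hn2).le]
  have hdn := div_natCast_le_rpow hn2 hn3 hD0 hn1.le ha1
  set s := (D * (Real.log n / n)) ^ a with hs
  have hs0 : 0 < s := Real.rpow_pos_of_pos hr0 a
  have hs1 : s ≤ 1 := Real.rpow_le_one hr0.le hn1.le ha0.le
  refine (hX.measure_not_isBoxDense_le hlam.le hN1 hNf hs0.le hs1
    (fun x η hη => hvol x η hη (s / 4) (by positivity) (by linarith)) (by omega)
    (by rw [mul_div_assoc] at hdn; linarith)).trans_eq ?_
  have hexp : n * (lam * (c * √(s / 4) ^ (d + 1))) = ((2 * d + 2 : ℕ) : ℝ) * Real.log n := by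
    rw [Real.sqrt_div hs0.le, show (4 : ℝ) = 2 ^ 2 by norm_num, Real.sqrt_sq two_pos.le, div_pow,
      sqrt_rpow_two_div_pow d hr0.le, hD]
    push_cast
    field_simp
  rw [hexp, Real.exp_neg, Real.exp_nat_mul, Real.exp_log (by positivity), mul_pow, pow_add]
  congr 1
  field_simp

end Sample

section Bernstein

variable {Ω : Type*} [MeasurableSpace Ω] {P : Measure Ω}

theorem mgf_le_exp_of_integral_eq_zero [IsProbabilityMeasure P] {Y : Ω → ℝ}
    (hY : AEStronglyMeasurable Y P) {κ v lam : ℝ} (hκ : ∀ ω, |Y ω| ≤ κ) (h0 : ∫ ω, Y ω ∂P = 0)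
    (hv : ∫ ω, Y ω ^ 2 ∂P ≤ v) (hlamκ : |lam| * κ ≤ 1) :
    mgf Y P lam ≤ Real.exp (lam ^ 2 * v) := by
  have hYi : Integrable Y P := .of_bound hY κ (ae_of_all _ hκ)
  have hY2i : Integrable (fun ω => Y ω ^ 2) P :=
    .of_bound (hY.pow 2) (κ ^ 2) <| ae_of_all _ fun ω => by
      rw [norm_pow]
      exact pow_le_pow_left₀ (norm_nonneg _) (hκ ω) 2
  have hexp (ω : Ω) : Real.exp (lam * Y ω) ≤ 1 + lam * Y ω + lam ^ 2 * Y ω ^ 2 := by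
    have h1 : |lam * Y ω| ≤ 1 := by
      rw [abs_mul]
      exact (by gcongr; exact hκ ω : |lam| * |Y ω| ≤ |lam| * κ).trans hlamκ
    linarith [le_of_abs_le (Real.abs_exp_sub_one_sub_id_le h1), mul_pow lam (Y ω) 2]
  have hlin : Integrable (fun ω => 1 + lam * Y ω) P := (integrable_const 1).add (hYi.const_mul lam)
  calc mgf Y P lam ≤ ∫ ω, (1 + lam * Y ω + lam ^ 2 * Y ω ^ 2) ∂P :=
        integral_mono_of_nonneg (ae_of_all _ fun ω => (Real.exp_pos _).le)
          (hlin.add (hY2i.const_mul _)) (ae_of_all _ hexp)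
    _ = 1 + lam ^ 2 * ∫ ω, Y ω ^ 2 ∂P := by
        rw [integral_add hlin (hY2i.const_mul _), integral_add (integrable_const 1)
          (hYi.const_mul lam), integral_const_mul, integral_const_mul, h0]
        simp
    _ ≤ lam ^ 2 * v + 1 := by
        rw [add_comm]
        gcongr
    _ ≤ _ := Real.add_one_le_exp _

theorem measureReal_le_sum_le_exp {ι : Type*} [IsProbabilityMeasure P] {Y : ι → Ω → ℝ}
    (hind : iIndepFun Y P) (hY : ∀ j, Measurable (Y j)) {κ v lam : ℝ} (hκ : ∀ j ω, |Y j ω| ≤ κ)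
    (h0 : ∀ j, ∫ ω, Y j ω ∂P = 0) (hv : ∀ j, ∫ ω, Y j ω ^ 2 ∂P ≤ v) (hlam : 0 ≤ lam)
    (hlamκ : lam * κ ≤ 1) (S : Finset ι) (s : ℝ) :
    P.real {ω | s ≤ ∑ j ∈ S, Y j ω} ≤ Real.exp (-lam * s + S.card * (lam ^ 2 * v)) := by
  have hint : Integrable (fun ω => Real.exp (lam * (∑ j ∈ S, Y j) ω)) P := by
    refine .of_bound (C := Real.exp (lam * (S.card * κ))) ?_ (ae_of_all _ fun ω => ?_)
    · simp only [Finset.sum_apply]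
      exact ((Finset.measurable_sum S fun j _ => hY j).const_mul lam).exp.aestronglyMeasurable
    · rw [Real.norm_of_nonneg (Real.exp_pos _).le, Finset.sum_apply, ← nsmul_eq_mul]
      gcongr
      exact Finset.sum_le_card_nsmul S _ κ fun j _ => le_of_abs_le (hκ j ω)
  calc P.real {ω | s ≤ ∑ j ∈ S, Y j ω}
      ≤ Real.exp (-lam * s) * mgf (∑ j ∈ S, Y j) P lam := by
        simpa only [Finset.sum_apply] using measure_ge_le_exp_mul_mgf s hlam hint
    _ ≤ Real.exp (-lam * s) * ∏ _ ∈ S, Real.exp (lam ^ 2 * v) := by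
        rw [hind.mgf_sum hY]
        gcongr with j
        · exact fun j _ => mgf_nonneg
        · exact mgf_le_exp_of_integral_eq_zero (hY j).aestronglyMeasurable (hκ j) (h0 j) (hv j)
            (by rwa [abs_of_nonneg hlam])
    _ = _ := by rw [Finset.prod_const, ← Real.exp_nat_mul, Real.exp_add]

theorem measure_le_abs_sum_le_exp {ι : Type*} [IsProbabilityMeasure P] {Y : ι → Ω → ℝ}
    (hind : iIndepFun Y P) (hY : ∀ j, Measurable (Y j)) {κ v lam : ℝ} (hκ : ∀ j ω, |Y j ω| ≤ κ)
    (h0 : ∀ j, ∫ ω, Y j ω ∂P = 0) (hv : ∀ j, ∫ ω, Y j ω ^ 2 ∂P ≤ v) (hlam : 0 ≤ lam)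
    (hlamκ : lam * κ ≤ 1) (S : Finset ι) (s : ℝ) :
    P {ω | s ≤ |∑ j ∈ S, Y j ω|} ≤
      ENNReal.ofReal (2 * Real.exp (-lam * s + S.card * (lam ^ 2 * v))) := by
  have hpos := measureReal_le_sum_le_exp hind hY hκ h0 hv hlam hlamκ S s
  have hneg := measureReal_le_sum_le_exp (Y := fun j ω => -Y j ω)
    (hind.comp (fun _ y => -y) fun _ => measurable_neg) (fun j => (hY j).neg)
    (fun j ω => by rw [abs_neg]; exact hκ j ω) (fun j => by rw [integral_neg, h0 j, neg_zero])
    (fun j => by simpa only [neg_sq] using hv j) hlam hlamκ S s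
  have hunion : {ω | s ≤ |∑ j ∈ S, Y j ω|} ⊆
      {ω | s ≤ ∑ j ∈ S, Y j ω} ∪ {ω | s ≤ ∑ j ∈ S, -Y j ω} := fun ω hω => by
    simp only [Finset.sum_neg_distrib]
    exact le_abs.1 (show s ≤ |∑ j ∈ S, Y j ω| from hω)
  rw [← ofReal_measureReal, two_mul]
  exact ENNReal.ofReal_le_ofReal <| (measureReal_mono hunion).trans <|
    (measureReal_union_le _ _).trans (add_le_add hpos hneg)

theorem measure_prodMk_mem_le_of_indepFun [IsProbabilityMeasure P] {α β : Type*}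
    [MeasurableSpace α] [MeasurableSpace β] {X : Ω → α} {Y : Ω → β} (hX : Measurable X)
    (hY : Measurable Y) (hind : IndepFun X Y P) {A : Set (α × β)} (hA : MeasurableSet A)
    {b : ENNReal} (hb : ∀ x, P {ω | (x, Y ω) ∈ A} ≤ b) : P {ω | (X ω, Y ω) ∈ A} ≤ b := by
  have := Measure.isProbabilityMeasure_map (μ := P) hX.aemeasurable
  have := Measure.isProbabilityMeasure_map (μ := P) hY.aemeasurable
  calc P {ω | (X ω, Y ω) ∈ A} = ((P.map X).prod (P.map Y)) A := by
        rw [← hind.map_prod_eq_prod_map_map hX.aemeasurable hY.aemeasurable,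
          Measure.map_apply (hX.prodMk hY) hA]
        rfl
    _ = ∫⁻ x, P {ω | (x, Y ω) ∈ A} ∂(P.map X) := by
        rw [Measure.prod_apply hA]
        exact lintegral_congr fun x => Measure.map_apply hY (measurable_prodMk_left hA)
    _ ≤ ∫⁻ _, b ∂(P.map X) := lintegral_mono hb
    _ = b := by simp

end Bernstein

section Mean

variable {d : ℕ} {Ω : Type*} [MeasurableSpace Ω] {P : Measure Ω} {X : ℕ → Ω → E d} {f : E d → ℝ}

theorem integral_comp_smul_sub (g f : E d → ℝ) {h : ℝ} (hh : 0 < h) (x : E d) :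
    ∫ y, g (h⁻¹ • (x - y)) * f y = h ^ d * ∫ z, g z * f (x - h • z) := by
  have htranslate : ∫ y, g (h⁻¹ • (x - y)) * f y = ∫ y, g (h⁻¹ • y) * f (x - y) := by
    rw [← integral_sub_left_eq_self (fun y => g (h⁻¹ • y) * f (x - y)) volume x]
    simp only [sub_sub_cancel]
  have hscale := Measure.integral_comp_smul volume (fun z => g z * f (x - h • z)) h⁻¹
  simp only [smul_smul, mul_inv_cancel₀ hh.ne', one_smul] at hscale
  rw [htranslate, hscale]
  simp [abs_of_pos (pow_pos hh d)]

theorem IsSampleFrom.integral_comp (hX : IsSampleFrom P X f) (hf : Measurable f)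
    (hf0 : ∀ x, 0 ≤ f x) {g : E d → ℝ} (hg : Measurable g) (i : ℕ) :
    ∫ ω, g (X i ω) ∂P = ∫ y, g y * f y := by
  obtain ⟨hmeas, -, hlaw⟩ := hX
  rw [← integral_map (hmeas i).aemeasurable hg.aestronglyMeasurable, hlaw i,
    integral_withDensity_eq_integral_toReal_smul hf.ennreal_ofReal
      (ae_of_all _ fun x => ENNReal.ofReal_lt_top)]
  simp only [ENNReal.toReal_ofReal (hf0 _), smul_eq_mul, mul_comm]

/-- Bounded measurable functions with compact support: the kernels for which the estimator
concentrates around its mean. -/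
structure IsBoundedKernel (K : E d → ℝ) : Prop where
  measurable : Measurable K
  exists_bound : ∃ κ, ∀ x, |K x| ≤ κ
  hasCompactSupport : HasCompactSupport K

namespace IsBoundedKernel

variable {K : E d → ℝ} (hK : IsBoundedKernel K)

include hK in
theorem integrable_mul {g : E d → ℝ} (hg : LocallyIntegrable g) :
    Integrable fun z => K z * g z := by
  obtain ⟨κ, hκ⟩ := hK.exists_bound
  rw [← integrableOn_iff_integrable_of_support_subset (s := tsupport K)
    (Function.support_mul_subset_left K g |>.trans (subset_tsupport K))]
  exact (hg.integrableOn_isCompact hK.hasCompactSupport).bdd_mul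
    hK.measurable.aestronglyMeasurable (ae_of_all _ hκ)

include hK in
theorem integrable : Integrable K := by
  simpa using hK.integrable_mul (locallyIntegrable_const 1)

include hK in
theorem integrable_sq : Integrable fun z => K z ^ 2 := by
  simpa only [sq] using hK.integrable_mul hK.integrable.locallyIntegrable

end IsBoundedKernel

/-- The expectation of the kernel density estimator at a fixed point. -/
noncomputable def kdeMean (K f : E d → ℝ) (h : ℝ) (x : E d) : ℝ := ∫ z, K z * f (x - h • z)

theorem abs_kdeMean_le {K : E d → ℝ} {F : ℝ} (hK : Integrable K) (hF : ∀ x, |f x| ≤ F) (h : ℝ)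
    (x : E d) : |kdeMean K f h x| ≤ F * ∫ z, |K z| := by
  rw [kdeMean, ← Real.norm_eq_abs, ← integral_const_mul]
  refine norm_integral_le_of_norm_le (hK.abs.const_mul F) (ae_of_all _ fun z => ?_)
  rw [norm_mul, Real.norm_eq_abs, Real.norm_eq_abs, mul_comm]
  gcongr
  exact hF _

theorem measurable_kdeMean {K : E d → ℝ} (hK : Measurable K) (hf : Measurable f) (h : ℝ) :
    Measurable (kdeMean K f h) :=
  have : Measurable fun q : E d × E d => K q.2 * f (q.1 - h • q.2) := by fun_prop
  this.stronglyMeasurable.integral_prod_right.measurable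

end Mean

section Bandwidth

variable {d p : ℕ} {h : ℕ → ℝ}

theorem kdeRate_pos (d p : ℕ) {n : ℕ} (hn : 2 ≤ n) : 0 < kdeRate d p n :=
  Real.rpow_pos_of_pos (log_div_pos hn) _

theorem tendsto_kdeRate (d : ℕ) (hp : p ≠ 0) : Tendsto (kdeRate d p) atTop (𝓝[>] 0) :=
  (tendsto_rpow_nhdsGT_zero (by positivity)).comp tendsto_log_div

theorem kdeRate_eq_pow (d p n : ℕ) :
    kdeRate d p n = ((Real.log n / n) ^ (1 / ((d : ℝ) + 2 * p))) ^ p := by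
  have hr : 0 ≤ Real.log n / n := div_nonneg (Real.log_natCast_nonneg n) n.cast_nonneg
  rw [kdeRate, ← Real.rpow_natCast, ← Real.rpow_mul hr, one_div_mul_eq_div]

theorem log_eq_mul_kdeRate_sq (d n : ℕ) (hp : p ≠ 0) :
    Real.log n =
      n * ((Real.log n / n) ^ (1 / ((d : ℝ) + 2 * p))) ^ d * kdeRate d p n ^ 2 := by
  have hr : 0 ≤ Real.log n / n := div_nonneg (Real.log_natCast_nonneg n) n.cast_nonneg
  have hexp : 1 / ((d : ℝ) + 2 * p) * ((d + p * 2 : ℕ) : ℝ) = 1 := by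
    push_cast
    field_simp
  rw [kdeRate_eq_pow, mul_assoc, ← pow_mul, ← pow_add, ← Real.rpow_natCast, ← Real.rpow_mul hr,
    hexp, Real.rpow_one]
  rcases eq_or_ne n 0 with rfl | hn
  · simp
  · field_simp

theorem isBigO_bandwidth_pow
    (hθ : h =Θ[atTop] fun n : ℕ => (Real.log n / n) ^ (1 / ((d : ℝ) + 2 * p))) :
    (fun n => h n ^ p) =O[atTop] kdeRate d p := by
  simpa only [← kdeRate_eq_pow] using hθ.1.pow p

theorem isBigO_log_bandwidth (hp : p ≠ 0)
    (hθ : h =Θ[atTop] fun n : ℕ => (Real.log n / n) ^ (1 / ((d : ℝ) + 2 * p))) :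
    (fun n : ℕ => Real.log n) =O[atTop] fun n => n * h n ^ d * kdeRate d p n ^ 2 := by
  refine (((isBigO_refl (fun n : ℕ => (n : ℝ)) atTop).mul (hθ.2.pow d)).mul
    (isBigO_refl (fun n => kdeRate d p n ^ 2) atTop)).congr_left fun n => ?_
  exact (log_eq_mul_kdeRate_sq d n hp).symm

theorem tendsto_bandwidth (hp : p ≠ 0) (hpos : ∀ᶠ n in atTop, 0 < h n)
    (hθ : h =Θ[atTop] fun n : ℕ => (Real.log n / n) ^ (1 / ((d : ℝ) + 2 * p))) :
    Tendsto h atTop (𝓝[>] 0) :=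
  tendsto_nhdsWithin_iff.2 ⟨hθ.1.trans_tendsto <| tendsto_nhds_of_tendsto_nhdsWithin <|
    (tendsto_rpow_nhdsGT_zero (by positivity)).comp tendsto_log_div, hpos⟩

theorem exists_log_le_mul_bandwidth (hp : p ≠ 0) (hpos : ∀ᶠ n in atTop, 0 < h n)
    (hθ : h =Θ[atTop] fun n : ℕ => (Real.log n / n) ^ (1 / ((d : ℝ) + 2 * p))) :
    ∃ b > 0, ∀ᶠ n : ℕ in atTop, Real.log n ≤ b * (n * h n ^ d * kdeRate d p n ^ 2) := by
  obtain ⟨b, hb, hO⟩ := (isBigO_log_bandwidth hp hθ).exists_pos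
  refine ⟨b, hb, ?_⟩
  filter_upwards [hO.bound, hpos] with n hn hh
  rw [Real.norm_of_nonneg (by positivity : 0 ≤ n * h n ^ d * kdeRate d p n ^ 2)] at hn
  exact (Real.le_norm_self _).trans hn

theorem eventually_inv_le_kdeRate (hp : p ≠ 0) (hpos : ∀ᶠ n in atTop, 0 < h n)
    (hθ : h =Θ[atTop] fun n : ℕ => (Real.log n / n) ^ (1 / ((d : ℝ) + 2 * p))) :
    ∀ᶠ n : ℕ in atTop, 1 / (n * h n ^ d) ≤ kdeRate d p n := by
  obtain ⟨b, hb, hlog⟩ := exists_log_le_mul_bandwidth hp hpos hθ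
  have hsmall := (tendsto_kdeRate d hp).eventually (Ioo_mem_nhdsGT one_pos)
  filter_upwards [hlog, hpos, tendsto_log_natCast.eventually_ge_atTop b, hsmall,
    eventually_gt_atTop 0] with n hn hh hbn ⟨hρ0, hρ1⟩ hn0
  rw [div_le_iff₀ (by positivity)]
  calc 1 ≤ n * h n ^ d * kdeRate d p n ^ 2 := by
        rw [← mul_le_mul_iff_right₀ hb, mul_one]
        exact hbn.trans hn
    _ = kdeRate d p n * (kdeRate d p n * (n * h n ^ d)) := by ring
    _ ≤ kdeRate d p n * (n * h n ^ d) := mul_le_of_le_one_left (by positivity) hρ1.le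

theorem eventually_one_div_le_kdeRate (d : ℕ) (hp : p ≠ 0) :
    ∀ᶠ n : ℕ in atTop, 1 / (n : ℝ) ≤ kdeRate d p n := by
  filter_upwards [tendsto_log_div.eventually (Ioo_mem_nhdsGT one_pos),
    tendsto_log_natCast.eventually_ge_atTop 1, eventually_ge_atTop 2] with n hn hlog hn2
  have hp0 : (0 : ℝ) < p := by positivity
  simpa only [one_mul, kdeRate] using div_natCast_le_rpow (c := 1) (D := 1) hn2
    (by rwa [div_one]) one_pos (by simpa only [one_mul] using hn.2.le)
    (show (p : ℝ) / (d + 2 * p) ≤ 1 by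
      rw [div_le_one (by positivity)]
      linarith [d.cast_nonneg (α := ℝ)])

end Bandwidth

section Concentration

variable {d : ℕ} {Ω : Type*} [MeasurableSpace Ω] {P : Measure Ω} [IsProbabilityMeasure P]
  {X : ℕ → Ω → E d} {f K : E d → ℝ}

/-- The sum of the kernel contributions of the points `x j` at `y`, each centered by the mean
contribution of a random point with density `f`. -/
noncomputable def centeredKernelSum {ι : Type*} [Fintype ι] (K f : E d → ℝ) (h : ℝ)
    (x : ι → E d) (y : E d) : ℝ :=
  ∑ j, (K (h⁻¹ • (y - x j)) - h ^ d * kdeMean K f h y)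

theorem measurable_centeredKernelSum {ι : Type*} [Fintype ι] (hK : Measurable K)
    (hf : Measurable f) (h : ℝ) :
    Measurable fun q : E d × (ι → E d) => centeredKernelSum K f h q.2 q.1 := by
  have hmean := measurable_kdeMean hK hf h
  unfold centeredKernelSum
  fun_prop

theorem IsSampleFrom.integral_centered_eq_zero (hX : IsSampleFrom P X f) (hf : Measurable f)
    (hf0 : ∀ x, 0 ≤ f x) (hK : IsBoundedKernel K) {h : ℝ} (hh : 0 < h) (y : E d) (j : ℕ) :
    ∫ ω, (K (h⁻¹ • (y - X j ω)) - h ^ d * kdeMean K f h y) ∂P = 0 := by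
  have hKm := hK.measurable
  have hXj := hX.1 j
  obtain ⟨κ, hκ⟩ := hK.exists_bound
  have hint : Integrable (fun ω => K (h⁻¹ • (y - X j ω))) P :=
    .of_bound (Measurable.aestronglyMeasurable (by fun_prop)) κ (ae_of_all _ fun ω => hκ _)
  rw [integral_sub hint (integrable_const _),
    hX.integral_comp hf hf0 (g := fun z => K (h⁻¹ • (y - z))) (by fun_prop),
    integral_comp_smul_sub K f hh, kdeMean]
  simp

theorem IsSampleFrom.integral_centered_sq_le (hX : IsSampleFrom P X f) (hf : Measurable f)
    (hf0 : ∀ x, 0 ≤ f x) {F : ℝ} (hF : ∀ x, f x ≤ F) (hK : IsBoundedKernel K) {h : ℝ}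
    (hh : 0 < h) (y : E d) (j : ℕ) :
    ∫ ω, (K (h⁻¹ • (y - X j ω)) - h ^ d * kdeMean K f h y) ^ 2 ∂P ≤
      h ^ d * (F * ∫ z, K z ^ 2) := by
  have hKm := hK.measurable
  have hXj := hX.1 j
  have hmean : ∫ ω, K (h⁻¹ • (y - X j ω)) ∂P = h ^ d * kdeMean K f h y := by
    rw [hX.integral_comp hf hf0 (g := fun z => K (h⁻¹ • (y - z))) (by fun_prop),
      integral_comp_smul_sub K f hh, kdeMean]
  have hY : AEMeasurable (fun ω => K (h⁻¹ • (y - X j ω))) P := by fun_prop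
  calc ∫ ω, (K (h⁻¹ • (y - X j ω)) - h ^ d * kdeMean K f h y) ^ 2 ∂P
      = variance (fun ω => K (h⁻¹ • (y - X j ω))) P := by rw [variance_eq_integral hY, hmean]
    _ ≤ ∫ ω, K (h⁻¹ • (y - X j ω)) ^ 2 ∂P := variance_le_expectation_sq hY.aestronglyMeasurable
    _ = h ^ d * ∫ z, K z ^ 2 * f (y - h • z) := by
        rw [hX.integral_comp hf hf0 (g := fun z => K (h⁻¹ • (y - z)) ^ 2) (by fun_prop),
          integral_comp_smul_sub (fun z => K z ^ 2) f hh]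
    _ ≤ h ^ d * (F * ∫ z, K z ^ 2) := by
        gcongr
        rw [← integral_const_mul]
        refine integral_mono_of_nonneg (ae_of_all _ fun z => mul_nonneg (sq_nonneg _) (hf0 _))
          (hK.integrable_sq.const_mul F) (ae_of_all _ fun z => ?_)
        exact (mul_comm _ _).trans_le (mul_le_mul_of_nonneg_right (hF _) (sq_nonneg _))

theorem IsSampleFrom.measure_le_abs_centeredKernelSum_le (hX : IsSampleFrom P X f)
    (hf : Measurable f) (hf0 : ∀ x, 0 ≤ f x) {F : ℝ} (hF : ∀ x, f x ≤ F) (hK : IsBoundedKernel K)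
    {κ : ℝ} (hκ : ∀ x, |K x| ≤ κ) {h : ℝ} (hh : 0 < h) {lam : ℝ} (hlam : 0 ≤ lam)
    (hlamκ : lam * (2 * κ) ≤ 1) (S : Finset ℕ) (y : E d) (s : ℝ) :
    P {ω | s ≤ |centeredKernelSum K f h (fun j : S => X j ω) y|} ≤ ENNReal.ofReal
      (2 * Real.exp (-lam * s + S.card * (lam ^ 2 * (h ^ d * (F * ∫ z, K z ^ 2))))) := by
  have hKm := hK.measurable
  have hmean : |h ^ d * kdeMean K f h y| ≤ κ := by
    rw [← Real.norm_eq_abs, kdeMean, ← integral_comp_smul_sub K f hh,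
      ← hX.integral_comp hf hf0 (g := fun z => K (h⁻¹ • (y - z))) (by fun_prop) 0]
    simpa using norm_integral_le_of_norm_le_const (f := fun ω => K (h⁻¹ • (y - X 0 ω)))
      (ae_of_all P fun ω => hκ _)
  have hind : iIndepFun (fun (j : S) ω => K (h⁻¹ • (y - X j ω)) - h ^ d * kdeMean K f h y) P :=
    (hX.2.1.precomp Subtype.val_injective).comp
      (fun _ z => K (h⁻¹ • (y - z)) - h ^ d * kdeMean K f h y) fun _ => by fun_prop
  have hbound (j : S) (ω : Ω) :
      |K (h⁻¹ • (y - X j ω)) - h ^ d * kdeMean K f h y| ≤ 2 * κ := by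
    linarith [abs_sub (K (h⁻¹ • (y - X j ω))) (h ^ d * kdeMean K f h y), hκ (h⁻¹ • (y - X j ω))]
  simpa only [centeredKernelSum, Finset.card_univ, Fintype.card_coe] using
    measure_le_abs_sum_le_exp hind
      (fun j => by have := hX.1 j; fun_prop) hbound
      (fun j => hX.integral_centered_eq_zero hf hf0 hK hh y j)
      (fun j => hX.integral_centered_sq_le hf hf0 hF hK hh y j) hlam hlamκ Finset.univ s

theorem IsSampleFrom.measure_le_abs_centeredKernelSum_sample_le (hX : IsSampleFrom P X f)
    (hf : Measurable f) (hf0 : ∀ x, 0 ≤ f x) {F : ℝ} (hF : ∀ x, f x ≤ F) (hK : IsBoundedKernel K)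
    {κ : ℝ} (hκ : ∀ x, |K x| ≤ κ) {h : ℝ} (hh : 0 < h) {lam : ℝ} (hlam : 0 ≤ lam)
    (hlamκ : lam * (2 * κ) ≤ 1) {S : Finset ℕ} {i : ℕ} (hi : i ∉ S) (s : ℝ) :
    P {ω | s ≤ |centeredKernelSum K f h (fun j : S => X j ω) (X i ω)|} ≤ ENNReal.ofReal
      (2 * Real.exp (-lam * s + S.card * (lam ^ 2 * (h ^ d * (F * ∫ z, K z ^ 2))))) := by
  have hind : IndepFun (X i) (fun ω (j : S) => X j ω) P :=
    (hX.2.1.indepFun_finset {i} S (Finset.disjoint_singleton_left.2 hi) hX.1).comp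
      (measurable_pi_apply (⟨i, Finset.mem_singleton_self i⟩ : ({i} : Finset ℕ))) measurable_id
  exact measure_prodMk_mem_le_of_indepFun (Y := fun ω (j : S) => X j ω)
    (A := {q | s ≤ |centeredKernelSum K f h q.2 q.1|}) (hX.1 i)
    (measurable_pi_lambda _ fun j => hX.1 j) hind
    (measurableSet_le measurable_const (measurable_centeredKernelSum hK.measurable hf h).abs)
    fun y => hX.measure_le_abs_centeredKernelSum_le hf hf0 hF hK hκ hh hlam hlamκ S y s

theorem exp_le_one_div_pow_three {a c v ρ q : ℝ} {N n : ℕ} (hn : n ≠ 0) (hN : N ≤ n) (hv : 0 ≤ v)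
    (hq : 0 ≤ q) (hlog : Real.log n ≤ a * (n * q * ρ ^ 2)) (hc : v + 3 * a = c) :
    Real.exp (-ρ * (c * (n * q * ρ)) + N * (ρ ^ 2 * (q * v))) ≤ 1 / (n : ℝ) ^ 3 := by
  have hn0 : (0 : ℝ) < n := by positivity
  calc Real.exp (-ρ * (c * (n * q * ρ)) + N * (ρ ^ 2 * (q * v)))
      ≤ Real.exp (-ρ * (c * (n * q * ρ)) + n * (ρ ^ 2 * (q * v))) := by gcongr
    _ ≤ Real.exp (-((3 : ℕ) * Real.log n)) := by
        refine Real.exp_le_exp.2 ?_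
        rw [← hc]
        push_cast
        linarith
    _ = 1 / (n : ℝ) ^ 3 := by rw [Real.exp_neg, Real.exp_nat_mul, Real.exp_log hn0, one_div]

theorem IsSampleFrom.exists_eventually_abs_centeredKernelSum_le (hX : IsSampleFrom P X f)
    (hf : Measurable f) (hf0 : ∀ x, 0 ≤ f x) {F : ℝ} (hF : ∀ x, f x ≤ F) {p : ℕ} (hp : p ≠ 0)
    (hK : IsBoundedKernel K) {h : ℕ → ℝ} (hpos : ∀ᶠ n in atTop, 0 < h n)
    (hθ : h =Θ[atTop] fun n : ℕ => (Real.log n / n) ^ (1 / ((d : ℝ) + 2 * p))) :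
    ∃ c > 0, ∀ᵐ ω ∂P, ∀ᶠ n in atTop, ∀ i ∈ Finset.range n,
      |centeredKernelSum K f (h n) (fun j : (Finset.range n).erase i => X j ω) (X i ω)| ≤
        c * (n * h n ^ d * kdeRate d p n) := by
  obtain ⟨κ, hκ⟩ := hK.exists_bound
  obtain ⟨a, ha, hlog⟩ := exists_log_le_mul_bandwidth hp hpos hθ
  set v := F * ∫ z, K z ^ 2
  have hv : 0 ≤ v :=
    mul_nonneg ((hf0 0).trans (hF 0)) (integral_nonneg fun z => sq_nonneg _)
  have hrate := tendsto_kdeRate d hp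
  refine ⟨v + 3 * a, by positivity, ?_⟩
  refine ae_eventually_of_measure_le ((Real.summable_one_div_nat_pow.2 one_lt_two).mul_left 2) ?_
  filter_upwards [hpos, hlog, eventually_ne_atTop 0, hrate.eventually self_mem_nhdsWithin,
    hrate.eventually (eventually_const_mul_lt (2 * κ) one_pos)] with n hh hlogn hn hρ hρκ
  have hone (i : ℕ) : P {ω | (v + 3 * a) * (n * h n ^ d * kdeRate d p n) ≤ |centeredKernelSum K f
      (h n) (fun j : (Finset.range n).erase i => X j ω) (X i ω)|} ≤
      ENNReal.ofReal (2 * (1 / (n : ℝ) ^ 3)) := by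
    refine (hX.measure_le_abs_centeredKernelSum_sample_le hf hf0 hF hK hκ hh (le_of_lt hρ)
      (by rw [mul_comm]; exact hρκ.le) (Finset.notMem_erase i _) _).trans
      (ENNReal.ofReal_le_ofReal ?_)
    gcongr
    exact exp_le_one_div_pow_three hn (Finset.card_erase_le.trans (Finset.card_range n).le) hv
      (by positivity) hlogn rfl
  have hunion : {ω | ¬ ∀ i ∈ Finset.range n, |centeredKernelSum K f (h n)
        (fun j : (Finset.range n).erase i => X j ω) (X i ω)| ≤
        (v + 3 * a) * (n * h n ^ d * kdeRate d p n)} ⊆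
      ⋃ i ∈ Finset.range n, {ω | (v + 3 * a) * (n * h n ^ d * kdeRate d p n) ≤
        |centeredKernelSum K f (h n) (fun j : (Finset.range n).erase i => X j ω) (X i ω)|} := by
    intro ω hω
    simp only [Set.mem_ofPred_eq, not_forall, not_le] at hω
    obtain ⟨i, hi, hω⟩ := hω
    exact Set.mem_iUnion₂.2 ⟨i, hi, hω.le⟩
  refine (measure_mono hunion).trans <| (measure_biUnion_finset_le _ _).trans <|
    (Finset.sum_le_card_nsmul _ _ _ fun i _ => hone i).trans (le_of_eq ?_)
  rw [Finset.card_range, nsmul_eq_mul, ← ENNReal.ofReal_natCast,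
    ← ENNReal.ofReal_mul n.cast_nonneg]
  congr 1
  field_simp

theorem kde_sub_kdeMean {h : ℝ} (hh : 0 < h) {n i : ℕ} (hi : i ∈ Finset.range n)
    (x : ℕ → E d) :
    kde K h n x (x i) - kdeMean K f h (x i) = 1 / (n * h ^ d) *
      (K 0 + centeredKernelSum K f h (fun j : (Finset.range n).erase i => x j) (x i)) -
        kdeMean K f h (x i) * (1 / n) := by
  have hn : 1 ≤ n := (Nat.zero_le i).trans_lt (Finset.mem_range.1 hi)
  have hn0 : (n : ℝ) ≠ 0 := by positivity
  have hsum := Finset.sum_coe_sort ((Finset.range n).erase i)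
    fun j => K (h⁻¹ • (x i - x j)) - h ^ d * kdeMean K f h (x i)
  rw [centeredKernelSum, hsum, kde, ← Finset.add_sum_erase _ _ hi, sub_self, smul_zero,
    Finset.sum_sub_distrib, Finset.sum_const, Finset.card_erase_of_mem hi,
    Finset.card_range, nsmul_eq_mul, Nat.cast_sub hn, Nat.cast_one]
  field_simp
  ring

theorem IsSampleFrom.exists_eventually_abs_kde_sub_kdeMean_le (hX : IsSampleFrom P X f)
    (hf : Measurable f) (hf0 : ∀ x, 0 ≤ f x) {F : ℝ} (hF : ∀ x, f x ≤ F) {p : ℕ} (hp : p ≠ 0)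
    (hK : IsBoundedKernel K) {h : ℕ → ℝ} (hpos : ∀ᶠ n in atTop, 0 < h n)
    (hθ : h =Θ[atTop] fun n : ℕ => (Real.log n / n) ^ (1 / ((d : ℝ) + 2 * p))) :
    ∃ c > 0, ∀ᵐ ω ∂P, ∀ᶠ n in atTop, ∀ i < n,
      |kde K (h n) n (X · ω) (X i ω) - kdeMean K f (h n) (X i ω)| ≤ c * kdeRate d p n := by
  obtain ⟨c, hc, hsum⟩ :=
    hX.exists_eventually_abs_centeredKernelSum_le hf hf0 hF hp hK hpos hθ
  have hmean := abs_kdeMean_le hK.integrable (f := f) (F := F)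
    fun x => by rw [abs_of_nonneg (hf0 x)]; exact hF x
  set m := F * ∫ z, |K z|
  have hm : 0 ≤ m := (abs_nonneg _).trans (hmean 0 0)
  refine ⟨|K 0| + c + m, by positivity, ?_⟩
  filter_upwards [hsum] with ω hω
  filter_upwards [hω, hpos, eventually_inv_le_kdeRate hp hpos hθ,
    eventually_one_div_le_kdeRate d hp] with n hn hh hinv hinv' i hi
  replace hi := Finset.mem_range.2 hi
  have hn0 : (n : ℝ) ≠ 0 := by
    have := (Nat.zero_le i).trans_lt (Finset.mem_range.1 hi)
    positivity
  set q := n * h n ^ d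
  have hq0 : 0 < q := by positivity
  rw [kde_sub_kdeMean hh hi]
  set T := centeredKernelSum K f (h n) (fun j : (Finset.range n).erase i => X j ω) (X i ω)
  calc |1 / q * (K 0 + T) - kdeMean K f (h n) (X i ω) * (1 / n)|
      ≤ |1 / q * (K 0 + T)| + |kdeMean K f (h n) (X i ω) * (1 / n)| := abs_sub _ _
    _ ≤ 1 / q * (|K 0| + c * (q * kdeRate d p n)) + m * (1 / n) := by
        rw [abs_mul, abs_mul, abs_of_pos (one_div_pos.2 hq0), abs_of_nonneg (by positivity :
          0 ≤ 1 / (n : ℝ))]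
        gcongr
        · exact (abs_add_le _ _).trans (add_le_add_right (hn i hi) _)
        · exact hmean _ _
    _ = |K 0| * (1 / q) + c * kdeRate d p n + m * (1 / n) := by field_simp
    _ ≤ |K 0| * kdeRate d p n + c * kdeRate d p n + m * kdeRate d p n := by gcongr
    _ = (|K 0| + c + m) * kdeRate d p n := by ring

end Concentration

section Taylor

variable {V G : Type*} [NormedAddCommGroup V] [NormedSpace ℝ V] [NormedAddCommGroup G]
  [NormedSpace ℝ G]

/-- The Taylor polynomial of `f` at `x` of degree less than `n`, as a function of the increment. -/
noncomputable def taylorSum (f : V → G) (n : ℕ) (x y : V) : G :=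
  ∑ k ∈ Finset.range n, (k.factorial : ℝ)⁻¹ • iteratedFDeriv ℝ k f x fun _ => y

theorem norm_sub_taylorSum_le [CompleteSpace G] {f : V → G} {n : ℕ} {x y : V} {C : ℝ}
    (hf : ∀ t ∈ Set.Icc (0 : ℝ) 1, ContDiffAt ℝ (n + 1) f (x + t • y))
    (hC : ∀ t ∈ Set.Icc (0 : ℝ) 1, ‖iteratedFDeriv ℝ (n + 1) f (x + t • y)‖ ≤ C) :
    ‖f (x + y) - taylorSum f (n + 1) x y‖ ≤ C * ‖y‖ ^ (n + 1) := by
  have : 0 ≤ C := (norm_nonneg _).trans (hC 0 (by simp))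
  rw [map_add_eq_sum_add_integral_iteratedFDeriv hf, taylorSum, add_sub_cancel_left, norm_smul,
    norm_inv, Real.norm_natCast]
  refine (mul_le_of_le_one_left (norm_nonneg _) (inv_le_one_of_one_le₀ (by
    exact_mod_cast n.factorial_pos))).trans ?_
  have hbound : ∀ t ∈ Set.uIoc (0 : ℝ) 1,
      ‖(1 - t) ^ n • iteratedFDeriv ℝ (n + 1) f (x + t • y) fun _ => y‖ ≤
        C * ‖y‖ ^ (n + 1) := by
    intro t ht
    rw [Set.uIoc_of_le zero_le_one] at ht
    have hpow : ‖(1 - t) ^ n‖ ≤ 1 := by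
      rw [norm_pow]
      exact pow_le_one₀ (norm_nonneg _) (abs_le.2 ⟨by linarith [ht.2], by linarith [ht.1]⟩)
    rw [norm_smul]
    refine (mul_le_of_le_one_left (norm_nonneg _) hpow).trans ?_
    refine ((iteratedFDeriv ℝ (n + 1) f (x + t • y)).le_opNorm _).trans ?_
    rw [Finset.prod_const, Finset.card_univ, Fintype.card_fin]
    gcongr
    exact hC t ⟨ht.1.le, ht.2⟩
  simpa using intervalIntegral.norm_integral_le_of_norm_le_const hbound

theorem continuous_taylorSum (f : V → G) (n : ℕ) (x : V) : Continuous (taylorSum f n x) :=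
  continuous_finsetSum _ fun k _ => ((iteratedFDeriv ℝ k f x).cont.comp
    (continuous_pi fun _ => continuous_id)).const_smul _

end Taylor

section Moments

variable {d : ℕ} {K : E d → ℝ}

theorem map_const_eq_sum_prod_pow {j : ℕ}
    (A : ContinuousMultilinearMap ℝ (fun _ : Fin j => E d) ℝ) (z : E d) :
    A (fun _ => z) = ∑ r : Fin j → Fin d, (∏ i, z i ^ Fintype.card {k // r k = i}) *
      A fun k => EuclideanSpace.single (r k) 1 := by
  have hz : z = ∑ i, z i • EuclideanSpace.single i (1 : ℝ) := by
    simpa using ((EuclideanSpace.basisFun (Fin d) ℝ).sum_repr z).symm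
  conv_lhs => rw [hz]
  rw [A.map_sum]
  refine Finset.sum_congr rfl fun r _ => ?_
  rw [A.map_smul_univ (fun k => z (r k)), smul_eq_mul, ← Fintype.prod_fiberwise' r z]
  simp

theorem IsKernelOfOrderAtLeast.integral_mul_multilinear {p : ℕ} (hK : IsKernelOfOrderAtLeast p K)
    (hKb : IsBoundedKernel K) {j : ℕ} (hj : 0 < j) (hjp : j < p)
    (A : ContinuousMultilinearMap ℝ (fun _ : Fin j => E d) ℝ) :
    ∫ z, K z * A (fun _ => z) = 0 := by
  have hint (r : Fin j → Fin d) : Integrable fun z : E d =>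
      K z * ((∏ i, z i ^ Fintype.card {k // r k = i}) *
        A fun k => EuclideanSpace.single (r k) 1) :=
    hKb.integrable_mul (Continuous.locallyIntegrable (by fun_prop))
  have hcard (r : Fin j → Fin d) : ∑ i, Fintype.card {k // r k = i} = j := by
    have := Fintype.sum_fiberwise' r fun _ => (1 : ℕ)
    simpa using this
  simp only [map_const_eq_sum_prod_pow A, Finset.mul_sum]
  rw [integral_finsetSum _ fun r _ => hint r]
  refine Finset.sum_eq_zero fun r _ => ?_
  have hmoment := hK.2 (fun i => Fintype.card {k // r k = i}) (by rwa [hcard]) (by rwa [hcard])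
  have hcomm (z : E d) (c : ℝ) :
      K z * ((∏ i, z i ^ Fintype.card {k // r k = i}) * c) =
        (∏ i, z i ^ Fintype.card {k // r k = i}) * K z * c := by ring
  simp only [hcomm]
  rw [integral_mul_const, hmoment, zero_mul]

theorem IsKernelOfOrderAtLeast.integral_mul_taylorSum {p : ℕ} (hp : p ≠ 0)
    (hK : IsKernelOfOrderAtLeast p K) (hKb : IsBoundedKernel K) (f : E d → ℝ) (x : E d) (c : ℝ) :
    ∫ z, K z * taylorSum f p x (c • z) = f x := by
  have hhom (k : ℕ) (z : E d) : (iteratedFDeriv ℝ k f x fun _ => c • z) =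
      c ^ k * iteratedFDeriv ℝ k f x fun _ => z := by
    simpa using (iteratedFDeriv ℝ k f x).map_smul_univ (fun _ => c) (fun _ => z)
  have hint (k : ℕ) : Integrable fun z => K z * iteratedFDeriv ℝ k f x fun _ => z :=
    hKb.integrable_mul <| Continuous.locallyIntegrable <|
      (iteratedFDeriv ℝ k f x).cont.comp (continuous_pi fun _ => continuous_id)
  have hterm (z : E d) : K z * taylorSum f p x (c • z) = ∑ k ∈ Finset.range p,
      ((k.factorial : ℝ)⁻¹ * c ^ k) * (K z * iteratedFDeriv ℝ k f x fun _ => z) := by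
    rw [taylorSum, Finset.mul_sum]
    refine Finset.sum_congr rfl fun k _ => ?_
    rw [hhom, smul_eq_mul]
    ring
  simp only [hterm]
  rw [integral_finsetSum _ fun k _ => (hint k).const_mul _, Finset.sum_eq_single 0]
  · simp [integral_mul_const, hK.1]
  · intro k hk hk0
    rw [integral_const_mul, hK.integral_mul_multilinear hKb (Nat.pos_of_ne_zero hk0)
      (Finset.mem_range.1 hk), mul_zero]
  · simp [hp]

end Moments

section Bias

variable {d : ℕ} {f K : E d → ℝ}

theorem IsBoundedKernel.exists_norm_le (hK : IsBoundedKernel K) :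
    ∃ R > 0, ∀ z, K z ≠ 0 → ‖z‖ ≤ R := by
  obtain ⟨R, hR0, hR⟩ := hK.hasCompactSupport.isCompact.isBounded.exists_pos_norm_le
  exact ⟨R, hR0, fun z hz => hR z (subset_tsupport K hz)⟩

theorem IsBoundedKernel.eventually_norm_smul_le (hK : IsBoundedKernel K) {η : ℝ} (hη : 0 < η) :
    ∀ᶠ h in 𝓝[>] (0 : ℝ), ∀ z, K z ≠ 0 → ‖h • z‖ ≤ η := by
  obtain ⟨R, -, hR⟩ := hK.exists_norm_le
  filter_upwards [eventually_const_mul_lt R hη, self_mem_nhdsWithin] with h hh hpos z hz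
  rw [norm_smul, Real.norm_of_nonneg (le_of_lt hpos)]
  nlinarith [hR z hz, Set.mem_Ioi.1 hpos]

theorem IsBoundedKernel.integrable_mul_translate (hK : IsBoundedKernel K) (hf : Measurable f)
    {F : ℝ} (hF : ∀ x, |f x| ≤ F) (h : ℝ) (x : E d) : Integrable fun z => K z * f (x - h • z) :=
  hK.integrable.mul_bdd (c := F) (Measurable.aestronglyMeasurable (by fun_prop))
    (ae_of_all _ fun _ => hF _)

theorem abs_integral_mul_sub_le {α : Type*} [MeasurableSpace α] {μ : Measure α}
    {w g g' : α → ℝ} (hw : Integrable w μ) (hg : Integrable (fun z => w z * g z) μ)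
    (hg' : Integrable (fun z => w z * g' z) μ) {b : ℝ}
    (hb : ∀ z, w z ≠ 0 → |g z - g' z| ≤ b) :
    |(∫ z, w z * g z ∂μ) - ∫ z, w z * g' z ∂μ| ≤ b * ∫ z, |w z| ∂μ := by
  rw [← integral_sub hg hg', ← Real.norm_eq_abs, ← integral_const_mul]
  refine norm_integral_le_of_norm_le (hw.abs.const_mul b) (ae_of_all _ fun z => ?_)
  rw [← mul_sub, norm_mul, mul_comm, Real.norm_eq_abs, Real.norm_eq_abs]
  rcases eq_or_ne (w z) 0 with hz | hz
  · simp [hz]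
  · gcongr
    exact hb z hz

theorem exists_norm_sub_taylorSum_le {V G : Type*} [NormedAddCommGroup V] [NormedSpace ℝ V]
    [ProperSpace V] [NormedAddCommGroup G] [NormedSpace ℝ G] [CompleteSpace G] {g : V → G} {p : ℕ}
    (hp : p ≠ 0) {S U : Set V} (hS : IsCompact S) (hU : IsOpen U) (hSU : S ⊆ U)
    (hg : ContDiffOn ℝ p g U) :
    ∃ C ≥ 0, ∃ δ > 0, ∀ x ∈ S, ∀ y, ‖y‖ ≤ δ → ‖g (x + y) - taylorSum g p x y‖ ≤ C * ‖y‖ ^ p := by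
  obtain ⟨n, rfl⟩ := Nat.exists_eq_succ_of_ne_zero hp
  obtain ⟨δ, hδ, hδU⟩ := hS.exists_cthickening_subset_open hU hSU
  have hdiff : ∀ x ∈ U, ContDiffAt ℝ (n + 1) g x := fun x hx => by
    exact_mod_cast hg.contDiffAt (hU.mem_nhds hx)
  obtain ⟨C, hC⟩ := (hS.cthickening (r := δ)).exists_bound_of_continuousOn
    (f := iteratedFDeriv ℝ (n + 1) g) fun x hx => ((hdiff x (hδU hx)).iteratedFDeriv_right
      (m := 0) (i := n + 1) (by push_cast; simp)).continuousAt.continuousWithinAt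
  refine ⟨|C|, abs_nonneg C, δ, hδ, fun x hx y hy => ?_⟩
  have hseg : ∀ t ∈ Set.Icc (0 : ℝ) 1, x + t • y ∈ Metric.cthickening δ S := fun t ht => by
    refine Metric.closedBall_subset_cthickening hx δ ?_
    rw [Metric.mem_closedBall, dist_eq_norm, add_sub_cancel_left, norm_smul,
      Real.norm_of_nonneg ht.1]
    exact (mul_le_of_le_one_left (norm_nonneg y) ht.2).trans hy
  exact norm_sub_taylorSum_le (fun t ht => hdiff _ (hδU (hseg t ht)))
    fun t ht => (hC _ (hseg t ht)).trans (le_abs_self C)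

theorem exists_abs_kdeMean_sub_le {p : ℕ} (hp : p ≠ 0) (hKb : IsBoundedKernel K)
    (hK : IsKernelOfOrderAtLeast p K) (hf : Measurable f) {F : ℝ} (hF : ∀ x, |f x| ≤ F)
    {S U : Set (E d)} (hS : IsCompact S) (hU : IsOpen U) (hSU : S ⊆ U) (hfU : ContDiffOn ℝ p f U) :
    ∃ c ≥ 0, ∀ᶠ h in 𝓝[>] (0 : ℝ), ∀ x ∈ S, |kdeMean K f h x - f x| ≤ c * h ^ p := by
  obtain ⟨C, hC, δ, hδ, htaylor⟩ := exists_norm_sub_taylorSum_le hp hS hU hSU hfU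
  obtain ⟨R, hR0, hR⟩ := hKb.exists_norm_le
  refine ⟨C * R ^ p * ∫ z, |K z|, mul_nonneg (by positivity)
    (integral_nonneg fun z => abs_nonneg _), ?_⟩
  filter_upwards [hKb.eventually_norm_smul_le hδ, self_mem_nhdsWithin] with h hh hpos x hx
  have hrem : ∀ z, K z ≠ 0 →
      |f (x - h • z) - taylorSum f p x (-h • z)| ≤ C * R ^ p * h ^ p := by
    intro z hz
    have hz' := htaylor x hx (-h • z) (by rw [neg_smul, norm_neg]; exact hh z hz)
    rw [neg_smul, ← sub_eq_add_neg, norm_neg, norm_smul, Real.norm_of_nonneg (le_of_lt hpos)] at hz'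
    rw [mul_assoc, ← mul_pow, mul_comm R, neg_smul]
    refine hz'.trans ?_
    have := le_of_lt (Set.mem_Ioi.1 hpos)
    gcongr
    exact hR z hz
  calc |kdeMean K f h x - f x|
      = |kdeMean K f h x - ∫ z, K z * taylorSum f p x (-h • z)| := by
        rw [hK.integral_mul_taylorSum hp hKb]
    _ ≤ C * R ^ p * h ^ p * ∫ z, |K z| :=
        abs_integral_mul_sub_le hKb.integrable (hKb.integrable_mul_translate hf hF h x)
          (hKb.integrable_mul (((continuous_taylorSum f p x).comp
            (continuous_const_smul (-h))).locallyIntegrable)) hrem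
    _ = C * R ^ p * (∫ z, |K z|) * h ^ p := by ring

end Bias

section Separation

variable {d : ℕ} {f K : E d → ℝ} {l u : ℝ}

theorem kdeMean_le_of_forall_le (hKb : IsBoundedKernel K) (hK0 : ∀ z, 0 ≤ K z)
    (hK1 : ∫ z, K z = 1) (hf : Measurable f) {F : ℝ} (hF : ∀ x, |f x| ≤ F) {h b : ℝ} {x : E d}
    (hb : ∀ z, K z ≠ 0 → f (x - h • z) ≤ b) : kdeMean K f h x ≤ b := by
  calc kdeMean K f h x ≤ ∫ z, K z * b := by
        refine integral_mono (hKb.integrable_mul_translate hf hF h x)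
          (hKb.integrable.mul_const b) fun z => ?_
        rcases eq_or_ne (K z) 0 with hz | hz
        · simp [hz]
        · exact mul_le_mul_of_nonneg_left (hb z hz) (hK0 z)
    _ = b := by rw [integral_mul_const, hK1, one_mul]

theorem le_kdeMean_of_forall_le (hKb : IsBoundedKernel K) (hK0 : ∀ z, 0 ≤ K z)
    (hK1 : ∫ z, K z = 1) (hf : Measurable f) {F : ℝ} (hF : ∀ x, |f x| ≤ F) {h b : ℝ} {x : E d}
    (hb : ∀ z, K z ≠ 0 → b ≤ f (x - h • z)) : b ≤ kdeMean K f h x := by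
  have hneg := kdeMean_le_of_forall_le hKb hK0 hK1 hf.neg (F := F) (h := h) (x := x)
    (fun x => by simpa using hF x) fun z hz => neg_le_neg (hb z hz)
  simp only [kdeMean, Pi.neg_apply, mul_neg, integral_neg] at hneg
  exact neg_le_neg_iff.1 hneg

theorem eventually_abs_kdeMean_sub_le (hKb : IsBoundedKernel K) (hK1 : ∫ z, K z = 1)
    (hf : Measurable f) {F : ℝ} (hF : ∀ x, |f x| ≤ F) (huc : UniformContinuous f) {ε : ℝ}
    (hε : 0 < ε) : ∀ᶠ h in 𝓝[>] (0 : ℝ), ∀ x, |kdeMean K f h x - f x| ≤ ε := by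
  have : 0 ≤ ∫ z, |K z| := integral_nonneg fun z => abs_nonneg _
  obtain ⟨η, hη, hclose⟩ := Metric.uniformContinuous_iff.1 huc (ε / ((∫ z, |K z|) + 1))
    (by positivity)
  filter_upwards [hKb.eventually_norm_smul_le (half_pos hη)] with h hh x
  have hbound := abs_integral_mul_sub_le hKb.integrable (hKb.integrable_mul_translate hf hF h x)
    (hKb.integrable.mul_const (f x)) fun z hz => by
      refine (Real.dist_eq _ _ ▸ hclose (a := x - h • z) (b := x) ?_).le
      rw [dist_self_sub_left]
      linarith [hh z hz]
  rw [integral_mul_const, hK1, one_mul] at hbound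
  refine hbound.trans ?_
  rw [div_mul_eq_mul_div, div_le_iff₀ (by positivity)]
  linarith

namespace SmoothZone

variable (Z : SmoothZone f l u)

theorem exists_sub_le_or_high_of_near :
    ∃ η > 0, ∀ x y, ‖y - x‖ ≤ η → l - Z.ζ ≤ f x → f x - Z.ζ / 4 ≤ f y ∨ u + Z.ζ / 2 ≤ f y := by
  have hδ := Z.δ_pos
  have hζ := Z.ζ_pos
  have hM : 0 < Z.L + Z.k * Z.δ := add_pos_of_nonneg_of_pos Z.L_nonneg (mul_pos Z.k_pos hδ)
  refine ⟨min Z.δ (Z.ζ / (4 * (Z.L + Z.k * Z.δ))), by positivity, fun x y hxy hx => ?_⟩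
  have hyδ : ‖y - x‖ ≤ Z.δ := hxy.trans (min_le_left _ _)
  by_cases hxZ : x ∈ Z.carrier
  · left
    have hsmall := hxy.trans (min_le_right _ _)
    rw [le_div_iff₀ (by positivity)] at hsmall
    linarith [(abs_le.1 (Z.abs_sub_le hxZ hyδ)).1]
  · exact Or.inr (Z.high_of_notMem x (subset_closure hx) hxZ y hyδ)

theorem eventually_kdeMean_separated (hf : Measurable f) {F : ℝ} (hF : ∀ x, |f x| ≤ F)
    (hKb : IsBoundedKernel K) (hK1 : ∫ z, K z = 1)
    (hKf : (∀ x, 0 ≤ K x) ∨ UniformContinuous f) :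
    ∀ᶠ h in 𝓝[>] (0 : ℝ), ∀ x, (f x ≤ l - Z.ζ / 2 → kdeMean K f h x ≤ l - Z.ζ / 4) ∧
      (u + Z.ζ / 2 ≤ f x → u + Z.ζ / 4 ≤ kdeMean K f h x) := by
  have hζ := Z.ζ_pos
  have hlu := Z.le
  rcases hKf with hK0 | huc
  · obtain ⟨η, hη, hnear⟩ := Z.exists_sub_le_or_high_of_near
    filter_upwards [hKb.eventually_norm_smul_le hη] with h hh x
    refine ⟨fun hx => kdeMean_le_of_forall_le hKb hK0 hK1 hf hF fun z hz => ?_,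
      fun hx => le_kdeMean_of_forall_le hKb hK0 hK1 hf hF fun z hz => ?_⟩
    · by_contra! hcon
      rcases hnear (x - h • z) x (by simpa using hh z hz) (by linarith) with h' | h' <;> linarith
    · rcases hnear x (x - h • z) (by simpa using hh z hz) (by linarith) with h' | h' <;> linarith
  · filter_upwards [eventually_abs_kdeMean_sub_le hKb hK1 hf hF huc
      (show 0 < Z.ζ / 4 by positivity)] with h hh x
    have hx := abs_le.1 (hh x)
    exact ⟨fun _ => by linarith [hx.2], fun _ => by linarith [hx.1]⟩

end SmoothZone

end Separation

section Resolution

variable {d : ℕ} {f : E d → ℝ} {l u : ℝ}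

/-- `A` lies inside and `B` outside of the level set of `f` with level `t`, and, up to the
resolution `s`, both are dense there, as far as `f` is at least `lam`. -/
structure Resolves (f : E d → ℝ) (lam t s : ℝ) (A B : Set (E d)) : Prop where
  inner_subset : A ⊆ levelSet f t
  outer_lt : ∀ x ∈ B, f x < t
  inner_dense : IsBoxDense A (levelSet f (t + s)) s
  outer_dense : IsBoxDense B {z | lam ≤ f z ∧ f z ≤ t - s} s

namespace SmoothZone

/-- On `S`, the estimate `g` of `f` has error at most `ε`, or else estimate and density lie on the
same side of all levels in `[l, u]`, with room to spare. -/
def IsAccurate (Z : SmoothZone f l u) (g : E d → ℝ) (ε : ℝ) (S : Set (E d)) : Prop :=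
  ∀ x ∈ S, |g x - f x| ≤ ε ∨ (f x ≤ l - Z.ζ / 2 ∧ g x ≤ l - Z.ζ / 8) ∨
    (u + Z.ζ / 2 ≤ f x ∧ u + Z.ζ / 8 ≤ g x)

variable {Z : SmoothZone f l u} {g : E d → ℝ} {ε D s t : ℝ} {S : Set (E d)}

theorem IsAccurate.resolves (hg : Z.IsAccurate g ε S) (ht : t ∈ Set.Icc l u) (hε : 0 ≤ ε)
    (hεD : ε ≤ D) (hD : D + ε < Z.ζ / 8) (hs : D + ε < s)
    (hS : IsBoxDense S (levelSet f (l - Z.ζ)) s) :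
    Resolves f (l - Z.ζ) t s {x ∈ S | t + D ≤ g x} {x ∈ S | g x < t - D} := by
  have := Z.ζ_pos
  obtain ⟨hlt, htu⟩ := ht
  simp only [IsAccurate, abs_le] at hg
  refine ⟨fun x ⟨hxS, hx⟩ => ?_, fun x ⟨hxS, hx⟩ => ?_, fun x η hη hsub => ?_,
    fun x η hη hsub => ?_⟩
  · change t ≤ f x
    rcases hg x hxS with ⟨_, _⟩ | ⟨_, _⟩ | ⟨_, _⟩ <;> linarith
  · rcases hg x hxS with ⟨_, _⟩ | ⟨_, _⟩ | ⟨_, _⟩ <;> linarith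
  · obtain ⟨y, hyS, hy⟩ := hS x η hη fun z hz => by
      have : t + s ≤ f z := hsub hz
      change l - Z.ζ ≤ f z
      linarith
    have : t + s ≤ f y := hsub hy
    refine ⟨y, ⟨hyS, ?_⟩, hy⟩
    rcases hg y hyS with ⟨_, _⟩ | ⟨_, _⟩ | ⟨_, _⟩ <;> linarith
  · obtain ⟨y, hyS, hy⟩ := hS x η hη fun z hz => (hsub hz).1
    have := (hsub hy).2
    refine ⟨y, ⟨hyS, ?_⟩, hy⟩
    rcases hg y hyS with ⟨_, _⟩ | ⟨_, _⟩ | ⟨_, _⟩ <;> linarith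

end SmoothZone

end Resolution

section Estimator

variable {d p : ℕ} {f K : E d → ℝ} {h : ℕ → ℝ} {l u F : ℝ} {Ω : Type*} [MeasurableSpace Ω]
  {P : Measure Ω} {X : ℕ → Ω → E d}

theorem tendsto_levelSetRate (d : ℕ) (hp : p ≠ 0) :
    Tendsto (levelSetRate d p) atTop (𝓝[>] 0) := by
  have hbox : Tendsto (fun n : ℕ => (Real.log n / n) ^ ((2 : ℝ) / (d + 1))) atTop (𝓝[>] 0) :=
    (tendsto_rpow_nhdsGT_zero (by positivity)).comp tendsto_log_div
  rw [tendsto_nhdsWithin_iff] at hbox ⊢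
  have hkde := tendsto_nhdsWithin_iff.1 (tendsto_kdeRate d hp)
  refine ⟨?_, hkde.2.mono fun n (hn : 0 < kdeRate d p n) => lt_max_of_lt_left hn⟩
  have hmax := hkde.1.max hbox.1
  rwa [max_self] at hmax

theorem samplePlus_eq_sep (K : E d → ℝ) (h D : ℝ) (n : ℕ) (X : ℕ → E d) (t : ℝ) :
    samplePlus K h D n X t = {x ∈ X '' Set.Iio n | t + D ≤ kde K h n X x} := by
  ext x
  simp [samplePlus, ← and_assoc, eq_comm]

theorem sampleMinus_eq_sep (K : E d → ℝ) (h D : ℝ) (n : ℕ) (X : ℕ → E d) (t : ℝ) :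
    sampleMinus K h D n X t = {x ∈ X '' Set.Iio n | kde K h n X x < t - D} := by
  ext x
  simp [sampleMinus, ← and_assoc, eq_comm]

namespace SmoothZone

variable (Z : SmoothZone f l u)

theorem isAccurate_of_kdeMean {g gbar : E d → ℝ} {ε₁ ε₂ : ℝ} {S : Set (E d)}
    (hε₁ : ε₁ ≤ Z.ζ / 8) (hdev : ∀ x ∈ S, |g x - gbar x| ≤ ε₁)
    (hbias : ∀ x ∈ Z.carrier, |gbar x - f x| ≤ ε₂)
    (hsep : ∀ x, (f x ≤ l - Z.ζ / 2 → gbar x ≤ l - Z.ζ / 4) ∧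
      (u + Z.ζ / 2 ≤ f x → u + Z.ζ / 4 ≤ gbar x)) :
    Z.IsAccurate g (ε₁ + ε₂) S := by
  intro x hx
  have hζ := Z.ζ_pos
  obtain ⟨hdev₁, hdev₂⟩ := abs_le.1 (hdev x hx)
  rcases le_or_gt (f x) (l - Z.ζ / 2) with hlow | hlow
  · exact Or.inr (Or.inl ⟨hlow, by linarith [(hsep x).1 hlow]⟩)
  rcases le_or_gt (u + Z.ζ / 2) (f x) with hhigh | hhigh
  · exact Or.inr (Or.inr ⟨hhigh, by linarith [(hsep x).2 hhigh]⟩)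
  · exact Or.inl ((_root_.abs_sub_le _ (gbar x) _).trans
      (add_le_add (hdev x hx) (hbias x (Z.mem_carrier (by linarith) hhigh))))

theorem exists_eventually_isAccurate_kde [IsProbabilityMeasure P] {U : Set (E d)} (hU : IsOpen U)
    (hZU : Z.carrier ⊆ U) (hp : p ≠ 0) (hfU : ContDiffOn ℝ p f U) (hX : IsSampleFrom P X f)
    (hf : Measurable f) (hf0 : ∀ x, 0 ≤ f x) (hF : ∀ x, f x ≤ F) (hKb : IsBoundedKernel K)
    (hK : IsKernelOfOrderAtLeast p K) (hpos : ∀ᶠ n in atTop, 0 < h n)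
    (hθ : h =Θ[atTop] fun n : ℕ => (Real.log n / n) ^ (1 / ((d : ℝ) + 2 * p)))
    (hKf : (∀ x, 0 ≤ K x) ∨ UniformContinuous f) :
    ∃ c > 0, ∀ᵐ ω ∂P, ∀ᶠ n in atTop, Z.IsAccurate (kde K (h n) n (X · ω)) (c * kdeRate d p n)
      ((X · ω) '' Set.Iio n) := by
  have hFa (x) : |f x| ≤ F := by rw [abs_of_nonneg (hf0 x)]; exact hF x
  have hh := tendsto_bandwidth hp hpos hθ
  obtain ⟨c₀, hc₀, hdev⟩ := hX.exists_eventually_abs_kde_sub_kdeMean_le hf hf0 hF hp hKb hpos hθ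
  obtain ⟨c₁, hc₁, hbias⟩ := exists_abs_kdeMean_sub_le hp hKb hK hf hFa Z.isCompact hU hZU hfU
  obtain ⟨c₂, hc₂, hbw⟩ := (isBigO_bandwidth_pow hθ).exists_pos
  have hsmall := (tendsto_kdeRate d hp).eventually
    (eventually_const_mul_lt c₀ (show 0 < Z.ζ / 8 by linarith [Z.ζ_pos]))
  refine ⟨c₀ + c₁ * c₂, by positivity, ?_⟩
  filter_upwards [hdev] with ω hdev
  filter_upwards [hdev, hh.eventually hbias, hbw.bound, hsmall, hpos,
    hh.eventually (Z.eventually_kdeMean_separated hf hFa hKb hK.1 hKf),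
    eventually_ge_atTop 2] with n hdev hbias hbw hsmall hpos hsep hn
  rw [Real.norm_of_nonneg (by positivity), Real.norm_of_nonneg (kdeRate_pos d p hn).le] at hbw
  rw [add_mul, mul_assoc]
  refine Z.isAccurate_of_kdeMean hsmall.le ?_
    (fun x hx => (hbias x hx).trans (mul_le_mul_of_nonneg_left hbw hc₁)) hsep
  rintro _ ⟨i, hi, rfl⟩
  exact hdev i hi

theorem exists_eventually_resolves [IsProbabilityMeasure P] [Nontrivial (E d)] {U : Set (E d)}
    (hU : IsOpen U) (hZU : Z.carrier ⊆ U) (hp : p ≠ 0) (hfU : ContDiffOn ℝ p f U)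
    (hX : IsSampleFrom P X f) (hf : Measurable f) (hf0 : ∀ x, 0 ≤ f x) (hF : ∀ x, f x ≤ F)
    (hKb : IsBoundedKernel K) (hK : IsKernelOfOrderAtLeast p K) (hpos : ∀ᶠ n in atTop, 0 < h n)
    (hθ : h =Θ[atTop] fun n : ℕ => (Real.log n / n) ^ (1 / ((d : ℝ) + 2 * p)))
    (hKf : (∀ x, 0 ≤ K x) ∨ UniformContinuous f) :
    ∃ M₀ > 0, ∀ M ≥ M₀, ∃ b > 0, ∀ᵐ ω ∂P, ∀ᶠ n in atTop, ∀ t ∈ Set.Icc l u,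
      Resolves f (l - Z.ζ) t (b * levelSetRate d p n)
        (samplePlus K (h n) (M * kdeRate d p n) n (X · ω) t)
        (sampleMinus K (h n) (M * kdeRate d p n) n (X · ω) t) := by
  obtain ⟨c, hc, hacc⟩ :=
    Z.exists_eventually_isAccurate_kde hU hZU hp hfU hX hf hf0 hF hKb hK hpos hθ hKf
  obtain ⟨C, hC, hbox⟩ := hX.exists_eventually_isBoxDense Z.low_pos Z.isBounded
  refine ⟨c, hc, fun M hM => ⟨max C (M + c + 1), lt_max_of_lt_left hC, ?_⟩⟩
  have hsmall := (tendsto_kdeRate d hp).eventually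
    (eventually_const_mul_lt (M + c) (show 0 < Z.ζ / 8 by linarith [Z.ζ_pos]))
  filter_upwards [hacc, hbox] with ω hacc hbox
  filter_upwards [hacc, hbox, hsmall, eventually_ge_atTop 2] with n hacc hbox hsmall hn t ht
  have hρ := kdeRate_pos d p hn
  have hb : 0 ≤ max C (M + c + 1) := (lt_max_of_lt_left hC).le
  have hkde : (M + c + 1) * kdeRate d p n ≤ max C (M + c + 1) * levelSetRate d p n :=
    mul_le_mul (le_max_right _ _) (le_max_left _ _) hρ.le hb
  have hgrid : C * (Real.log n / n) ^ ((2 : ℝ) / (d + 1)) ≤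
      max C (M + c + 1) * levelSetRate d p n :=
    mul_le_mul (le_max_left _ _) (le_max_right _ _)
      (Real.rpow_nonneg (log_div_pos hn).le _) hb
  rw [samplePlus_eq_sep, sampleMinus_eq_sep]
  exact hacc.resolves ht (by positivity) (by gcongr) (by linarith) (by linarith)
    (hbox.mono hgrid)

end SmoothZone

end Estimator

section Segment

variable {V : Type*} [NormedAddCommGroup V] [InnerProductSpace ℝ V]

theorem IsBoxDense.exists_dist_le [Nontrivial V] {A S : Set V} {s : ℝ} (hA : IsBoxDense A S s)
    {x : V} (hx : Metric.closedBall x √s ⊆ S) : ∃ a ∈ A, dist a x ≤ √s := by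
  obtain ⟨e, he⟩ := exists_norm_eq V (zero_le_one' ℝ)
  obtain ⟨a, haA, ha⟩ := hA x e he fun z hz => hx (mem_closedBall_iff_norm.2 hz.2)
  exact ⟨a, haA, (dist_eq_norm a x).trans_le ha.2⟩

theorem exists_endpoint_inner_nonneg {p q z : V} (hz : z ∈ segment ℝ p q) (w : V) :
    ∃ y ∈ ({p, q} : Set V), 0 ≤ ⟪y - z, w⟫_ℝ ∧ ‖y - z‖ ≤ ‖p - q‖ := by
  have hdist := dist_add_dist_of_mem_segment hz
  rw [dist_eq_norm, dist_comm, dist_eq_norm, dist_eq_norm] at hdist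
  by_cases hp : 0 ≤ ⟪p - z, w⟫_ℝ
  · exact ⟨p, by simp, hp, by linarith [norm_nonneg (q - z)]⟩
  refine ⟨q, by simp, ?_, by linarith [norm_nonneg (p - z)]⟩
  obtain ⟨α, β, hα, hβ, hαβ, rfl⟩ := hz
  have hp' : p - (α • p + β • q) = -(β • (q - p)) := by
    rw [← eq_sub_iff_add_eq] at hαβ
    rw [hαβ]
    module
  have hq' : q - (α • p + β • q) = α • (q - p) := by
    rw [← eq_sub_iff_add_eq'] at hαβ
    rw [hαβ]
    module
  rw [hp', inner_neg_left, real_inner_smul_left, not_le] at hp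
  rw [hq', real_inner_smul_left]
  exact mul_nonneg hα (pos_of_mul_pos_right (neg_lt_zero.1 hp) hβ).le

theorem norm_add_smul_le_sub {v w : V} {D ε ρ γ : ℝ} (hε : 0 < ε) (hw : ‖w‖ = 1) (hv : ‖v‖ ≤ D)
    (hvw : 0 ≤ ⟪v, w⟫_ℝ) (hρ : 0 ≤ ρ) (hργ : ρ ≤ γ) (hγ : 2 * D ^ 2 / ε + D + ε ≤ γ) :
    ‖v + (ε / 2 - ρ) • w‖ ≤ γ - ε / 4 := by
  have hD : 0 ≤ D := (norm_nonneg v).trans hv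
  have : 0 ≤ 2 * D ^ 2 / ε := by positivity
  rcases le_or_gt (ε / 2) ρ with h | h
  · have hγε : 2 * D ^ 2 + D * ε + ε * ε ≤ γ * ε := by
      have := mul_le_mul_of_nonneg_right hγ hε.le
      rwa [add_mul, add_mul, div_mul_cancel₀ _ hε.ne'] at this
    have hcross : (ε / 2 - ρ) * ⟪v, w⟫_ℝ ≤ 0 :=
      mul_nonpos_of_nonpos_of_nonneg (by linarith) hvw
    have hvD : ‖v‖ ^ 2 ≤ D ^ 2 := by gcongr
    have hργ' : (ε / 2 - ρ) ^ 2 ≤ (γ - ε / 2) ^ 2 :=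
      sq_le_sq' (by linarith) (by linarith)
    refine abs_le_of_sq_le_sq' ?_ (by linarith) |>.2
    rw [norm_add_sq_real, real_inner_smul_right, norm_smul, hw, mul_one, Real.norm_eq_abs, sq_abs]
    nlinarith [mul_nonneg hD hε.le]
  · refine (norm_add_le _ _).trans ?_
    rw [norm_smul, hw, mul_one, Real.norm_of_nonneg (by linarith)]
    linarith

/-- The endpoint `y` of the segment on the side of `c`, shifted towards `c`, lies well inside the
ball with centre `c`, since a ball with a large radius is almost a half space. -/
theorem mem_rConvexHull_of_mem_segment {d : ℕ} [Nontrivial (E d)] {A : Set (E d)}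
    {p q z z' : E d} {ε γ : ℝ} (hz : z ∈ segment ℝ p q) (hε : 0 < ε)
    (hγ : 2 * ‖p - q‖ ^ 2 / ε + ‖p - q‖ + ε ≤ γ)
    (hA : ∀ y ∈ ({p, q} : Set (E d)), ∀ x, ‖x - y‖ ≤ ε → ∃ a ∈ A, dist a x < ε / 4)
    (hz' : ‖z' - z‖ ≤ ε / 4) : z' ∈ rConvexHull γ A := by
  refine mem_rConvexHull.2 fun c hc => ?_
  obtain ⟨w, hw, hcw⟩ := exists_unit_smul (c - z')
  obtain ⟨y, hy, hyw, hyz⟩ := exists_endpoint_inner_nonneg hz w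
  set x := y + (z' - z) + (ε / 2) • w with hx
  have hxy : ‖x - y‖ ≤ ε := by
    rw [hx, add_assoc, add_sub_cancel_left]
    refine (norm_add_le _ _).trans ?_
    rw [norm_smul, hw, Real.norm_of_nonneg (by positivity)]
    linarith
  obtain ⟨a, haA, hax⟩ := hA y hy x hxy
  have hxc : dist x c ≤ γ - ε / 4 := by
    have hc' : x - c = (y - z) + (ε / 2 - ‖c - z'‖) • w := by
      rw [hx, sub_smul, ← hcw]
      abel
    rw [dist_eq_norm, hc']
    refine norm_add_smul_le_sub hε hw hyz hyw (norm_nonneg _) ?_ hγ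
    rw [← dist_eq_norm, dist_comm]
    exact hc.le
  exact ⟨a, haA, by linarith [dist_triangle a x c]⟩

end Segment

section Nonconvex

variable {d : ℕ} {f : E d → ℝ} {l u t : ℝ}

theorem levelSet_anti {s : ℝ} (h : s ≤ t) : levelSet f t ⊆ levelSet f s := fun _ hx => h.trans hx

namespace SmoothZone

variable (Z : SmoothZone f l u)

theorem add_le_of_norm_sub_le {a z : E d} {τ : ℝ} (ha : a ∈ Z.carrier) (hτ : 0 ≤ τ)
    (hτδ : 2 * τ ≤ Z.δ) (hτk : 9 * Z.k * τ ≤ Z.m)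
    (hz : ‖z - (a - τ • outerNormal f a)‖ ≤ τ / 2) : f a + Z.m / 4 * τ ≤ f z := by
  have hk := Z.k_pos
  have hn := Z.norm_outerNormal ha
  set n := outerNormal f a
  set v := z - (a - τ • n) with hv
  have hza : z - a = v - τ • n := by rw [hv]; abel
  have hnorm : ‖z - a‖ ≤ 3 / 2 * τ := by
    rw [hza]
    refine (norm_sub_le _ _).trans ?_
    rw [norm_smul, hn, Real.norm_of_nonneg hτ]
    linarith
  have hinner : ⟪z - a, n⟫_ℝ ≤ -(τ / 2) := by
    have := real_inner_le_norm v n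
    rw [hn, mul_one] at this
    rw [hza, inner_sub_left, real_inner_smul_left, real_inner_self_eq_norm_sq, hn]
    linarith
  have htaylor := neg_le_of_abs_le (Z.taylor_outerNormal ha (z := z) (by linarith))
  have hlinear : ‖gradient f a‖ * ⟪z - a, n⟫_ℝ ≤ -(Z.m * (τ / 2)) :=
    calc ‖gradient f a‖ * ⟪z - a, n⟫_ℝ ≤ ‖gradient f a‖ * -(τ / 2) := by gcongr
      _ ≤ -(Z.m * (τ / 2)) := by
        rw [mul_neg, neg_le_neg_iff]
        gcongr
        exact Z.m_le a ha
  have hquad : Z.k * ‖z - a‖ ^ 2 ≤ Z.k * (3 / 2 * τ) ^ 2 := by gcongr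
  nlinarith

include Z in
theorem levelSet_subset_closure_iUnion_interior (ht : t ∈ Set.Icc l u) :
    levelSet f t ⊆ closure (⋃ s > t, interior (levelSet f s)) := by
  intro y (hy : t ≤ f y)
  have hζ := Z.ζ_pos
  have hm := Z.m_pos
  by_cases hyZ : y ∈ Z.carrier
  · have hlim : Tendsto (fun τ : ℝ => y - τ • outerNormal f y) (𝓝[>] 0) (𝓝 y) :=
      tendsto_nhdsWithin_of_tendsto_nhds <| Continuous.tendsto' (by fun_prop) _ _ (by simp)
    refine mem_closure_of_tendsto hlim ?_
    filter_upwards [eventually_mem_nhdsWithin, eventually_const_mul_lt 2 Z.δ_pos,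
      eventually_const_mul_lt (9 * Z.k) hm] with τ hτ hτδ hτk
    rw [Set.mem_Ioi] at hτ
    refine Set.mem_iUnion₂.2 ⟨t + Z.m / 4 * τ, lt_add_of_pos_right _ (by positivity), ?_⟩
    refine mem_interior_iff_mem_nhds.2 (mem_of_superset
      (Metric.closedBall_mem_nhds _ (half_pos hτ)) fun z hz => ?_)
    have := Z.add_le_of_norm_sub_le hyZ hτ.le hτδ.le hτk.le (mem_closedBall_iff_norm.1 hz)
    change t + _ ≤ f z
    linarith
  · refine subset_closure (Set.mem_iUnion₂.2 ⟨u + Z.ζ / 2, show t < _ by linarith [ht.2], ?_⟩)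
    have hlow : l - Z.ζ ≤ f y := by linarith [ht.1]
    exact mem_interior_iff_mem_nhds.2 (mem_of_superset (Metric.closedBall_mem_nhds _ Z.δ_pos)
      fun z hz => Z.high_of_notMem y (subset_closure hlow) hyZ z (mem_closedBall_iff_norm.1 hz))

theorem exists_mem_sub_lt_of_isPreconnected {S : Set (E d)} (hS : IsPreconnected S)
    (ht : t ∈ Set.Icc l u) (hne : (S ∩ levelSet f t).Nonempty) (hsub : ¬ S ⊆ levelSet f t) :
    ∃ z ∈ S, l - Z.ζ / 2 < f z ∧ f z < t := by
  have hζ := Z.ζ_pos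
  obtain ⟨η, hη, hnear⟩ := Z.exists_sub_le_or_high_of_near
  by_contra! hcon
  have hnear_mem : Metric.thickening η (levelSet f t) ∩ S ⊆ levelSet f t := by
    rintro y ⟨hy, hyS⟩
    obtain ⟨x, hx : t ≤ f x, hxy⟩ := Metric.mem_thickening_iff.1 hy
    refine hcon y hyS ?_
    rcases hnear x y (dist_eq_norm y x ▸ hxy.le) (by linarith [ht.1]) with h | h <;>
      linarith [ht.1, ht.2]
  have hself := Metric.self_subset_thickening (half_pos hη) (levelSet f t)
  have hthick := Metric.thickening_mono (half_le_self hη.le) (levelSet f t)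
  have hclosure : closure (Metric.thickening (η / 2) (levelSet f t)) ⊆
      Metric.thickening η (levelSet f t) :=
    (Metric.closure_thickening_subset_cthickening _ _).trans
      (Metric.cthickening_subset_thickening' hη (half_lt_self hη) _)
  have hS_sub := hS.subset_of_closure_inter_subset Metric.isOpen_thickening
    (hne.mono (Set.inter_subset_inter_right S hself))
    fun y ⟨hy, hyS⟩ => hself (hnear_mem ⟨hclosure hy, hyS⟩)
  exact hsub fun y hy => hnear_mem ⟨hthick (hS_sub hy), hy⟩

theorem exists_segment_of_not_convex (ht : t ∈ Set.Icc l u) (hconv : ¬ Convex ℝ (levelSet f t)) :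
    ∃ p q, ∃ z ∈ segment ℝ p q, ∃ κ > 0, p ∈ interior (levelSet f (t + κ)) ∧
      q ∈ interior (levelSet f (t + κ)) ∧
      z ∈ interior {x | l - Z.ζ ≤ f x ∧ f x ≤ t - κ} := by
  have hζ := Z.ζ_pos
  set I := ⋃ s > t, interior (levelSet f s)
  have hI : ∃ p ∈ I, ∃ q ∈ I, ¬ segment ℝ p q ⊆ levelSet f t := by
    by_contra! hcon
    refine hconv fun p₀ hp₀ q₀ hq₀ α β hα hβ hαβ => ?_
    have hcont : Continuous (Function.uncurry fun p q : E d => α • p + β • q) := by fun_prop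
    rw [← (Z.isClosed_levelSet ht).closure_eq]
    exact map_mem_closure₂ (f := fun p q : E d => α • p + β • q) hcont
      (Z.levelSet_subset_closure_iUnion_interior ht hp₀)
      (Z.levelSet_subset_closure_iUnion_interior ht hq₀)
      fun p hp q hq => hcon p hp q hq ⟨α, β, hα, hβ, hαβ, rfl⟩
  obtain ⟨p, hp, q, hq, hpq⟩ := hI
  obtain ⟨t₁, ht₁, hp⟩ := Set.mem_iUnion₂.1 hp
  obtain ⟨t₂, ht₂, hq⟩ := Set.mem_iUnion₂.1 hq
  obtain ⟨z, hz, hlz, hzt⟩ := Z.exists_mem_sub_lt_of_isPreconnected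
    (convex_segment p q).isPreconnected ht
    ⟨p, left_mem_segment ℝ p q, levelSet_anti (le_of_lt ht₁) (interior_subset hp)⟩ hpq
  have hcont := Z.continuousAt (Z.mem_carrier (x := z) (by linarith) (by linarith [ht.2]))
  refine ⟨p, q, z, hz, min (min (t₁ - t) (t₂ - t)) ((t - f z) / 2), ?_, ?_, ?_, ?_⟩
  · exact lt_min (lt_min (sub_pos.2 ht₁) (sub_pos.2 ht₂)) (by linarith)
  · exact interior_mono (levelSet_anti (by grind)) hp
  · exact interior_mono (levelSet_anti (by grind)) hq
  · refine mem_interior_iff_mem_nhds.2 ?_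
    filter_upwards [hcont.eventually_mem (Ioo_mem_nhds (show l - Z.ζ < f z by linarith)
      (show f z < t - (t - f z) / 2 by linarith))] with x hx
    exact ⟨hx.1.le, hx.2.le.trans (by grind)⟩

variable [Nontrivial (E d)]

theorem exists_mem_nhds_radius_le (ht : t ∈ Set.Icc l u) (hconv : ¬ Convex ℝ (levelSet f t)) :
    ∃ N ∈ 𝓝 t, ∃ R, ∀ᶠ s in 𝓝[>] 0, ∀ t' ∈ N, ∀ A B, Resolves f (l - Z.ζ) t' s A B →
      ∀ γ, Disjoint (rConvexHull γ A) B → γ ≤ R := by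
  obtain ⟨p, q, z, hzpq, κ, hκ, hp, hq, hz⟩ := Z.exists_segment_of_not_convex ht hconv
  simp only [mem_interior_iff_mem_nhds] at hp hq hz
  obtain ⟨ε, hε, hε_sub⟩ : ∃ ε > 0, Metric.closedBall p (2 * ε) ⊆ levelSet f (t + κ) ∧
      Metric.closedBall q (2 * ε) ⊆ levelSet f (t + κ) ∧
      Metric.closedBall z ε ⊆ {x | l - Z.ζ ≤ f x ∧ f x ≤ t - κ} := by
    obtain ⟨ε₁, hε₁, hpε⟩ := Metric.nhds_basis_closedBall.mem_iff.1 hp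
    obtain ⟨ε₂, hε₂, hqε⟩ := Metric.nhds_basis_closedBall.mem_iff.1 hq
    obtain ⟨ε₃, hε₃, hzε⟩ := Metric.nhds_basis_closedBall.mem_iff.1 hz
    exact ⟨min (ε₁ / 2) (min (ε₂ / 2) ε₃), by positivity,
      (Metric.closedBall_subset_closedBall (by grind)).trans hpε,
      (Metric.closedBall_subset_closedBall (by grind)).trans hqε,
      (Metric.closedBall_subset_closedBall (by grind)).trans hzε⟩
  obtain ⟨hpε, hqε, hzε⟩ := hε_sub
  refine ⟨Set.Ioo (t - κ / 2) (t + κ / 2), Ioo_mem_nhds (by linarith) (by linarith),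
    2 * ‖p - q‖ ^ 2 / ε + ‖p - q‖ + ε, ?_⟩
  filter_upwards [eventually_const_mul_lt 2 hκ, eventually_const_mul_sqrt_lt 4 hε]
    with s hsκ hsε t' ⟨ht'₁, ht'₂⟩ A B hAB γ hγ
  by_contra! hcon
  have hA : ∀ y ∈ ({p, q} : Set (E d)), ∀ x, ‖x - y‖ ≤ ε → ∃ a ∈ A, dist a x < ε / 4 := by
    intro y hy x hx
    have hyε : Metric.closedBall y (2 * ε) ⊆ levelSet f (t' + s) := by
      refine Set.Subset.trans ?_ (levelSet_anti (show t' + s ≤ t + κ by linarith))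
      rcases hy with rfl | rfl
      exacts [hpε, hqε]
    have hxy : Metric.closedBall x √s ⊆ Metric.closedBall y (2 * ε) :=
      Metric.closedBall_subset_closedBall' (by rw [dist_eq_norm]; linarith)
    obtain ⟨a, haA, ha⟩ := hAB.inner_dense.exists_dist_le (hxy.trans hyε)
    exact ⟨a, haA, by linarith⟩
  obtain ⟨b, hbB, hb⟩ := hAB.outer_dense.exists_dist_le (x := z) fun x hx =>
    have h := hzε (Metric.closedBall_subset_closedBall (by linarith) hx)
    ⟨h.1, h.2.trans (by linarith)⟩
  refine Set.disjoint_left.1 hγ (mem_rConvexHull_of_mem_segment hzpq hε hcon.le hA ?_) hbB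
  rw [← dist_eq_norm]
  linarith

theorem exists_radius_le (hconv : ∀ t ∈ Set.Icc l u, ¬ Convex ℝ (levelSet f t)) :
    ∃ R, ∀ᶠ s in 𝓝[>] 0, ∀ t ∈ Set.Icc l u, ∀ A B, Resolves f (l - Z.ζ) t s A B →
      ∀ γ, Disjoint (rConvexHull γ A) B → γ ≤ R := by
  refine isCompact_Icc.induction_on (p := fun S => ∃ R, ∀ᶠ s in 𝓝[>] 0, ∀ t ∈ S, ∀ A B,
    Resolves f (l - Z.ζ) t s A B → ∀ γ, Disjoint (rConvexHull γ A) B → γ ≤ R) ?_ ?_ ?_ ?_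
  · exact ⟨0, by simp⟩
  · rintro S T hST ⟨R, hR⟩
    exact ⟨R, hR.mono fun s hs t ht => hs t (hST ht)⟩
  · rintro S T ⟨R, hR⟩ ⟨R', hR'⟩
    refine ⟨max R R', ?_⟩
    filter_upwards [hR, hR'] with s hS hT t ht A B hAB γ hγ
    exact ht.elim (fun ht => le_max_of_le_left (hS t ht A B hAB γ hγ))
      fun ht => le_max_of_le_right (hT t ht A B hAB γ hγ)
  · intro t ht
    obtain ⟨N, hN, hR⟩ := Z.exists_mem_nhds_radius_le ht (hconv t ht)
    exact ⟨N, mem_nhdsWithin_of_mem_nhds hN, hR⟩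

end SmoothZone

end Nonconvex

section ShapeParameter

variable {d : ℕ} {A B : Set (E d)} {r R ν : ℝ}

/-- The supremum of the radii for which the hull of `A` avoids `B`; for the plus and minus samples
it is `rHat`. As there, a supremum over an empty or unbounded set of radii is `0`. -/
noncomputable def separationRadius (A B : Set (E d)) : ℝ :=
  sSup {γ : ℝ | 0 < γ ∧ rConvexHull γ A ∩ B = ∅}

theorem disjoint_of_lt_separationRadius (hr : 0 < r) (h : r < separationRadius A B) :
    Disjoint (rConvexHull r A) B := by
  have hne : {γ : ℝ | 0 < γ ∧ rConvexHull γ A ∩ B = ∅}.Nonempty := by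
    by_contra! hempty
    rw [separationRadius, hempty, Real.sSup_empty] at h
    exact h.not_gt hr
  obtain ⟨γ, ⟨-, hγ⟩, hrγ⟩ := exists_lt_of_lt_csSup hne h
  exact (Set.disjoint_iff_inter_eq_empty.2 hγ).mono_left (rConvexHull_mono_radius hr hrγ.le)

theorem separationRadius_mem_Icc (hr : 0 < r) (hdisj : Disjoint (rConvexHull r A) B)
    (hR : ∀ γ, Disjoint (rConvexHull γ A) B → γ ≤ R) : separationRadius A B ∈ Set.Icc r R := by
  have hmem : r ∈ {γ : ℝ | 0 < γ ∧ rConvexHull γ A ∩ B = ∅} := ⟨hr, hdisj.inter_eq⟩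
  have hle : ∀ γ ∈ {γ : ℝ | 0 < γ ∧ rConvexHull γ A ∩ B = ∅}, γ ≤ R := fun γ hγ =>
    hR γ (Set.disjoint_iff_inter_eq_empty.2 hγ.2)
  exact ⟨le_csSup ⟨R, hle⟩ hmem, csSup_le ⟨r, hmem⟩ hle⟩

theorem mul_separationRadius_mem_Icc (hr : 0 < r) (hdisj : Disjoint (rConvexHull r A) B)
    (hR : ∀ γ, Disjoint (rConvexHull γ A) B → γ ≤ R) (hν : ν ∈ Set.Ioo (0 : ℝ) 1) :
    ν * separationRadius A B ∈ Set.Icc (ν * r) R ∧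
      Disjoint (rConvexHull (ν * separationRadius A B / ((1 + ν) / 2)) A) B := by
  obtain ⟨hlow, hhigh⟩ := separationRadius_mem_Icc hr hdisj hR
  obtain ⟨hν0, hν1⟩ := hν
  have hpos := hr.trans_le hlow
  refine ⟨⟨by gcongr, (mul_le_of_le_one_left hpos.le hν1.le).trans hhigh⟩, ?_⟩
  refine disjoint_of_lt_separationRadius (by positivity) ?_
  rw [div_lt_iff₀ (by positivity), mul_comm]
  gcongr
  linarith

end ShapeParameter

section Error

variable {d : ℕ} {f : E d → ℝ} {l u : ℝ}

theorem symmDiff_levelSet_subset {H : Set (E d)} {t ε ε' : ℝ} (hε : 0 ≤ ε) (hε' : 0 ≤ ε')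
    (hout : ∀ x ∈ H, t - ε ≤ f x) (hin : levelSet f (t + ε') ⊆ H) :
    symmDiff H (levelSet f t) ⊆ {x | t - ε ≤ f x ∧ f x ≤ t - ε + (ε + ε')} := by
  rintro x (⟨hx, hxG⟩ | ⟨hxG : t ≤ f x, hx⟩)
  · have : f x < t := not_le.1 hxG
    exact ⟨hout x hx, by linarith⟩
  · have : f x < t + ε' := not_le.1 fun h => hx (hin h)
    exact ⟨by linarith, by linarith⟩

namespace SmoothZone

variable (Z : SmoothZone f l u)

theorem disjoint_rConvexHull [Nontrivial (E d)] {t s γ : ℝ} {A B : Set (E d)}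
    (ht : t ∈ Set.Icc l u) (hne : (levelSet f t).Nonempty)
    (hAB : Resolves f (l - Z.ζ) t s A B) (hγ : 0 < γ) (hγδ : 2 * γ ≤ Z.δ)
    (hγm : 2 * Z.k * γ ≤ Z.m) : Disjoint (rConvexHull γ A) B :=
  Set.disjoint_left.2 fun x hxA hxB => (hAB.outer_lt x hxB).not_ge <|
    Z.rConvexHull_levelSet_subset ht hne hγ hγδ hγm (rConvexHull_mono_set hAB.inner_subset hxA)

theorem eventually_exists_levelSet_add_dist_le : ∀ᶠ ε in 𝓝[>] 0, ∀ t ∈ Set.Icc l u,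
    ∀ y ∈ levelSet f t, ∃ y' ∈ levelSet f (t + ε), dist y y' ≤ 4 / Z.m * ε := by
  have hm := Z.m_pos
  filter_upwards [eventually_mem_nhdsWithin, eventually_const_mul_lt 1 (half_pos Z.ζ_pos),
    eventually_const_mul_lt (2 * (4 / Z.m)) Z.δ_pos,
    eventually_const_mul_lt (9 * Z.k * (4 / Z.m)) hm] with ε hε hεζ hεδ hεk t ht y (hy : t ≤ f y)
  rw [Set.mem_Ioi] at hε
  rcases le_or_gt (t + ε) (f y) with h | h
  · exact ⟨y, h, by rw [dist_self]; positivity⟩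
  have hyZ : y ∈ Z.carrier := Z.mem_carrier (by linarith [ht.1, Z.ζ_pos]) (by linarith [ht.2])
  set τ := 4 / Z.m * ε with hτ
  have hτ0 : 0 < τ := by positivity
  refine ⟨y - τ • outerNormal f y, ?_, ?_⟩
  · have hgain := Z.add_le_of_norm_sub_le hyZ hτ0.le (by linarith) (by linarith)
      (z := y - τ • outerNormal f y) (by simpa using (half_pos hτ0).le)
    have hτm : Z.m / 4 * τ = ε := by rw [hτ]; field_simp
    change t + ε ≤ f _
    linarith
  · rw [dist_eq_norm, sub_sub_cancel, norm_smul, Z.norm_outerNormal hyZ, mul_one,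
      Real.norm_of_nonneg hτ0.le]

theorem exists_rConvexHull_estimates [Nontrivial (E d)]
    (hconv : ∀ t ∈ Set.Icc l u, ¬ Convex ℝ (levelSet f t)) {ν : ℝ} (hν : ν ∈ Set.Ioo (0 : ℝ) 1) :
    ∃ C₁ > 0, ∃ C₂ > 0, ∀ᶠ s in 𝓝[>] 0, ∀ t ∈ Set.Icc l u, ∀ A B,
      Resolves f (l - Z.ζ) t s A B →
      (∀ x ∈ rConvexHull (ν * separationRadius A B) A,
        t - C₁ * s ≤ f x ∧ ∃ y ∈ levelSet f t, dist x y ≤ C₁ * s) ∧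
      levelSet f (t + C₂ * s) ⊆ rConvexHull (ν * separationRadius A B) A := by
  obtain ⟨r, hr, hrδ, hrm⟩ := (eventually_mem_nhdsWithin.and <| (eventually_const_mul_lt 2
    Z.δ_pos).and <| eventually_const_mul_lt (2 * Z.k) Z.m_pos).exists
  rw [Set.mem_Ioi] at hr
  obtain ⟨hν0, hν1⟩ := hν
  have hνr : 0 < ν * r := by positivity
  obtain ⟨R, hR⟩ := Z.exists_radius_le hconv
  obtain ⟨C₁, hC₁, hout⟩ := Z.exists_near_levelSet_of_mem_rConvexHull (R := R) hνr
    (show 0 < (1 + ν) / 2 by positivity) (by linarith)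
  obtain ⟨C₂, hC₂, hin⟩ := Z.exists_levelSet_subset_rConvexHull hνr
  refine ⟨C₁, hC₁, C₂, hC₂, ?_⟩
  filter_upwards [hR, hout, hin] with s hR hout hin t ht A B hAB
  have hne : (levelSet f t).Nonempty :=
    Set.nonempty_iff_ne_empty.2 fun h => hconv t ht (h ▸ convex_empty)
  obtain ⟨hmem, hdisj⟩ := mul_separationRadius_mem_Icc hr
    (Z.disjoint_rConvexHull ht hne hAB hr hrδ.le hrm.le) (hR t ht A B hAB) ⟨hν0, hν1⟩
  exact ⟨hout t ht hne A hAB.inner_subset B hAB.inner_dense hAB.outer_dense _ hmem hdisj,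
    hin t ht A hAB.inner_dense _ hmem.1⟩

theorem exists_hausdorffEDist_le_and_volume_le [Nontrivial (E d)] (hf : Measurable f)
    (hconv : ∀ t ∈ Set.Icc l u, ¬ Convex ℝ (levelSet f t)) {ν : ℝ} (hν : ν ∈ Set.Ioo (0 : ℝ) 1) :
    ∃ C, ∀ᶠ s in 𝓝[>] 0, ∀ t ∈ Set.Icc l u, ∀ A B, Resolves f (l - Z.ζ) t s A B →
      Metric.hausdorffEDist (rConvexHull (ν * separationRadius A B) A) (levelSet f t) ≤
        ENNReal.ofReal (C * s) ∧
      volume (symmDiff (rConvexHull (ν * separationRadius A B) A) (levelSet f t)) ≤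
        ENNReal.ofReal (C * s) := by
  obtain ⟨C₁, hC₁, C₂, hC₂, hhull⟩ := Z.exists_rConvexHull_estimates hconv hν
  obtain ⟨C₃, -, hvol⟩ := Z.volume_strip_le hf
  refine ⟨max (max C₁ (4 / Z.m * C₂)) (C₃ * (C₁ + C₂)), ?_⟩
  filter_upwards [eventually_mem_nhdsWithin, hhull,
    (tendsto_const_mul_nhdsGT_zero hC₂).eventually Z.eventually_exists_levelSet_add_dist_le,
    (tendsto_const_mul_nhdsGT_zero (add_pos hC₁ hC₂)).eventually hvol,
    eventually_const_mul_lt C₁ Z.ζ_pos, eventually_const_mul_lt C₂ (half_pos Z.ζ_pos)]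
    with s hs hhull hinward hvol hs₁ hs₂ t ht A B hAB
  rw [Set.mem_Ioi] at hs
  obtain ⟨hout, hin⟩ := hhull t ht A B hAB
  have hle {c : ℝ} (hc : c ≤ max (max C₁ (4 / Z.m * C₂)) (C₃ * (C₁ + C₂))) :
      ENNReal.ofReal (c * s) ≤
        ENNReal.ofReal (max (max C₁ (4 / Z.m * C₂)) (C₃ * (C₁ + C₂)) * s) := by gcongr
  constructor
  · refine Metric.hausdorffEDist_le_of_mem_edist (fun x hx => ?_) fun y hy => ?_
    · obtain ⟨y, hy, hxy⟩ := (hout x hx).2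
      exact ⟨y, hy, (edist_le_ofReal (by positivity)).2 hxy |>.trans (hle (by simp))⟩
    · obtain ⟨y', hy', hyy'⟩ := hinward t ht y hy
      rw [← mul_assoc] at hyy'
      have := Z.m_pos
      exact ⟨y', hin hy', (edist_le_ofReal (by positivity)).2 hyy' |>.trans (hle (by simp))⟩
  · calc volume (symmDiff _ (levelSet f t))
        ≤ volume {x | t - C₁ * s ≤ f x ∧ f x ≤ t - C₁ * s + (C₁ + C₂) * s} := by
          rw [add_mul]
          exact measure_mono (symmDiff_levelSet_subset (by positivity) (by positivity)
            (fun x hx => (hout x hx).1) hin)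
      _ ≤ ENNReal.ofReal (C₃ * ((C₁ + C₂) * s)) :=
          hvol _ (by linarith [ht.1]) (by linarith [ht.2])
      _ ≤ _ := by
          rw [← mul_assoc]
          exact hle (le_max_right _ _)

end SmoothZone

end Error

theorem IsBoundedKernel.of_continuous {d : ℕ} {K : E d → ℝ} (hK : Continuous K)
    (hsupp : HasCompactSupport K) : IsBoundedKernel K where
  measurable := hK.measurable
  exists_bound := hsupp.exists_bound_of_continuous hK
  hasCompactSupport := hsupp

end LevelSetEstimation

open LevelSetEstimation in
theorem theorem3p2_general {d p : ℕ} (hp : p ≠ 0) {f : E d → ℝ} (hf : Measurable f)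
    (hf_nonneg : ∀ x, 0 ≤ f x) {l u : ℝ}
    (hconv : ∀ t ∈ Set.Icc l u, ¬ Convex ℝ (levelSet f t)) (hA : AssumptionA p f l u)
    {K : E d → ℝ} (hKb : IsBoundedKernel K) (hK : IsKernelOfOrderAtLeast p K) {h : ℕ → ℝ}
    (hpos : ∀ᶠ n in atTop, 0 < h n)
    (hθ : h =Θ[atTop] fun n : ℕ => (Real.log n / n) ^ (1 / ((d : ℝ) + 2 * p)))
    (hKf : (∀ x, 0 ≤ K x) ∨ UniformContinuous f)
    {Ω : Type*} [MeasurableSpace Ω] {P : Measure Ω} [IsProbabilityMeasure P]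
    {X : ℕ → Ω → E d} (hX : IsSampleFrom P X f) :
    ∃ M₀ > (0 : ℝ), ∀ M ≥ M₀, ∀ ν ∈ Set.Ioo (0 : ℝ) 1, ∃ C : ℝ, ∀ᵐ ω ∂P, ∀ᶠ n : ℕ in atTop,
      (⨆ t ∈ Set.Icc l u, Metric.hausdorffEDist
          (levelSetEstimator K (h n) (M * kdeRate d p n) ν n (fun i => X i ω) t)
          (levelSet f t)) ≤ ENNReal.ofReal (C * levelSetRate d p n) ∧
      (⨆ t ∈ Set.Icc l u, volume (symmDiff
          (levelSetEstimator K (h n) (M * kdeRate d p n) ν n (fun i => X i ω) t)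
          (levelSet f t))) ≤ ENNReal.ofReal (C * levelSetRate d p n) := by
  have : Nontrivial (E d) := by
    by_contra! hsub
    exact hconv l ⟨le_rfl, hA.1⟩ Set.subsingleton_of_subsingleton.convex
  obtain ⟨F, hF⟩ := hA.2.1
  obtain ⟨Z, U, hU, hZU, hfU⟩ := hA.exists_smoothZone hp hf_nonneg
  obtain ⟨M₀, hM₀, hres⟩ := Z.exists_eventually_resolves hU hZU hp hfU hX hf hf_nonneg
    (fun x => hF ⟨x, rfl⟩) hKb hK hpos hθ hKf
  refine ⟨M₀, hM₀, fun M hM ν hν => ?_⟩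
  obtain ⟨b, hb, hres⟩ := hres M hM
  obtain ⟨C, hC⟩ := Z.exists_hausdorffEDist_le_and_volume_le hf hconv hν
  have hrate := (tendsto_const_mul_nhdsGT_zero hb).comp (tendsto_levelSetRate d hp)
  refine ⟨C * b, ?_⟩
  filter_upwards [hres] with ω hω
  filter_upwards [hω, hrate.eventually hC] with n hn hC
  rw [mul_assoc]
  exact ⟨iSup₂_le fun t ht => (hC t ht _ _ (hn t ht)).1,
    iSup₂_le fun t ht => (hC t ht _ _ (hn t ht)).2⟩

theorem theorem3p2 {d p : ℕ} (hp : 1 ≤ p)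
    (f : LevelSetEstimation.E d → ℝ) (hf_meas : Measurable f) (hf_nonneg : ∀ x, 0 ≤ f x)
    (l u : ℝ)
    (hG : ∀ t ∈ Set.Icc l u,
      IsCompact (LevelSetEstimation.levelSet f t) ∧ (LevelSetEstimation.levelSet f t).Nonempty ∧
        ¬ Convex ℝ (LevelSetEstimation.levelSet f t))
    (hA : LevelSetEstimation.AssumptionA p f l u)
    (K : LevelSetEstimation.E d → ℝ) (h : ℕ → ℝ)
    (hK : LevelSetEstimation.AssumptionK p K h)
    (hKf : (∀ x, 0 ≤ K x) ∨ UniformContinuous f)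
    {Ω : Type*} [MeasurableSpace Ω] (P : Measure Ω) [IsProbabilityMeasure P]
    (X : ℕ → Ω → LevelSetEstimation.E d) (hX : LevelSetEstimation.IsSampleFrom P X f) :
    ∃ M₀ > (0 : ℝ), ∀ M ≥ M₀, ∀ ν ∈ Set.Ioo (0 : ℝ) 1, ∃ C : ℝ, ∀ᵐ ω ∂P, ∀ᶠ n : ℕ in atTop,
      (⨆ t ∈ Set.Icc l u, Metric.hausdorffEDist
          (LevelSetEstimation.levelSetEstimator K (h n) (M * LevelSetEstimation.kdeRate d p n) ν n
            (fun i => X i ω) t)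
          (LevelSetEstimation.levelSet f t)) ≤
        ENNReal.ofReal (C * LevelSetEstimation.levelSetRate d p n) ∧
      (⨆ t ∈ Set.Icc l u, volume (symmDiff
          (LevelSetEstimation.levelSetEstimator K (h n) (M * LevelSetEstimation.kdeRate d p n) ν n
            (fun i => X i ω) t)
          (LevelSetEstimation.levelSet f t))) ≤
        ENNReal.ofReal (C * LevelSetEstimation.levelSetRate d p n) := by
  obtain ⟨hcont, hsupp, hord, -, hpos, hθ⟩ := hK
  exact theorem3p2_general (Nat.one_le_iff_ne_zero.1 hp) hf_meas hf_nonneg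
    (fun t ht => (hG t ht).2.2) hA (.of_continuous hcont hsupp) hord hpos hθ hKf hX
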